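/- Let $\mathbb{C}P^2$ carry the Fubini--Study metric of constant holomorphic sectional curvature $4$, and let $f:\mathbb{C}\to\mathbb{C}P^2$ be a conformally parametrized minimal Lagrangian immersion, $z=x+iy$, with induced metric $2e^{u}\,dz\,d\bar z$, which is translationally equivariant: $f(z+t)=R(t)f(z)$ for all $t\in\mathbb{R}$, $z\in\mathbb{C}$, with a one-parameter subgroup $R$ of $SU(3)$. Then $u$ depends only on $y$ and the Hopf differential $F_{zz}\cdot\overline{F_{\bar z}}\,dz^3$ ($F$ a horizontal lift of $f$ to $S^5\subset\mathbb{C}^3$) has a constant coefficient; write this coefficient as $-i\lambda^{-3}\psi$ with $|\lambda|=1$. Put $$a_1=e^{u(0)},\quad \beta=2a_1+\frac{|\psi|^2}{a_1^2},\quad a_{2,3}=\tfrac12\Big(\pm(\tfrac\beta2-a_1)+\sqrt{(\tfrac\beta2-a_1)^2+4a_1(\tfrac\beta2-a_1)}\Big),$$ and assume that the origin is chosen so that $u'(0)=0$ and $a_2<a_1$ (for a non-flat surface with $\psi\ne0$ this can always be achieved by a translation in $y$). Let $$T=\frac{K}{r},\qquad r=\sqrt{2(a_1+a_3)},\qquad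 K=\int_0^{\pi/2}\frac{d\theta}{\sqrt{1-k^2\sin^2\theta}},\qquad k^2=\frac{a_1-a_2}{a_1+a_3},$$ so that $2T$ is the smallest positive period of $u(y)$. A frame of $f$ is a smooth map $\mathbb{F}:\mathbb{C}\to SU(3)$ with $f=[\mathbb{F}e_3]$ and $$\mathbb{F}^{-1}\mathbb{F}_z=\begin{pmatrix}\frac{u_z}{2}&0&i\lambda^{-1}e^{u/2}\\-i\lambda^{-1}\psi e^{-u}&-\frac{u_z}{2}&0\\0&i\lambda^{-1}e^{u/2}&0\end{pmatrix},\qquad \mathbb{F}^{-1}\mathbb{F}_{\bar z}=\begin{pmatrix}-\frac{u_{\bar z}}{2}&-i\lambda\bar\psi e^{-u}&0\\0&\frac{u_{\bar z}}{2}&i\lambda e^{u/2}\\i\lambda e^{u/2}&0&0\end{pmatrix};$$ then $F=\mathbb{F}e_3$ is the canonical horizontal lift of $f$. Let $id_1,id_2,id_3$ ($d_j\in\mathbb{R}$), in any order, be the eigenvalues of $$D=\mathbb{F}(0)^{-1}\partial_x\mathbb{F}(0)=\begin{pmatrix}0&-i\lambda\bar\psi e^{-u(0)}&i\lambda^{-1}e^{u(0)/2}\\-i\lambda^{-1}\psi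 e^{-u(0)}&0&i\lambda e^{u(0)/2}\\i\lambda e^{u(0)/2}&i\lambda^{-1}e^{u(0)/2}&0\end{pmatrix}.$$ **Theorem.** Assume that $\lambda^{-3}\psi$ is neither real nor purely imaginary. Then $f$ has a frame; for all $j$ and $y$ one has $d_je^{u(y)}-\mathrm{Re}(\lambda^{-3}\psi)\neq0$, and $$h_j(y)=\left(\frac{d_je^{u(y)}-\mathrm{Re}(\lambda^{-3}\psi)}{d_j^3-\mathrm{Re}(\lambda^{-3}\psi)}\right)^{1/2},\qquad G_j(y)=\int_0^y\frac{d_j\,\mathrm{Im}(\lambda^{-3}\psi)}{d_je^{u(s)}-\mathrm{Re}(\lambda^{-3}\psi)}\,ds$$ are well defined, with a positive radicand. For every frame $\mathbb{F}$ of $f$ there is an orthonormal basis $l_1,l_2,l_3$ of $\mathbb{C}^3$ with $Dl_j=id_jl_j$ such that $$F(x+iy)=\mathbb{F}(0)\sum_{j=1}^3h_j(y)\,e^{id_jx+iG_j(y)}\,l_j\qquad(x,y\in\mathbb{R});$$ in particular $F=\sum_jh_je^{id_jx+iG_j}l_j$ if $\mathbb{F}(0)=I$, which can be achieved by an isometry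 of $\mathbb{C}P^2$. Moreover, $f$ descends to a torus (that is, $f$ has two periods in $\mathbb{C}$ that are linearly independent over $\mathbb{R}$) if and only if both $$\frac{d_1}{d_2}\qquad\text{and}\qquad\frac1{2\pi}\Big(\frac{d_2}{d_1}G_1(2T)-G_2(2T)\Big)$$ are rational. -/

import Mathlib

open scoped ContDiff LinearAlgebra.Projectivization

noncomputable section

namespace MinLag

/-! ### Differential operators and the Hermitian product -/

/-- The Hermitian product `Z · W̄ = ∑ₖ zₖ * conj wₖ` on `ℂ³`. -/
def hdot (Z W : Fin 3 → ℂ) : ℂ := ∑ k, Z k * (starRingEnd ℂ) (W k)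

section Operators

variable {E : Type} [NormedAddCommGroup E] [NormedSpace ℝ E]

/-- `∂g/∂x` for a function of `z = x + i y`. -/
def dX (g : ℂ → E) (z : ℂ) : E := fderiv ℝ g z 1

/-- `∂g/∂y` for a function of `z = x + i y`. -/
def dY (g : ℂ → E) (z : ℂ) : E := fderiv ℝ g z Complex.I

/-- `∂g/∂z = (∂g/∂x - i ∂g/∂y) / 2`. -/
def dZ [Module ℂ E] (g : ℂ → E) (z : ℂ) : E :=
  (1 / 2 : ℂ) • (dX g z - Complex.I • dY g z)

/-- `∂g/∂z̄ = (∂g/∂x + i ∂g/∂y) / 2`. -/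
def dZbar [Module ℂ E] (g : ℂ → E) (z : ℂ) : E :=
  (1 / 2 : ℂ) • (dX g z + Complex.I • dY g z)

end Operators

/-! ### Minimal Lagrangian immersions of `ℂ` into `ℂP²`

`ℂP² = ℙ ℂ (Fin 3 → ℂ)` carries the Fubini-Study metric of holomorphic sectional curvature 4,
that is, the Hopf map `S⁵(1) → ℂP²` is a Riemannian submersion: at `p ∈ S⁵` the tangent space of
`ℂP²` at `[p]` is identified with the Hermitian orthogonal complement of `p`, with
metric `Re (v · w̄)` and Kähler form `Im (v · w̄)` (up to sign). -/

/-- The horizontal part of `v` at the point `p` of the unit sphere. -/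
def hor (p v : Fin 3 → ℂ) : Fin 3 → ℂ := v - hdot v p • p

/-- `F` is a smooth lift of `f` to the unit sphere `S⁵`. -/
def IsSphereLift (f : ℂ → ℙ ℂ (Fin 3 → ℂ)) (F : ℂ → Fin 3 → ℂ) : Prop :=
  ContDiff ℝ ∞ F ∧ ∀ z, hdot (F z) (F z) = 1 ∧ F z ∈ (f z).submodule

/-- `F` is a smooth horizontal lift of `f` to the unit sphere `S⁵`. -/
def IsHorizontalLift (f : ℂ → ℙ ℂ (Fin 3 → ℂ)) (F : ℂ → Fin 3 → ℂ) : Prop :=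
  IsSphereLift f F ∧ ∀ z, hdot (dX F z) (F z) = 0 ∧ hdot (dY F z) (F z) = 0

/-- `f` is a smooth conformal Lagrangian immersion with induced metric
`2 e^u dz dz̄ = 2 e^u (dx² + dy²)`. (A smooth map from the contractible surface `ℂ` to
`ℂP²` is the same as a map that has a smooth lift to `S⁵`. The two vectors
`hor F F_x`, `hor F F_y` represent `∂f/∂x` and `∂f/∂y`.) -/
def IsConformalLagrangian (f : ℂ → ℙ ℂ (Fin 3 → ℂ)) (u : ℂ → ℝ) : Prop :=
  ∃ F : ℂ → Fin 3 → ℂ, IsSphereLift f F ∧ ∀ z,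
    (hdot (hor (F z) (dX F z)) (hor (F z) (dX F z))).re = 2 * Real.exp (u z) ∧
    (hdot (hor (F z) (dY F z)) (hor (F z) (dY F z))).re = 2 * Real.exp (u z) ∧
    (hdot (hor (F z) (dX F z)) (hor (F z) (dY F z))).re = 0 ∧
    (hdot (hor (F z) (dX F z)) (hor (F z) (dY F z))).im = 0

/-- The mean curvature vector of the conformal Lagrangian immersion `f` vanishes: for a horizontal
lift `F` (it exists, since `f` is Lagrangian and `ℂ` is simply connected, and it is unique up
to a constant phase) the trace `F_xx + F_yy` has no component along the normal vectors of `f`,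
i.e. along the horizontal vectors that are real orthogonal to `F_x` and `F_y`. -/
def HasZeroMeanCurvature (f : ℂ → ℙ ℂ (Fin 3 → ℂ)) : Prop :=
  ∀ F : ℂ → Fin 3 → ℂ, IsHorizontalLift f F → ∀ (z : ℂ) (N : Fin 3 → ℂ),
    hdot N (F z) = 0 → (hdot N (dX F z)).re = 0 → (hdot N (dY F z)).re = 0 →
      (hdot (dX (dX F) z + dY (dY F) z) N).re = 0

/-- `f` is a conformally parametrized minimal Lagrangian immersion of `ℂ` with metric
`2 e^u dz dz̄`. -/
def IsMinimalLagrangian (f : ℂ → ℙ ℂ (Fin 3 → ℂ)) (u : ℂ → ℝ) : Prop :=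
  IsConformalLagrangian f u ∧ HasZeroMeanCurvature f

/-- The Hopf differential of `f` is `φ dz³`: `φ = F_zz · conj F_z̄` for the horizontal lifts
`F` of `f` (it does not depend on the horizontal lift). -/
def HasHopfDifferential (f : ℂ → ℙ ℂ (Fin 3 → ℂ)) (φ : ℂ → ℂ) : Prop :=
  ∀ F : ℂ → Fin 3 → ℂ, IsHorizontalLift f F → ∀ z, hdot (dZ (dZ F) z) (dZbar F z) = φ z

/-- `f` is translationally equivariant: `f (z + t) = R(t) f(z)` for all real `t`, with a (continuous)
one-parameter subgroup `R` of `SU(3)`. -/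
def IsTranslationallyEquivariant (f : ℂ → ℙ ℂ (Fin 3 → ℂ)) : Prop :=
  ∃ R : ℝ → Matrix.SpecialLinearGroup (Fin 3) ℂ,
    (∀ t, (R t : Matrix (Fin 3) (Fin 3) ℂ) ∈ Matrix.unitaryGroup (Fin 3) ℂ) ∧
    Continuous (fun t => (R t : Matrix (Fin 3) (Fin 3) ℂ)) ∧
    (∀ s t, R (s + t) = R s * R t) ∧
    ∀ (z : ℂ) (t : ℝ), f (z + t) = R t • f z

/-- `f` descends to a torus: it has two periods that are linearly independent over `ℝ`. -/
def DescendsToTorus (f : ℂ → ℙ ℂ (Fin 3 → ℂ)) : Prop :=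
  ∃ ω₁ ω₂ : ℂ, LinearIndependent ℝ ![ω₁, ω₂] ∧
    (∀ z, f (z + ω₁) = f z) ∧ (∀ z, f (z + ω₂) = f z)

/-! ### The extended frame -/

/-- The matrix `λ⁻¹ U₋₁ + U₀`, where `e = e^{u/2}`, `p = ψ e^{-u}` and `uz = ∂u/∂z`. -/
def matU (lam e p uz : ℂ) : Matrix (Fin 3) (Fin 3) ℂ :=
  !![uz / 2, 0, lam⁻¹ * (Complex.I * e);
     -(lam⁻¹ * (Complex.I * p)), -(uz / 2), 0;
     0, lam⁻¹ * (Complex.I * e), 0]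

/-- The matrix `λ V₁ + V₀`, where `e = e^{u/2}`, `pbar = conj ψ e^{-u}` and `uzbar = ∂u/∂z̄`. -/
def matV (lam e pbar uzbar : ℂ) : Matrix (Fin 3) (Fin 3) ℂ :=
  !![-(uzbar / 2), -(lam * (Complex.I * pbar)), 0;
     0, uzbar / 2, lam * (Complex.I * e);
     lam * (Complex.I * e), 0, 0]

/-- The third column of a frame. -/
def canonicalLift (Fr : ℂ → Matrix (Fin 3) (Fin 3) ℂ) (z : ℂ) : Fin 3 → ℂ := fun i => Fr z i 2

/-- `Fr : ℂ → SU(3)` is the frame of `f` at the loop parameter `λ`: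
`Fr⁻¹ Fr_z = λ⁻¹ U₋₁ + U₀`, `Fr⁻¹ Fr_z̄ = λ V₁ + V₀` and `[Fr e₃] = f`. -/
structure IsFrame (f : ℂ → ℙ ℂ (Fin 3 → ℂ)) (u : ℂ → ℝ) (ψ : ℂ → ℂ) (lam : ℂ)
    (Fr : ℂ → Matrix (Fin 3) (Fin 3) ℂ) : Prop where
  smooth : ∀ i j, ContDiff ℝ ∞ (fun z => Fr z i j)
  special_unitary : ∀ z, Fr z ∈ Matrix.specialUnitaryGroup (Fin 3) ℂ
  deriv_z : ∀ z i j, dZ (fun w => Fr w i j) z =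
    (Fr z * matU lam (Real.exp (u z / 2)) (ψ z * Real.exp (-u z))
      (dZ (fun w => (u w : ℂ)) z)) i j
  deriv_zbar : ∀ z i j, dZbar (fun w => Fr w i j) z =
    (Fr z * matV lam (Real.exp (u z / 2)) ((starRingEnd ℂ) (ψ z) * Real.exp (-u z))
      (dZbar (fun w => (u w : ℂ)) z)) i j
  lifts : ∀ z, canonicalLift Fr z ∈ (f z).submodule

/-- The generating matrix `D(λ) = Fr(0)⁻¹ (∂Fr/∂x)(0)` for `u₀ = u(0)`, `u'(0) = 0`,
written out explicitly. -/
def matD (lam : ℂ) (u₀ : ℝ) (ψ₀ : ℂ) : Matrix (Fin 3) (Fin 3) ℂ :=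
  let e : ℂ := Real.exp (u₀ / 2)
  let q : ℂ := Real.exp (-u₀)
  !![0, -(Complex.I * lam * (starRingEnd ℂ) ψ₀ * q), Complex.I * lam⁻¹ * e;
     -(Complex.I * lam⁻¹ * ψ₀ * q), 0, Complex.I * lam * e;
     Complex.I * lam * e, Complex.I * lam⁻¹ * e, 0]

/-! ### The half period of the metric

All constants are functions of `a₁ = e^{u(0)}` and of `c = |ψ|`. -/

/-- `β = 2 a₁ + |ψ|² / a₁²`. -/
def betaConst (a₁ c : ℝ) : ℝ := 2 * a₁ + c ^ 2 / a₁ ^ 2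

/-- `a₂`, the smaller positive root of `w³ - (β / 2) w² + |ψ|² / 2` if `a₁` is the larger one. -/
def a2Const (a₁ c : ℝ) : ℝ :=
  (betaConst a₁ c / 2 - a₁ +
    √((betaConst a₁ c / 2 - a₁) ^ 2 + 4 * a₁ * (betaConst a₁ c / 2 - a₁))) / 2

/-- `a₃`, where `-a₃` is the negative root of the same cubic polynomial. -/
def a3Const (a₁ c : ℝ) : ℝ :=
  (-(betaConst a₁ c / 2 - a₁) +
    √((betaConst a₁ c / 2 - a₁) ^ 2 + 4 * a₁ * (betaConst a₁ c / 2 - a₁))) / 2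

/-- `k²`, the square of the modulus. -/
def modulusSq (a₁ c : ℝ) : ℝ := (a₁ - a2Const a₁ c) / (a₁ + a3Const a₁ c)

/-- The complete elliptic integral of the first kind, as a function of `k²`. -/
def ellipticK (ksq : ℝ) : ℝ := ∫ θ in (0 : ℝ)..(Real.pi / 2), 1 / √(1 - ksq * Real.sin θ ^ 2)

/-- `T = K / r` with `r = √(2 (a₁ + a₃))`; the smallest period of the metric in `y` is `2 T`. -/
def halfPeriod (a₁ c : ℝ) : ℝ := ellipticK (modulusSq a₁ c) / √(2 * (a₁ + a3Const a₁ c))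

/-! ### The functions `h_j` and `G_j` -/

/-- `h(y) = ((d w(y) - Re c) / (d³ - Re c))^{1/2}`. -/
def hFun (w : ℝ → ℝ) (c : ℂ) (d y : ℝ) : ℝ := √((d * w y - c.re) / (d ^ 3 - c.re))

/-- `G(y) = ∫₀^y d Im c / (d w(s) - Re c) ds`. -/
def gFun (w : ℝ → ℝ) (c : ℂ) (d y : ℝ) : ℝ := ∫ s in (0 : ℝ)..y, d * c.im / (d * w s - c.re)

end MinLag

end

noncomputable section

namespace MinLag

/-! ### Calculus of the operators `∂/∂x`, `∂/∂y`, `∂/∂z`, `∂/∂z̄` -/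

section Calculus

variable {E : Type} [NormedAddCommGroup E] [NormedSpace ℝ E]

/-! Write c = λ⁻³ψ, ρ = Re c and w = e^u. A horizontal lift F exists because the Lagrangian
condition closes the 1-form that measures the vertical part of dF. Then F_z, F_z̄, F is an
orthogonal basis of ℂ³, and conformality, minimality and the Hopf coefficient φ give F_zz̄ = -e^u F
and F_zz = u_z F_z + φ e^{-u} F_z̄. Normalising this basis produces a frame. Equivariance is used
only to see that u does not depend on x and that φ, being also holomorphic, is constant.

The coefficient matrices of a frame are therefore independent of x, so F_x = A F with the constant
skew-Hermitian matrix A = Fr(0) D Fr(0)* (`IsFrame.dX_canonicalLift`). In an orthonormal eigenbasis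
of A the coordinates P_j of F satisfy ∂_x P_j = i d_j P_j. The relations |F|² = 1, F_x·F = 0, |F_x|²
= 2w are a Vandermonde system for the |P_j|²; its solution is the radicand of h_j
(`coord_mul_conj`). In the same way F_y·F, F_y·F_x, F_y·F_xx determine (∂_y P_j) conj P_j
(`dY_coord_mul_conj`), hence the logarithmic derivative of P_j in y, which is that of h_j e^{iG_j}.
The quotients are unimodular constants, absorbed into the l_j. The two conditions on c make the d_j
distinct and nonzero and keep d_j w - ρ away from zero.

The Gauss equation has the first integral w'² = -8 (w - a₁)(w - a₂)(w + a₃), so w = a₁ - (a₁ - a₂)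
sin²θ with θ a Jacobi amplitude, and w takes its maximum exactly on the integer multiples of 2T
(`periodic_of_second_order`). A period ω of f preserves all |P_j|, so Im ω = 2Tn, and the three
phases d_j Re ω + n G_j(2T) agree modulo 2π. Since ∑ d_j = 0 and ∑ G_j(2T) = 0 (`sum_gFun`), the
common phase factor is a cube root of unity. So, up to a factor 3, periods are integral solutions of
linear equations in the d_j and G_j(2T), and two independent solutions exist exactly under the two
rationality conditions (`descendsToTorus_iff`). -/

theorem contDiff_dX {g : ℂ → E} (hg : ContDiff ℝ ∞ g) : ContDiff ℝ ∞ (dX g) :=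
  (hg.fderiv_right (m := ∞) (by simp)).clm_apply contDiff_const

theorem contDiff_dY {g : ℂ → E} (hg : ContDiff ℝ ∞ g) : ContDiff ℝ ∞ (dY g) :=
  (hg.fderiv_right (m := ∞) (by simp)).clm_apply contDiff_const

theorem ContDiff.diffAt {g : ℂ → E} (hg : ContDiff ℝ ∞ g) (z : ℂ) : DifferentiableAt ℝ g z :=
  (hg.differentiable (by simp)) z

theorem dY_dX {g : ℂ → E} (hg : ContDiff ℝ ∞ g) (z : ℂ) : dY (dX g) z = dX (dY g) z := by
  have h1 : ContDiff ℝ ∞ (fderiv ℝ g) := hg.fderiv_right (m := ∞) (by simp)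
  have h2 : IsSymmSndFDerivAt ℝ g z := by
    apply ContDiffAt.isSymmSndFDerivAt (n := ∞) hg.contDiffAt
    simpa using ENat.LEInfty.out (m := 2)
  have h3 : ∀ v : ℂ, fderiv ℝ (fun w => fderiv ℝ g w v) z = (fderiv ℝ (fderiv ℝ g) z).flip v := by
    intro v
    ext t
    rw [fderiv_clm_apply (ContDiff.diffAt h1 z) (differentiableAt_const v)]
    simp
  have := h2.eq 1 Complex.I
  show fderiv ℝ (fun w => fderiv ℝ g w 1) z Complex.I = fderiv ℝ (fun w => fderiv ℝ g w Complex.I) z 1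
  rw [h3, h3]
  simpa using this.symm

theorem fderiv_eq_zero_of_dX_dY {g : ℂ → E} {z : ℂ} (h1 : dX g z = 0) (h2 : dY g z = 0) :
    fderiv ℝ g z = 0 := by
  ext t
  have : t = t.re • (1 : ℂ) + t.im • Complex.I := by simp
  rw [this, map_add, map_smul, map_smul]
  have h1' : fderiv ℝ g z 1 = 0 := h1
  have h2' : fderiv ℝ g z Complex.I = 0 := h2
  simp [h1', h2']

theorem eq_of_dX_dY_eq_zero {g : ℂ → E} (hg : Differentiable ℝ g) (h1 : ∀ z, dX g z = 0)
    (h2 : ∀ z, dY g z = 0) (z z' : ℂ) : g z = g z' :=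
  is_const_of_fderiv_eq_zero hg (fun w => fderiv_eq_zero_of_dX_dY (h1 w) (h2 w)) z z'

theorem hasDerivAt_line_x {g : ℂ → E} {z : ℂ} {x : ℝ} (hg : DifferentiableAt ℝ g (z + x)) :
    HasDerivAt (fun t : ℝ => g (z + t)) (dX g (z + x)) x := by
  have h : HasDerivAt (fun t : ℝ => z + (t : ℂ)) 1 x := by
    simpa using (Complex.ofRealCLM.hasDerivAt (x := x)).const_add z
  exact hg.hasFDerivAt.comp_hasDerivAt x h

theorem hasDerivAt_line_y {g : ℂ → E} {z : ℂ} {y : ℝ}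
    (hg : DifferentiableAt ℝ g (z + y * Complex.I)) :
    HasDerivAt (fun t : ℝ => g (z + t * Complex.I)) (dY g (z + y * Complex.I)) y := by
  have h : HasDerivAt (fun t : ℝ => z + (t : ℂ) * Complex.I) Complex.I y := by
    simpa using ((Complex.ofRealCLM.hasDerivAt (x := y)).mul_const Complex.I).const_add z
  exact hg.hasFDerivAt.comp_hasDerivAt y h

theorem hasDerivAt_imag_axis {g : ℂ → E} (hg : ContDiff ℝ ∞ g) (y : ℝ) :
    HasDerivAt (fun t : ℝ => g (t * Complex.I)) (dY g (y * Complex.I)) y := by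
  simpa using hasDerivAt_line_y (g := g) (z := 0) (y := y) (ContDiff.diffAt hg _)

theorem dX_translate (g : ℂ → E) (a z : ℂ) : dX (fun w => g (w + a)) z = dX g (z + a) := by
  simp only [dX]; rw [fderiv_comp_add_right]

theorem dY_translate (g : ℂ → E) (a z : ℂ) : dY (fun w => g (w + a)) z = dY g (z + a) := by
  simp only [dY]; rw [fderiv_comp_add_right]

theorem dX_const (a : E) (z : ℂ) : dX (fun _ => a) z = 0 := by simp [dX]

theorem dY_const (a : E) (z : ℂ) : dY (fun _ => a) z = 0 := by simp [dY]

theorem dX_clm {E' : Type} [NormedAddCommGroup E'] [NormedSpace ℝ E'] (L : E →L[ℝ] E') {g : ℂ → E}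
    {z : ℂ} (hg : DifferentiableAt ℝ g z) : dX (fun w => L (g w)) z = L (dX g z) := by
  have := (L.hasFDerivAt.comp z hg.hasFDerivAt).fderiv
  simp only [dX]; change fderiv ℝ (L ∘ g) z 1 = _; rw [this]; rfl

theorem dY_clm {E' : Type} [NormedAddCommGroup E'] [NormedSpace ℝ E'] (L : E →L[ℝ] E') {g : ℂ → E}
    {z : ℂ} (hg : DifferentiableAt ℝ g z) : dY (fun w => L (g w)) z = L (dY g z) := by
  have := (L.hasFDerivAt.comp z hg.hasFDerivAt).fderiv
  simp only [dY]; change fderiv ℝ (L ∘ g) z Complex.I = _; rw [this]; rfl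

theorem dX_ofReal {u : ℂ → ℝ} {z : ℂ} (hu : DifferentiableAt ℝ u z) :
    dX (fun w => (u w : ℂ)) z = (dX u z : ℝ) := dX_clm Complex.ofRealCLM hu

theorem dY_ofReal {u : ℂ → ℝ} {z : ℂ} (hu : DifferentiableAt ℝ u z) :
    dY (fun w => (u w : ℂ)) z = (dY u z : ℝ) := dY_clm Complex.ofRealCLM hu

theorem contDiff_ofReal {u : ℂ → ℝ} (hu : ContDiff ℝ ∞ u) : ContDiff ℝ ∞ (fun w => (u w : ℂ)) :=
  Complex.ofRealCLM.contDiff.comp hu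

theorem dX_add {g h : ℂ → E} {z : ℂ} (hg : DifferentiableAt ℝ g z) (hh : DifferentiableAt ℝ h z) :
    dX (fun w => g w + h w) z = dX g z + dX h z := by
  simp only [dX]; rw [fderiv_fun_add hg hh]; rfl

theorem dY_add {g h : ℂ → E} {z : ℂ} (hg : DifferentiableAt ℝ g z) (hh : DifferentiableAt ℝ h z) :
    dY (fun w => g w + h w) z = dY g z + dY h z := by
  simp only [dY]; rw [fderiv_fun_add hg hh]; rfl

end Calculus

/-! ### Wirtinger calculus for maps into complex vector spaces -/

section ComplexCalculus

variable {E : Type} [NormedAddCommGroup E] [NormedSpace ℂ E]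

theorem dX_smul {a : ℂ → ℂ} {g : ℂ → E} {z : ℂ} (ha : DifferentiableAt ℝ a z)
    (hg : DifferentiableAt ℝ g z) :
    dX (fun w => a w • g w) z = dX a z • g z + a z • dX g z := by
  simp only [dX]; rw [fderiv_fun_smul ha hg]; simp [add_comm]

theorem dY_smul {a : ℂ → ℂ} {g : ℂ → E} {z : ℂ} (ha : DifferentiableAt ℝ a z)
    (hg : DifferentiableAt ℝ g z) :
    dY (fun w => a w • g w) z = dY a z • g z + a z • dY g z := by
  simp only [dY]; rw [fderiv_fun_smul ha hg]; simp [add_comm]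

theorem dZ_smul {a : ℂ → ℂ} {g : ℂ → E} {z : ℂ} (ha : DifferentiableAt ℝ a z)
    (hg : DifferentiableAt ℝ g z) :
    dZ (fun w => a w • g w) z = dZ a z • g z + a z • dZ g z := by
  simp only [dZ]; rw [dX_smul ha hg, dY_smul ha hg]; module

theorem dZbar_smul {a : ℂ → ℂ} {g : ℂ → E} {z : ℂ} (ha : DifferentiableAt ℝ a z)
    (hg : DifferentiableAt ℝ g z) :
    dZbar (fun w => a w • g w) z = dZbar a z • g z + a z • dZbar g z := by
  simp only [dZbar]; rw [dX_smul ha hg, dY_smul ha hg]; module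

theorem contDiff_dZ {g : ℂ → E} (hg : ContDiff ℝ ∞ g) : ContDiff ℝ ∞ (dZ g) :=
  ((contDiff_dX hg).sub ((contDiff_dY hg).const_smul Complex.I)).const_smul (1 / 2 : ℂ)

theorem contDiff_dZbar {g : ℂ → E} (hg : ContDiff ℝ ∞ g) : ContDiff ℝ ∞ (dZbar g) :=
  ((contDiff_dX hg).add ((contDiff_dY hg).const_smul Complex.I)).const_smul (1 / 2 : ℂ)

theorem dX_const_smul (a : ℂ) {g : ℂ → E} {z : ℂ} (hg : DifferentiableAt ℝ g z) :
    dX (fun w => a • g w) z = a • dX g z := by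
  rw [dX_smul (differentiableAt_const a) hg, dX_const]; simp

theorem dY_const_smul (a : ℂ) {g : ℂ → E} {z : ℂ} (hg : DifferentiableAt ℝ g z) :
    dY (fun w => a • g w) z = a • dY g z := by
  rw [dY_smul (differentiableAt_const a) hg, dY_const]; simp

theorem dZ_const_smul (a : ℂ) {g : ℂ → E} {z : ℂ} (hg : DifferentiableAt ℝ g z) :
    dZ (fun w => a • g w) z = a • dZ g z := by
  simp only [dZ]; rw [dX_const_smul a hg, dY_const_smul a hg]; module

theorem dZbar_const_smul (a : ℂ) {g : ℂ → E} {z : ℂ} (hg : DifferentiableAt ℝ g z) :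
    dZbar (fun w => a • g w) z = a • dZbar g z := by
  simp only [dZbar]; rw [dX_const_smul a hg, dY_const_smul a hg]; module

theorem dX_eq_dZ_add_dZbar (g : ℂ → E) (z : ℂ) : dX g z = dZ g z + dZbar g z := by
  simp only [dZ, dZbar]; module

theorem dY_eq_dZ_sub_dZbar (g : ℂ → E) (z : ℂ) :
    dY g z = Complex.I • (dZ g z - dZbar g z) := by
  simp only [dZ, dZbar, ← smul_sub, smul_smul]
  have : dX g z - Complex.I • dY g z - (dX g z + Complex.I • dY g z)
      = (-2 * Complex.I) • dY g z := by module
  rw [this, smul_smul]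
  have : Complex.I * (1 / 2) * (-2 * Complex.I) = 1 := by linear_combination -Complex.I_mul_I
  rw [this, one_smul]

theorem dX_dZ {g : ℂ → E} (hg : ContDiff ℝ ∞ g) (z : ℂ) :
    dX (dZ g) z = (1 / 2 : ℂ) • (dX (dX g) z - Complex.I • dX (dY g) z) := by
  have h1 := ContDiff.diffAt (contDiff_dX hg) z
  have h2 := ContDiff.diffAt (contDiff_dY hg) z
  have : dZ g = fun w => (1 / 2 : ℂ) • (dX g w + (-Complex.I) • dY g w) := by
    ext w; simp only [dZ]; module
  rw [this, dX_const_smul _ (h1.fun_add (h2.fun_const_smul _)), dX_add h1 (h2.fun_const_smul _),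
    dX_const_smul _ h2]
  module

theorem dY_dZ {g : ℂ → E} (hg : ContDiff ℝ ∞ g) (z : ℂ) :
    dY (dZ g) z = (1 / 2 : ℂ) • (dY (dX g) z - Complex.I • dY (dY g) z) := by
  have h1 := ContDiff.diffAt (contDiff_dX hg) z
  have h2 := ContDiff.diffAt (contDiff_dY hg) z
  have : dZ g = fun w => (1 / 2 : ℂ) • (dX g w + (-Complex.I) • dY g w) := by
    ext w; simp only [dZ]; module
  rw [this, dY_const_smul _ (h1.fun_add (h2.fun_const_smul _)), dY_add h1 (h2.fun_const_smul _),
    dY_const_smul _ h2]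
  module

theorem dX_dZbar {g : ℂ → E} (hg : ContDiff ℝ ∞ g) (z : ℂ) :
    dX (dZbar g) z = (1 / 2 : ℂ) • (dX (dX g) z + Complex.I • dX (dY g) z) := by
  have h1 := ContDiff.diffAt (contDiff_dX hg) z
  have h2 := ContDiff.diffAt (contDiff_dY hg) z
  show dX (fun w => (1 / 2 : ℂ) • (dX g w + Complex.I • dY g w)) z = _
  rw [dX_const_smul _ (h1.fun_add (h2.fun_const_smul _)), dX_add h1 (h2.fun_const_smul _),
    dX_const_smul _ h2]

theorem dY_dZbar {g : ℂ → E} (hg : ContDiff ℝ ∞ g) (z : ℂ) :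
    dY (dZbar g) z = (1 / 2 : ℂ) • (dY (dX g) z + Complex.I • dY (dY g) z) := by
  have h1 := ContDiff.diffAt (contDiff_dX hg) z
  have h2 := ContDiff.diffAt (contDiff_dY hg) z
  show dY (fun w => (1 / 2 : ℂ) • (dX g w + Complex.I • dY g w)) z = _
  rw [dY_const_smul _ (h1.fun_add (h2.fun_const_smul _)), dY_add h1 (h2.fun_const_smul _),
    dY_const_smul _ h2]

theorem dZbar_dZ_eq {g : ℂ → E} (hg : ContDiff ℝ ∞ g) (z : ℂ) :
    dZbar (dZ g) z = (1 / 4 : ℂ) • (dX (dX g) z + dY (dY g) z) := by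
  have hI : Complex.I * Complex.I = -1 := Complex.I_mul_I
  rw [dZbar, dX_dZ hg, dY_dZ hg, dY_dX hg]
  simp only [smul_sub, smul_add, smul_smul]
  match_scalars <;> first | ring1 | linear_combination (-1 / 4 : ℂ) * hI

theorem dZ_dZbar {g : ℂ → E} (hg : ContDiff ℝ ∞ g) (z : ℂ) :
    dZ (dZbar g) z = dZbar (dZ g) z := by
  have hI : Complex.I * Complex.I = -1 := Complex.I_mul_I
  rw [dZbar_dZ_eq hg, dZ, dX_dZbar hg, dY_dZbar hg, dY_dX hg]
  simp only [smul_sub, smul_add, smul_smul]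
  match_scalars <;> first | ring1 | linear_combination (-1 / 4 : ℂ) * hI

end ComplexCalculus

/-! ### The Hermitian product -/

theorem hdot_eq (Z W : Fin 3 → ℂ) : hdot Z W = Z 0 * (starRingEnd ℂ) (W 0) +
    Z 1 * (starRingEnd ℂ) (W 1) + Z 2 * (starRingEnd ℂ) (W 2) := by
  simp [hdot, Fin.sum_univ_three]

theorem hdot_add_left (Z Z' W : Fin 3 → ℂ) : hdot (Z + Z') W = hdot Z W + hdot Z' W := by
  simp only [hdot_eq, Pi.add_apply]; ring

theorem hdot_add_right (Z W W' : Fin 3 → ℂ) : hdot Z (W + W') = hdot Z W + hdot Z W' := by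
  simp only [hdot_eq, Pi.add_apply, map_add]; ring

theorem hdot_sub_left (Z Z' W : Fin 3 → ℂ) : hdot (Z - Z') W = hdot Z W - hdot Z' W := by
  simp only [hdot_eq, Pi.sub_apply]; ring

theorem hdot_sub_right (Z W W' : Fin 3 → ℂ) : hdot Z (W - W') = hdot Z W - hdot Z W' := by
  simp only [hdot_eq, Pi.sub_apply, map_sub]; ring

theorem hdot_smul_left (a : ℂ) (Z W : Fin 3 → ℂ) : hdot (a • Z) W = a * hdot Z W := by
  simp only [hdot_eq, Pi.smul_apply, smul_eq_mul]; ring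

theorem hdot_smul_right (a : ℂ) (Z W : Fin 3 → ℂ) :
    hdot Z (a • W) = (starRingEnd ℂ) a * hdot Z W := by
  simp only [hdot_eq, Pi.smul_apply, smul_eq_mul, map_mul]; ring

theorem hdot_neg_left (Z W : Fin 3 → ℂ) : hdot (-Z) W = -hdot Z W := by
  simp only [hdot_eq, Pi.neg_apply]; ring

theorem hdot_neg_right (Z W : Fin 3 → ℂ) : hdot Z (-W) = -hdot Z W := by
  simp only [hdot_eq, Pi.neg_apply, map_neg]; ring

theorem conj_hdot (Z W : Fin 3 → ℂ) : (starRingEnd ℂ) (hdot Z W) = hdot W Z := by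
  simp only [hdot_eq, map_add, map_mul, Complex.conj_conj]; ring

theorem hdot_eq_zero_comm {Z W : Fin 3 → ℂ} (h : hdot Z W = 0) : hdot W Z = 0 := by
  rw [← conj_hdot, h, map_zero]

theorem hdot_sum_left {ι : Type*} (s : Finset ι) (Z : ι → Fin 3 → ℂ) (W : Fin 3 → ℂ) :
    hdot (∑ j ∈ s, Z j) W = ∑ j ∈ s, hdot (Z j) W := by
  classical
  induction s using Finset.induction_on with
  | empty => simp [hdot]
  | insert a s ha ih => rw [Finset.sum_insert ha, Finset.sum_insert ha, hdot_add_left, ih]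

theorem hdot_self_eq_zero {Z : Fin 3 → ℂ} (h : hdot Z Z = 0) : Z = 0 := by
  simp only [hdot, Complex.mul_conj] at h
  have h' : ∑ k, Complex.normSq (Z k) = 0 := by exact_mod_cast h
  rw [Finset.sum_eq_zero_iff_of_nonneg (fun i _ => Complex.normSq_nonneg _)] at h'
  ext k
  simpa using h' k (Finset.mem_univ k)

theorem hdot_self_im (Z : Fin 3 → ℂ) : (hdot Z Z).im = 0 := by
  have := conj_hdot Z Z
  exact Complex.conj_eq_iff_im.mp this

theorem hdot_self_re_nonneg (Z : Fin 3 → ℂ) : 0 ≤ (hdot Z Z).re := by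
  simp only [hdot, Complex.mul_conj]
  rw [← Complex.ofReal_sum, Complex.ofReal_re]
  exact Finset.sum_nonneg fun i _ => Complex.normSq_nonneg _

theorem contDiff_hdot {F G : ℂ → Fin 3 → ℂ} (hF : ContDiff ℝ ∞ F) (hG : ContDiff ℝ ∞ G) :
    ContDiff ℝ ∞ (fun z => hdot (F z) (G z)) := by
  rw [contDiff_pi] at hF hG
  unfold hdot
  refine ContDiff.sum fun k _ => (hF k).mul ?_
  exact Complex.conjCLE.contDiff.comp (hG k)

theorem fderiv_hdot {F G : ℂ → Fin 3 → ℂ} {z : ℂ} (hF : DifferentiableAt ℝ F z)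
    (hG : DifferentiableAt ℝ G z) (v : ℂ) :
    fderiv ℝ (fun w => hdot (F w) (G w)) z v =
      hdot (fderiv ℝ F z v) (G z) + hdot (F z) (fderiv ℝ G z v) := by
  have hF' := hasFDerivAt_pi'.mp hF.hasFDerivAt
  have hG' := hasFDerivAt_pi'.mp hG.hasFDerivAt
  have h : ∀ k, HasFDerivAt (fun w => F w k * (starRingEnd ℂ) (G w k)) _ z := fun k =>
    (hF' k).mul ((Complex.conjCLE.toContinuousLinearMap.hasFDerivAt).comp z (hG' k))
  have h2 : HasFDerivAt (fun w => hdot (F w) (G w)) _ z := HasFDerivAt.fun_sum (u := Finset.univ) fun k _ => h k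
  rw [h2.fderiv]
  simp [hdot, Fin.sum_univ_three]
  ring

theorem dX_hdot {F G : ℂ → Fin 3 → ℂ} {z : ℂ} (hF : DifferentiableAt ℝ F z)
    (hG : DifferentiableAt ℝ G z) :
    dX (fun w => hdot (F w) (G w)) z = hdot (dX F z) (G z) + hdot (F z) (dX G z) :=
  fderiv_hdot hF hG 1

theorem dY_hdot {F G : ℂ → Fin 3 → ℂ} {z : ℂ} (hF : DifferentiableAt ℝ F z)
    (hG : DifferentiableAt ℝ G z) :
    dY (fun w => hdot (F w) (G w)) z = hdot (dY F z) (G z) + hdot (F z) (dY G z) :=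
  fderiv_hdot hF hG Complex.I

theorem dZ_hdot {F G : ℂ → Fin 3 → ℂ} {z : ℂ} (hF : DifferentiableAt ℝ F z)
    (hG : DifferentiableAt ℝ G z) :
    dZ (fun w => hdot (F w) (G w)) z = hdot (dZ F z) (G z) + hdot (F z) (dZbar G z) := by
  simp only [dZ, dZbar, hdot_smul_left, hdot_smul_right, hdot_sub_left, hdot_add_right,
    dX_hdot hF hG, dY_hdot hF hG, smul_eq_mul, map_div₀, map_one, map_ofNat, Complex.conj_I]
  ring

theorem dZbar_hdot {F G : ℂ → Fin 3 → ℂ} {z : ℂ} (hF : DifferentiableAt ℝ F z)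
    (hG : DifferentiableAt ℝ G z) :
    dZbar (fun w => hdot (F w) (G w)) z = hdot (dZbar F z) (G z) + hdot (F z) (dZ G z) := by
  simp only [dZ, dZbar, hdot_smul_left, hdot_smul_right, hdot_sub_right, hdot_add_left,
    dX_hdot hF hG, dY_hdot hF hG, smul_eq_mul, map_div₀, map_one, map_ofNat, Complex.conj_I]
  ring

/-! ### Horizontal lifts -/

/-- Poincaré lemma in the plane: the closed 1-form p dx + q dy is exact. It supplies the phase that
makes a lift horizontal. -/
theorem exists_primitive {p q : ℂ → ℝ} (hp : ContDiff ℝ ∞ p) (hq : ContDiff ℝ ∞ q)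
    (h : ∀ z, dY p z = dX q z) :
    ∃ θ : ℂ → ℝ, ContDiff ℝ ∞ θ ∧ (∀ z, dX θ z = p z) ∧ ∀ z, dY θ z = q z := by
  set η : ℂ → ℂ →L[ℝ] ℝ := fun z => p z • Complex.reCLM + q z • Complex.imCLM with hη
  have hηs : ContDiff ℝ ∞ η := (hp.smul contDiff_const).add (hq.smul contDiff_const)
  have hsplit : ∀ (g : ℂ → ℝ) (a t : ℂ), fderiv ℝ g a t = t.re * dX g a + t.im * dY g a := by
    intro g a t
    have : t = t.re • (1 : ℂ) + t.im • Complex.I := by simp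
    conv_lhs => rw [this, map_add, map_smul, map_smul]
    rfl
  have hη' : ∀ a x y, fderiv ℝ η a x y = fderiv ℝ p a x * y.re + fderiv ℝ q a x * y.im := by
    intro a x y
    have h1 := ((ContDiff.diffAt hp a).hasFDerivAt.smul_const Complex.reCLM).add
      ((ContDiff.diffAt hq a).hasFDerivAt.smul_const Complex.imCLM)
    have h2 : fderiv ℝ η a = _ := h1.fderiv
    rw [h2]
    simp
  obtain ⟨θ, hθ⟩ := (convex_univ (𝕜 := ℝ) (E := ℂ)).exists_forall_hasFDerivAt_of_fderiv_symmetric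
    isOpen_univ (hηs.differentiable (by simp)).differentiableOn (by
      intro a _ x y
      rw [hη', hη', hsplit p, hsplit q, hsplit p, hsplit q, h a]
      ring)
  have hθ' : ∀ a, HasFDerivAt θ (η a) a := fun a => hθ a trivial
  refine ⟨θ, ?_, fun z => ?_, fun z => ?_⟩
  · rw [contDiff_infty_iff_fderiv]
    refine ⟨fun a => (hθ' a).differentiableAt, ?_⟩
    have : fderiv ℝ θ = η := funext fun a => (hθ' a).fderiv
    rw [this]; exact hηs
  · simp [dX, (hθ' z).fderiv, hη]
  · simp [dY, (hθ' z).fderiv, hη]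

theorem eq_hdot_smul_of_mem_submodule {p : ℙ ℂ (Fin 3 → ℂ)} {v w : Fin 3 → ℂ}
    (hv : v ∈ p.submodule) (hw : w ∈ p.submodule) (h1 : hdot w w = 1) : v = hdot v w • w := by
  rw [Projectivization.submodule_eq, Submodule.mem_span_singleton] at hv hw
  obtain ⟨a, rfl⟩ := hv
  obtain ⟨b, rfl⟩ := hw
  rw [smul_smul]
  congr 1
  simp only [hdot_smul_left, hdot_smul_right] at h1 ⊢
  linear_combination (-a) * h1

theorem eq_of_mem_submodule {p q : ℙ ℂ (Fin 3 → ℂ)} {v : Fin 3 → ℂ} (hv : v ≠ 0)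
    (hp : v ∈ p.submodule) (hq : v ∈ q.submodule) : p = q := by
  have key : ∀ r : ℙ ℂ (Fin 3 → ℂ), v ∈ r.submodule → r = Projectivization.mk ℂ v hv := by
    intro r hr
    rw [Projectivization.submodule_eq, Submodule.mem_span_singleton] at hr
    obtain ⟨a, ha⟩ := hr
    conv_lhs => rw [← Projectivization.mk_rep r]
    rw [eq_comm, Projectivization.mk_eq_mk_iff']
    exact ⟨a, ha⟩
  rw [key p hp, key q hq]

/-- A horizontal lift together with the relations expressing that it is conformal and
Lagrangian with metric `2 e^u dz dz̄`. -/
structure IsConformalLift (f : ℂ → ℙ ℂ (Fin 3 → ℂ)) (u : ℂ → ℝ) (H : ℂ → Fin 3 → ℂ) : Prop where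
  lift : IsHorizontalLift f H
  xx : ∀ z, hdot (dX H z) (dX H z) = 2 * (Real.exp (u z) : ℂ)
  yy : ∀ z, hdot (dY H z) (dY H z) = 2 * (Real.exp (u z) : ℂ)
  xy : ∀ z, hdot (dX H z) (dY H z) = 0

theorem hdot_dX_re {F : ℂ → Fin 3 → ℂ} (hF : ContDiff ℝ ∞ F) (h1 : ∀ z, hdot (F z) (F z) = 1)
    (z : ℂ) : (hdot (dX F z) (F z)).re = 0 := by
  have h := dX_hdot (ContDiff.diffAt hF z) (ContDiff.diffAt hF z)
  rw [funext h1, dX_const, ← conj_hdot (dX F z) (F z)] at h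
  have := congrArg Complex.re h
  simp only [Complex.zero_re, Complex.add_re, Complex.conj_re] at this
  linarith

theorem hdot_dY_re {F : ℂ → Fin 3 → ℂ} (hF : ContDiff ℝ ∞ F) (h1 : ∀ z, hdot (F z) (F z) = 1)
    (z : ℂ) : (hdot (dY F z) (F z)).re = 0 := by
  have h := dY_hdot (ContDiff.diffAt hF z) (ContDiff.diffAt hF z)
  rw [funext h1, dY_const, ← conj_hdot (dY F z) (F z)] at h
  have := congrArg Complex.re h
  simp only [Complex.zero_re, Complex.add_re, Complex.conj_re] at this
  linarith

/-- The vertical part of dF is i(p dx + q dy) times F. The form p dx + q dy is closed because the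
surface is Lagrangian, so it has a primitive θ, and e^{-iθ} F has no vertical part. -/
theorem exists_isConformalLift {f : ℂ → ℙ ℂ (Fin 3 → ℂ)} {u : ℂ → ℝ}
    (hf : IsConformalLagrangian f u) : ∃ H, IsConformalLift f u H := by
  obtain ⟨F, ⟨hF, hF1⟩, hm⟩ := hf
  have hFX := contDiff_dX hF
  have hFY := contDiff_dY hF
  set p : ℂ → ℝ := fun z => (hdot (dX F z) (F z)).im with hp
  set q : ℂ → ℝ := fun z => (hdot (dY F z) (F z)).im with hq
  have hpc : ∀ z, hdot (dX F z) (F z) = Complex.I * p z := by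
    intro z
    apply Complex.ext <;> simp [hp, hdot_dX_re hF (fun z => (hF1 z).1)]
  have hqc : ∀ z, hdot (dY F z) (F z) = Complex.I * q z := by
    intro z
    apply Complex.ext <;> simp [hq, hdot_dY_re hF (fun z => (hF1 z).1)]
  have hps : ContDiff ℝ ∞ p := Complex.imCLM.contDiff.comp (contDiff_hdot hFX hF)
  have hqs : ContDiff ℝ ∞ q := Complex.imCLM.contDiff.comp (contDiff_hdot hFY hF)
  -- Projecting F_x and F_y to the horizontal space changes F_x·F_y by (ip)(-iq) = pq, which is
  -- real, so the Lagrangian condition passes to the unprojected derivatives.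
  have hXY : ∀ z, (hdot (dX F z) (dY F z)).im = 0 := by
    intro z
    have h := (hm z).2.2.2
    have h1 := (hF1 z).1
    have hc := conj_hdot (dY F z) (F z)
    rw [hqc] at hc
    simp only [hor, hdot_sub_left, hdot_sub_right, hdot_smul_left, hdot_smul_right, hpc, hqc, h1,
      ← hc, map_mul, Complex.conj_I, Complex.conj_ofReal, Complex.sub_im, Complex.mul_im,
      Complex.mul_re, Complex.neg_re, Complex.neg_im, Complex.I_re, Complex.I_im,
      Complex.ofReal_re, Complex.ofReal_im, mul_one, sub_self,
      Complex.zero_re] at h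
    linarith
  -- The second derivatives cancel, and p_y - q_x is twice the imaginary part of F_x·F_y.
  have hclosed : ∀ z, dY p z = dX q z := by
    intro z
    have e1 : dY p z = (dY (fun w => hdot (dX F w) (F w)) z).im :=
      dY_clm Complex.imCLM (ContDiff.diffAt (contDiff_hdot hFX hF) z)
    have e2 : dX q z = (dX (fun w => hdot (dY F w) (F w)) z).im :=
      dX_clm Complex.imCLM (ContDiff.diffAt (contDiff_hdot hFY hF) z)
    rw [e1, e2, dY_hdot (ContDiff.diffAt hFX z) (ContDiff.diffAt hF z),
      dX_hdot (ContDiff.diffAt hFY z) (ContDiff.diffAt hF z), dY_dX hF,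
      ← conj_hdot (dX F z) (dY F z)]
    simp [hXY z]
  obtain ⟨θ, hθ, hθx, hθy⟩ := exists_primitive hps hqs hclosed
  set χ : ℂ → ℂ := fun z => Complex.exp (-(Complex.I * θ z)) with hχ
  have hθc := contDiff_ofReal hθ
  have hχs : ContDiff ℝ ∞ χ := (contDiff_const.mul hθc).neg.cexp
  have hχd : ∀ z v, fderiv ℝ χ z v = -(Complex.I * (fderiv ℝ θ z v : ℝ)) * χ z := by
    intro z v
    have h1 := (((Complex.ofRealCLM.hasFDerivAt.comp z (ContDiff.diffAt hθ z).hasFDerivAt).const_mul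
      Complex.I).neg).cexp
    have h2 : fderiv ℝ χ z = _ := h1.fderiv
    rw [h2]
    simp [hχ]; ring
  have hχ1 : ∀ z, χ z * (starRingEnd ℂ) (χ z) = 1 := by
    intro z
    rw [hχ, ← Complex.exp_conj, ← Complex.exp_add]
    simp
  have hHs : ContDiff ℝ ∞ (fun z => χ z • F z) := hχs.smul hF
  have hHx : ∀ z, dX (fun z => χ z • F z) z = χ z • hor (F z) (dX F z) := by
    intro z
    have : dX χ z = -(Complex.I * (dX θ z : ℝ)) * χ z := hχd z 1
    rw [dX_smul (ContDiff.diffAt hχs z) (ContDiff.diffAt hF z), this, hθx, hor, hpc]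
    module
  have hHy : ∀ z, dY (fun z => χ z • F z) z = χ z • hor (F z) (dY F z) := by
    intro z
    have : dY χ z = -(Complex.I * (dY θ z : ℝ)) * χ z := hχd z Complex.I
    rw [dY_smul (ContDiff.diffAt hχs z) (ContDiff.diffAt hF z), this, hθy, hor, hqc]
    module
  have hdd : ∀ z v w, hdot (χ z • v) (χ z • w) = hdot v w := by
    intro z v w
    rw [hdot_smul_left, hdot_smul_right]
    linear_combination hdot v w * hχ1 z
  have hhor : ∀ z v, hdot (hor (F z) v) (F z) = 0 := by
    intro z v
    rw [hor, hdot_sub_left, hdot_smul_left, (hF1 z).1]; ring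
  refine ⟨fun z => χ z • F z, ⟨⟨hHs, fun z => ⟨?_, ?_⟩⟩, fun z => ⟨?_, ?_⟩⟩, fun z => ?_, fun z => ?_,
    fun z => ?_⟩
  · rw [hdd]; exact (hF1 z).1
  · exact Submodule.smul_mem _ _ (hF1 z).2
  · rw [hHx, hdd, hhor]
  · rw [hHy, hdd, hhor]
  · rw [hHx, hdd]
    apply Complex.ext
    · rw [(hm z).1, ← Complex.ofReal_ofNat, ← Complex.ofReal_mul, Complex.ofReal_re]
    · rw [hdot_self_im, ← Complex.ofReal_ofNat, ← Complex.ofReal_mul, Complex.ofReal_im]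
  · rw [hHy, hdd]
    apply Complex.ext
    · rw [(hm z).2.1, ← Complex.ofReal_ofNat, ← Complex.ofReal_mul, Complex.ofReal_re]
    · rw [hdot_self_im, ← Complex.ofReal_ofNat, ← Complex.ofReal_mul, Complex.ofReal_im]
  · rw [hHx, hHy, hdd]
    exact Complex.ext (hm z).2.2.1 (hm z).2.2.2

/-- Any two horizontal lifts differ by a phase that is infinitesimally constant, so the conformality
relations do not depend on the lift. -/
theorem IsConformalLift.of_isHorizontalLift {f : ℂ → ℙ ℂ (Fin 3 → ℂ)} {u : ℂ → ℝ}
    {H G : ℂ → Fin 3 → ℂ} (hH : IsConformalLift f u H) (hG : IsHorizontalLift f G) :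
    IsConformalLift f u G := by
  obtain ⟨⟨⟨hHs, hH1⟩, hH0⟩, hxx, hyy, hxy⟩ := hH
  obtain ⟨⟨hGs, hG1⟩, hG0⟩ := id hG
  have hχs : ContDiff ℝ ∞ (fun z => hdot (G z) (H z)) := contDiff_hdot hGs hHs
  have hGH : ∀ z, G z = hdot (G z) (H z) • H z := fun z =>
    eq_hdot_smul_of_mem_submodule (hG1 z).2 (hH1 z).2 (hH1 z).1
  have hHG : ∀ z, H z = hdot (H z) (G z) • G z := fun z =>
    eq_hdot_smul_of_mem_submodule (hH1 z).2 (hG1 z).2 (hG1 z).1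
  have hχ1 : ∀ z, hdot (G z) (H z) * (starRingEnd ℂ) (hdot (G z) (H z)) = 1 := by
    intro z
    have h := (hG1 z).1
    rw [hGH z, hdot_smul_left, hdot_smul_right, (hH1 z).1, mul_one] at h
    exact h
  have hX : ∀ z, dX G z = hdot (G z) (H z) • dX H z := by
    intro z
    have h1 : dX (fun w => hdot (G w) (H w)) z = 0 := by
      rw [dX_hdot (ContDiff.diffAt hGs z) (ContDiff.diffAt hHs z)]
      have a1 : hdot (dX G z) (H z) = 0 := by
        rw [hHG z, hdot_smul_right, (hG0 z).1, mul_zero]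
      have a2 : hdot (G z) (dX H z) = 0 := by
        rw [hGH z, hdot_smul_left, hdot_eq_zero_comm (hH0 z).1, mul_zero]
      rw [a1, a2, add_zero]
    conv_lhs => rw [funext hGH]
    rw [dX_smul (ContDiff.diffAt hχs z) (ContDiff.diffAt hHs z), h1, zero_smul, zero_add]
  have hY : ∀ z, dY G z = hdot (G z) (H z) • dY H z := by
    intro z
    have h1 : dY (fun w => hdot (G w) (H w)) z = 0 := by
      rw [dY_hdot (ContDiff.diffAt hGs z) (ContDiff.diffAt hHs z)]
      have a1 : hdot (dY G z) (H z) = 0 := by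
        rw [hHG z, hdot_smul_right, (hG0 z).2, mul_zero]
      have a2 : hdot (G z) (dY H z) = 0 := by
        rw [hGH z, hdot_smul_left, hdot_eq_zero_comm (hH0 z).2, mul_zero]
      rw [a1, a2, add_zero]
    conv_lhs => rw [funext hGH]
    rw [dY_smul (ContDiff.diffAt hχs z) (ContDiff.diffAt hHs z), h1, zero_smul, zero_add]
  have hdd : ∀ z v w, hdot (hdot (G z) (H z) • v) (hdot (G z) (H z) • w) = hdot v w := by
    intro z v w
    rw [hdot_smul_left, hdot_smul_right]
    linear_combination hdot v w * hχ1 z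
  refine ⟨hG, fun z => ?_, fun z => ?_, fun z => ?_⟩
  · rw [hX, hdd, hxx]
  · rw [hY, hdd, hyy]
  · rw [hX, hY, hdd, hxy]

theorem IsConformalLift.contDiff {f : ℂ → ℙ ℂ (Fin 3 → ℂ)} {u : ℂ → ℝ} {H : ℂ → Fin 3 → ℂ}
    (hH : IsConformalLift f u H) : ContDiff ℝ ∞ H := hH.lift.1.1

/-- Smoothness of u is not part of the definition of the surface; it is recovered from u =
log(|H_x|²/2). -/
theorem IsConformalLift.contDiff_u {f : ℂ → ℙ ℂ (Fin 3 → ℂ)} {u : ℂ → ℝ} {H : ℂ → Fin 3 → ℂ}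
    (hH : IsConformalLift f u H) : ContDiff ℝ ∞ u := by
  have h : ∀ z, (hdot (dX H z) (dX H z)).re = 2 * Real.exp (u z) := by
    intro z
    rw [hH.xx, ← Complex.ofReal_ofNat, ← Complex.ofReal_mul, Complex.ofReal_re]
  have hu : u = fun z => Real.log ((hdot (dX H z) (dX H z)).re / 2) := by
    ext z
    rw [h]; simp
  rw [hu]
  have hs : ContDiff ℝ ∞ (fun z => (hdot (dX H z) (dX H z)).re / 2) :=
    (Complex.reCLM.contDiff.comp (contDiff_hdot (contDiff_dX hH.contDiff)
      (contDiff_dX hH.contDiff))).div_const 2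
  refine hs.log fun z => ?_
  rw [h]
  have := Real.exp_pos (u z)
  positivity

/-! ### Structure equations of a horizontal lift -/

/-- The matrix with rows ā, b̄, c̄ is invertible, since its product with its adjoint is diagonal
with nonzero entries; it annihilates v. -/
theorem eq_zero_of_orthogonal {a b c v : Fin 3 → ℂ} (ha : hdot a a ≠ 0) (hb : hdot b b ≠ 0)
    (hc : hdot c c ≠ 0) (hab : hdot a b = 0) (hac : hdot a c = 0) (hbc : hdot b c = 0)
    (hva : hdot v a = 0) (hvb : hdot v b = 0) (hvc : hdot v c = 0) : v = 0 := by
  set M : Matrix (Fin 3) (Fin 3) ℂ := Matrix.of ![star a, star b, star c] with hM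
  have hMM : M * M.conjTranspose = Matrix.diagonal ![hdot a a, hdot b b, hdot c c] := by
    have hba := hdot_eq_zero_comm hab
    have hca := hdot_eq_zero_comm hac
    have hcb := hdot_eq_zero_comm hbc
    rw [hdot_eq] at hab hac hbc hba hca hcb
    ext i j
    fin_cases i <;> fin_cases j <;>
      simp [hM, Matrix.mul_apply, Fin.sum_univ_three, hdot_eq] <;>
      first | ring1 | linear_combination hba | linear_combination hca | linear_combination hcb |
        linear_combination hab | linear_combination hac | linear_combination hbc
  have hdet : M.det ≠ 0 := by
    intro h0
    have := congrArg Matrix.det hMM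
    rw [Matrix.det_mul, h0, zero_mul, Matrix.det_diagonal, Fin.prod_univ_three] at this
    exact mul_ne_zero (mul_ne_zero ha hb) hc this.symm
  apply Matrix.eq_zero_of_mulVec_eq_zero hdet
  rw [hdot_eq] at hva hvb hvc
  ext i
  fin_cases i <;> simp [hM, Matrix.mulVec, dotProduct, Fin.sum_univ_three]
  · linear_combination hva
  · linear_combination hvb
  · linear_combination hvc

/-- The conformal factor `e^u` as a complex valued function. -/
def expC (u : ℂ → ℝ) (z : ℂ) : ℂ := (Real.exp (u z) : ℂ)

/-- The logarithmic factor `u` as a complex valued function. -/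
def ofRealFun (u : ℂ → ℝ) (z : ℂ) : ℂ := (u z : ℂ)

theorem expC_ne_zero (u : ℂ → ℝ) (z : ℂ) : expC u z ≠ 0 := by
  simp only [expC, ne_eq, Complex.ofReal_eq_zero]; exact (Real.exp_pos _).ne'

theorem conj_expC (u : ℂ → ℝ) (z : ℂ) : (starRingEnd ℂ) (expC u z) = expC u z :=
  Complex.conj_ofReal _

theorem contDiff_expC {u : ℂ → ℝ} (hu : ContDiff ℝ ∞ u) : ContDiff ℝ ∞ (expC u) :=
  contDiff_ofReal (Real.contDiff_exp.comp hu)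

theorem fderiv_exp_mul {u : ℂ → ℝ} (hu : ContDiff ℝ ∞ u) (a : ℝ) (z v : ℂ) :
    fderiv ℝ (fun w => (Real.exp (a * u w) : ℂ)) z v =
      a * (Real.exp (a * u z) : ℂ) * fderiv ℝ (ofRealFun u) z v := by
  have h0 := (ContDiff.diffAt hu z).hasFDerivAt
  have h1 : fderiv ℝ (fun w => (Real.exp (a * u w) : ℂ)) z = _ :=
    (Complex.ofRealCLM.hasFDerivAt.comp z (h0.const_mul a).exp).fderiv
  have h2 : fderiv ℝ (ofRealFun u) z = _ := (Complex.ofRealCLM.hasFDerivAt.comp z h0).fderiv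
  rw [h1, h2]
  simp; ring

theorem dZ_exp_mul {u : ℂ → ℝ} (hu : ContDiff ℝ ∞ u) (a : ℝ) (z : ℂ) :
    dZ (fun w => (Real.exp (a * u w) : ℂ)) z =
      a * (Real.exp (a * u z) : ℂ) * dZ (ofRealFun u) z := by
  simp only [dZ, dX, dY, fderiv_exp_mul hu, smul_eq_mul]; ring

theorem dZbar_exp_mul {u : ℂ → ℝ} (hu : ContDiff ℝ ∞ u) (a : ℝ) (z : ℂ) :
    dZbar (fun w => (Real.exp (a * u w) : ℂ)) z =
      a * (Real.exp (a * u z) : ℂ) * dZbar (ofRealFun u) z := by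
  simp only [dZbar, dX, dY, fderiv_exp_mul hu, smul_eq_mul]; ring

theorem dZ_expC {u : ℂ → ℝ} (hu : ContDiff ℝ ∞ u) (z : ℂ) :
    dZ (expC u) z = expC u z * dZ (ofRealFun u) z := by
  have h := dZ_exp_mul hu 1 z
  simp only [one_mul, Complex.ofReal_one] at h
  exact h

theorem dZbar_expC {u : ℂ → ℝ} (hu : ContDiff ℝ ∞ u) (z : ℂ) :
    dZbar (expC u) z = expC u z * dZbar (ofRealFun u) z := by
  have h := dZbar_exp_mul hu 1 z
  simp only [one_mul, Complex.ofReal_one] at h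
  exact h

theorem conj_dZ_ofRealFun {u : ℂ → ℝ} (hu : ContDiff ℝ ∞ u) (z : ℂ) :
    (starRingEnd ℂ) (dZ (ofRealFun u) z) = dZbar (ofRealFun u) z := by
  have h1 : dX (ofRealFun u) z = (dX u z : ℝ) := dX_ofReal (ContDiff.diffAt hu z)
  have h2 : dY (ofRealFun u) z = (dY u z : ℝ) := dY_ofReal (ContDiff.diffAt hu z)
  simp only [dZ, dZbar, h1, h2, smul_eq_mul, map_mul, map_sub, map_div₀, map_one, map_ofNat,
    Complex.conj_ofReal, Complex.conj_I]
  ring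

theorem dZ_const (a : ℂ) (z : ℂ) : dZ (fun _ : ℂ => a) z = 0 := by
  simp [dZ, dX_const, dY_const]

theorem dZbar_const (a : ℂ) (z : ℂ) : dZbar (fun _ : ℂ => a) z = 0 := by
  simp [dZbar, dX_const, dY_const]

namespace IsConformalLift

variable {f : ℂ → ℙ ℂ (Fin 3 → ℂ)} {u : ℂ → ℝ} {H : ℂ → Fin 3 → ℂ}

theorem self (hH : IsConformalLift f u H) (z : ℂ) : hdot (H z) (H z) = 1 := (hH.lift.1.2 z).1

theorem z_self (hH : IsConformalLift f u H) (z : ℂ) : hdot (dZ H z) (H z) = 0 := by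
  simp [dZ, hdot_smul_left, hdot_sub_left, (hH.lift.2 z).1, (hH.lift.2 z).2]

theorem zbar_self (hH : IsConformalLift f u H) (z : ℂ) : hdot (dZbar H z) (H z) = 0 := by
  simp [dZbar, hdot_smul_left, hdot_add_left, (hH.lift.2 z).1, (hH.lift.2 z).2]

theorem z_z (hH : IsConformalLift f u H) (z : ℂ) : hdot (dZ H z) (dZ H z) = expC u z := by
  simp only [dZ, hdot_smul_left, hdot_sub_left, hdot_smul_right, hdot_sub_right, hH.xx, hH.xy,
    hH.yy, hdot_eq_zero_comm (hH.xy z), expC, Complex.conj_I, map_div₀, map_one, map_ofNat]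
  linear_combination (-1 / 2 * (Real.exp (u z) : ℂ)) * Complex.I_mul_I

theorem zbar_zbar (hH : IsConformalLift f u H) (z : ℂ) :
    hdot (dZbar H z) (dZbar H z) = expC u z := by
  simp only [dZbar, hdot_smul_left, hdot_add_left, hdot_smul_right, hdot_add_right, hH.xx, hH.xy,
    hH.yy, hdot_eq_zero_comm (hH.xy z), expC, Complex.conj_I, map_div₀, map_one, map_ofNat]
  linear_combination (-1 / 2 * (Real.exp (u z) : ℂ)) * Complex.I_mul_I

theorem z_zbar (hH : IsConformalLift f u H) (z : ℂ) : hdot (dZ H z) (dZbar H z) = 0 := by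
  simp only [dZ, dZbar, hdot_smul_left, hdot_add_right, hdot_smul_right, hdot_sub_left, hH.xx,
    hH.xy, hH.yy, hdot_eq_zero_comm (hH.xy z), Complex.conj_I, map_div₀, map_one, map_ofNat]
  linear_combination (1 / 2 * (Real.exp (u z) : ℂ)) * Complex.I_mul_I

/-- H_z, H_z̄, H is an orthogonal basis, so a vector is known from three products. The structure
equations below are all checked in this way. -/
theorem ext_frame (hH : IsConformalLift f u H) {z : ℂ} {v v' : Fin 3 → ℂ}
    (h1 : hdot v (dZ H z) = hdot v' (dZ H z)) (h2 : hdot v (dZbar H z) = hdot v' (dZbar H z))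
    (h3 : hdot v (H z) = hdot v' (H z)) : v = v' := by
  rw [← sub_eq_zero]
  apply eq_zero_of_orthogonal (a := dZ H z) (b := dZbar H z) (c := H z)
  · rw [hH.z_z]; exact expC_ne_zero u z
  · rw [hH.zbar_zbar]; exact expC_ne_zero u z
  · rw [hH.self]; exact one_ne_zero
  · exact hH.z_zbar z
  · exact hH.z_self z
  · exact hH.zbar_self z
  · rw [hdot_sub_left, h1, sub_self]
  · rw [hdot_sub_left, h2, sub_self]
  · rw [hdot_sub_left, h3, sub_self]

/-- The component along H comes from differentiating H_z·H = 0. The two tangential components are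
complex unknowns, killed by four real equations: two from the derivative of the conformality
relation H_z·H_z̄ = 0 and two from vanishing mean curvature. -/
theorem laplace (hH : IsConformalLift f u H) (hmin : HasZeroMeanCurvature f) (z : ℂ) :
    dZbar (dZ H) z = -expC u z • H z := by
  have hs := hH.contDiff
  have hz := ContDiff.diffAt (contDiff_dZ hs) z
  have hzb := ContDiff.diffAt (contDiff_dZbar hs) z
  have h3 : hdot (dZbar (dZ H) z) (H z) = -expC u z := by
    have h := dZbar_hdot hz (ContDiff.diffAt hs z)
    rw [funext hH.z_self, dZbar_const, hH.z_z] at h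
    linear_combination -h
  have hab : hdot (dZbar (dZ H) z) (dZbar H z)
      + (starRingEnd ℂ) (hdot (dZbar (dZ H) z) (dZ H z)) = 0 := by
    have h := dZbar_hdot hz hzb
    rw [funext hH.z_zbar, dZbar_const, dZ_dZbar hs] at h
    rw [conj_hdot]; exact h.symm
  -- On a Lagrangian surface the normal vectors are i times tangent vectors, and testing against iV
  -- reads off the imaginary part of the product with V.
  have hN : ∀ V : Fin 3 → ℂ, hdot V (H z) = 0 →
      (hdot (Complex.I • V) (dX H z)).re = 0 → (hdot (Complex.I • V) (dY H z)).re = 0 →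
      (hdot (dZbar (dZ H) z) V).im = 0 := by
    intro V h0 h1 h2
    have h := hmin H hH.lift z (Complex.I • V) (by rw [hdot_smul_left, h0, mul_zero]) h1 h2
    rw [hdot_smul_right, Complex.conj_I] at h
    rw [dZbar_dZ_eq hs, hdot_smul_left]
    simp only [neg_mul, Complex.neg_re, Complex.mul_re, Complex.I_re, Complex.I_im] at h
    rw [show (1 / 4 : ℂ) = ((1 / 4 : ℝ) : ℂ) by norm_num, Complex.im_ofReal_mul]
    linarith
  have hX := hN (dX H z) (hH.lift.2 z).1 (by
    rw [hdot_smul_left, hH.xx]; simp) (by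
    rw [hdot_smul_left, hH.xy]; simp)
  have hY := hN (dY H z) (hH.lift.2 z).2 (by
    rw [hdot_smul_left, hdot_eq_zero_comm (hH.xy z)]; simp) (by
    rw [hdot_smul_left, hH.yy]; simp)
  rw [dX_eq_dZ_add_dZbar, hdot_add_right] at hX
  rw [dY_eq_dZ_sub_dZbar, hdot_smul_right, hdot_sub_right, Complex.conj_I] at hY
  have e1 := congrArg Complex.re hab
  have e2 := congrArg Complex.im hab
  simp only [Complex.add_im, Complex.add_re, Complex.conj_re, Complex.conj_im, Complex.zero_re,
    Complex.zero_im, neg_mul, Complex.neg_im, Complex.mul_im, Complex.I_re, Complex.I_im,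
    Complex.sub_re, Complex.sub_im] at e1 e2 hX hY
  have h1 : hdot (dZbar (dZ H) z) (dZ H z) = 0 := by
    apply Complex.ext <;> simp only [Complex.zero_re, Complex.zero_im] <;> linarith
  have h2 : hdot (dZbar (dZ H) z) (dZbar H z) = 0 := by
    rw [h1, map_zero, add_zero] at hab; exact hab
  apply hH.ext_frame
  · rw [h1, hdot_smul_left, hdot_eq_zero_comm (hH.z_self z), mul_zero]
  · rw [h2, hdot_smul_left, hdot_eq_zero_comm (hH.zbar_self z), mul_zero]
  · rw [h3, hdot_smul_left, hH.self, mul_one]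

theorem zz_self (hH : IsConformalLift f u H) (z : ℂ) : hdot (dZ (dZ H) z) (H z) = 0 := by
  have hs := hH.contDiff
  have h := dZ_hdot (ContDiff.diffAt (contDiff_dZ hs) z) (ContDiff.diffAt hs z)
  rw [funext hH.z_self, dZ_const, hH.z_zbar, add_zero] at h
  exact h.symm

theorem zz_z (hH : IsConformalLift f u H) (hmin : HasZeroMeanCurvature f) (z : ℂ) :
    hdot (dZ (dZ H) z) (dZ H z) = expC u z * dZ (ofRealFun u) z := by
  have hs := hH.contDiff
  have hz := ContDiff.diffAt (contDiff_dZ hs) z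
  have h := dZ_hdot hz hz
  rw [hH.laplace hmin, hdot_smul_right, hH.z_self, mul_zero, add_zero, funext hH.z_z,
    dZ_expC hH.contDiff_u] at h
  exact h.symm

/-- Differentiating |H_z|² = e^u and H_z·H = 0 fixes two of the components of H_zz; the third one is
the Hopf coefficient. -/
theorem zz (hH : IsConformalLift f u H) (hmin : HasZeroMeanCurvature f) (z : ℂ) :
    dZ (dZ H) z = dZ (ofRealFun u) z • dZ H z +
      (hdot (dZ (dZ H) z) (dZbar H z) * (expC u z)⁻¹) • dZbar H z := by
  have hw := expC_ne_zero u z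
  apply hH.ext_frame
  · rw [hH.zz_z hmin, hdot_add_left, hdot_smul_left, hdot_smul_left, hH.z_z,
      hdot_eq_zero_comm (hH.z_zbar z)]
    ring
  · rw [hdot_add_left, hdot_smul_left, hdot_smul_left, hH.zbar_zbar, hH.z_zbar]
    field_simp; ring
  · rw [hH.zz_self, hdot_add_left, hdot_smul_left, hdot_smul_left, hH.z_self, hH.zbar_self]
    ring

theorem zbarzbar (hH : IsConformalLift f u H) (hmin : HasZeroMeanCurvature f) (z : ℂ) :
    dZbar (dZbar H) z = dZbar (ofRealFun u) z • dZbar H z -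
      ((starRingEnd ℂ) (hdot (dZ (dZ H) z) (dZbar H z)) * (expC u z)⁻¹) • dZ H z := by
  have hw := expC_ne_zero u z
  have hs := hH.contDiff
  have hz := ContDiff.diffAt (contDiff_dZ hs) z
  have hzb := ContDiff.diffAt (contDiff_dZbar hs) z
  have e1 : hdot (dZbar (dZbar H) z) (H z) = 0 := by
    have h := dZbar_hdot hzb (ContDiff.diffAt hs z)
    rw [funext hH.zbar_self, dZbar_const, hdot_eq_zero_comm (hH.z_zbar z), add_zero] at h
    exact h.symm
  have e2 : hdot (dZbar (dZbar H) z) (dZbar H z) = expC u z * dZbar (ofRealFun u) z := by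
    have h := dZbar_hdot hzb hzb
    rw [dZ_dZbar hs, hH.laplace hmin, hdot_smul_right, hH.zbar_self, mul_zero, add_zero,
      funext hH.zbar_zbar, dZbar_expC hH.contDiff_u] at h
    exact h.symm
  have e3 : hdot (dZbar (dZbar H) z) (dZ H z)
      = -(starRingEnd ℂ) (hdot (dZ (dZ H) z) (dZbar H z)) := by
    have h := dZbar_hdot hzb hz
    have h0 : (fun w => hdot (dZbar H w) (dZ H w)) = fun _ => 0 :=
      funext fun w => hdot_eq_zero_comm (hH.z_zbar w)
    rw [h0, dZbar_const] at h
    rw [conj_hdot]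
    linear_combination -h
  apply hH.ext_frame
  · rw [e3, hdot_sub_left, hdot_smul_left, hdot_smul_left, hH.z_z,
      hdot_eq_zero_comm (hH.z_zbar z)]
    field_simp; ring
  · rw [e2, hdot_sub_left, hdot_smul_left, hdot_smul_left, hH.zbar_zbar, hH.z_zbar]
    ring
  · rw [e1, hdot_sub_left, hdot_smul_left, hdot_smul_left, hH.z_self, hH.zbar_self]
    ring

theorem zbar_zz (hH : IsConformalLift f u H) (hmin : HasZeroMeanCurvature f) (z : ℂ) :
    dZbar (dZ (dZ H)) z = -(expC u z * dZ (ofRealFun u) z) • H z - expC u z • dZ H z := by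
  have hs := hH.contDiff
  have hw := contDiff_expC hH.contDiff_u
  rw [← dZ_dZbar (contDiff_dZ hs), funext (hH.laplace hmin),
    dZ_smul (a := fun z => -expC u z) (ContDiff.diffAt hw.neg z) (ContDiff.diffAt hs z)]
  have : dZ (fun z => -expC u z) z = -dZ (expC u) z := by
    have h := dZ_const_smul (-1 : ℂ) (ContDiff.diffAt hw z)
    simpa using h
  rw [this, dZ_expC hH.contDiff_u]
  module

/-- Codazzi equation: after the mixed derivatives are replaced through `laplace`, every remaining
product is one of the orthogonality relations. -/
theorem zbar_hopf (hH : IsConformalLift f u H) (hmin : HasZeroMeanCurvature f) (z : ℂ) :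
    dZbar (fun w => hdot (dZ (dZ H) w) (dZbar H w)) z = 0 := by
  have hs := hH.contDiff
  rw [dZbar_hdot (ContDiff.diffAt (contDiff_dZ (contDiff_dZ hs)) z)
    (ContDiff.diffAt (contDiff_dZbar hs) z), dZ_dZbar hs, hH.laplace hmin, hH.zbar_zz hmin,
    hdot_sub_left, hdot_smul_left, hdot_smul_left, hdot_smul_right, hH.zz_self, hH.z_zbar,
    hdot_eq_zero_comm (hH.zbar_self z)]
  ring

/-- Gauss equation for e^u instead of u, obtained by applying ∂/∂z̄ to H_zz·H_z = (e^u)_z; the term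
|H_zz|² is expanded with `zz`. -/
theorem gauss (hH : IsConformalLift f u H) (hmin : HasZeroMeanCurvature f) (z : ℂ) :
    dZbar (dZ (expC u)) z = -expC u z ^ 2 +
      expC u z * dZ (ofRealFun u) z * dZbar (ofRealFun u) z +
      hdot (dZ (dZ H) z) (dZbar H z) * (starRingEnd ℂ) (hdot (dZ (dZ H) z) (dZbar H z)) *
        (expC u z)⁻¹ := by
  have hs := hH.contDiff
  have hw := expC_ne_zero u z
  have h := dZbar_hdot (ContDiff.diffAt (contDiff_dZ (contDiff_dZ hs)) z)
    (ContDiff.diffAt (contDiff_dZ hs) z)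
  have e : (fun w => hdot (dZ (dZ H) w) (dZ H w)) = dZ (expC u) := by
    ext w; rw [hH.zz_z hmin, dZ_expC hH.contDiff_u]
  have e2 : hdot (dZ (dZ H) z) (dZ (dZ H) z) =
      expC u z * dZ (ofRealFun u) z * dZbar (ofRealFun u) z +
      hdot (dZ (dZ H) z) (dZbar H z) * (starRingEnd ℂ) (hdot (dZ (dZ H) z) (dZbar H z)) *
        (expC u z)⁻¹ := by
    conv_lhs => rw [hH.zz hmin z]
    simp only [hdot_add_left, hdot_add_right, hdot_smul_left, hdot_smul_right, hH.z_z,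
      hH.zbar_zbar, hH.z_zbar, hdot_eq_zero_comm (hH.z_zbar z), map_mul, map_inv₀, conj_expC,
      conj_dZ_ofRealFun hH.contDiff_u]
    field_simp; ring
  rw [e, hH.zbar_zz hmin, e2, hdot_sub_left, hdot_smul_left, hdot_smul_left, hH.z_z,
    hdot_eq_zero_comm (hH.z_self z)] at h
  rw [h]; ring

end IsConformalLift

/-! ### Equivariance -/

section MulVec

variable (A : Matrix (Fin 3) (Fin 3) ℂ) {g : ℂ → Fin 3 → ℂ} {z : ℂ}

/-- Multiplication by a matrix as a continuous real linear map. -/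
def mulVecCLM : (Fin 3 → ℂ) →L[ℝ] (Fin 3 → ℂ) :=
  (LinearMap.toContinuousLinearMap (Matrix.mulVecLin A)).restrictScalars ℝ

theorem dX_mulVec (hg : DifferentiableAt ℝ g z) :
    dX (fun w => A.mulVec (g w)) z = A.mulVec (dX g z) := dX_clm (mulVecCLM A) hg

theorem dY_mulVec (hg : DifferentiableAt ℝ g z) :
    dY (fun w => A.mulVec (g w)) z = A.mulVec (dY g z) := dY_clm (mulVecCLM A) hg

theorem dZ_mulVec (hg : DifferentiableAt ℝ g z) :
    dZ (fun w => A.mulVec (g w)) z = A.mulVec (dZ g z) := by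
  simp only [dZ, dX_mulVec A hg, dY_mulVec A hg, Matrix.mulVec_smul, Matrix.mulVec_sub]

theorem dZbar_mulVec (hg : DifferentiableAt ℝ g z) :
    dZbar (fun w => A.mulVec (g w)) z = A.mulVec (dZbar g z) := by
  simp only [dZbar, dX_mulVec A hg, dY_mulVec A hg, Matrix.mulVec_smul, Matrix.mulVec_add]

theorem contDiff_mulVec (hg : ContDiff ℝ ∞ g) : ContDiff ℝ ∞ (fun w => A.mulVec (g w)) :=
  (mulVecCLM A).contDiff.comp hg

theorem hdot_mulVec_left (v w : Fin 3 → ℂ) :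
    hdot (A.mulVec v) w = hdot v (A.conjTranspose.mulVec w) := by
  simp only [hdot_eq, Matrix.mulVec, dotProduct, Fin.sum_univ_three, Matrix.conjTranspose_apply,
    map_add, map_mul, RCLike.star_def, Complex.conj_conj]
  ring

theorem hdot_mulVec_mulVec {A : Matrix (Fin 3) (Fin 3) ℂ} (hA : A.conjTranspose * A = 1)
    (v w : Fin 3 → ℂ) : hdot (A.mulVec v) (A.mulVec w) = hdot v w := by
  rw [hdot_mulVec_left, Matrix.mulVec_mulVec, hA, Matrix.one_mulVec]

end MulVec

theorem dZ_translate (g : ℂ → Fin 3 → ℂ) (a z : ℂ) : dZ (fun w => g (w + a)) z = dZ g (z + a) := by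
  simp only [dZ, dX_translate, dY_translate]

theorem dZbar_translate (g : ℂ → Fin 3 → ℂ) (a z : ℂ) :
    dZbar (fun w => g (w + a)) z = dZbar g (z + a) := by
  simp only [dZbar, dX_translate, dY_translate]

variable {f : ℂ → ℙ ℂ (Fin 3 → ℂ)} {u : ℂ → ℝ} {H : ℂ → Fin 3 → ℂ}

/-- The choice A = R(t)⁻¹ works: it brings H(z + t) back to the line f(z). Metric and Hopf
differential, being the same for all horizontal lifts, must then be invariant under real
translations. -/
theorem IsConformalLift.translate (hH : IsConformalLift f u H)
    (hequiv : IsTranslationallyEquivariant f) (t : ℝ) :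
    ∃ A : Matrix (Fin 3) (Fin 3) ℂ, A.conjTranspose * A = 1 ∧
      IsHorizontalLift f (fun z => A.mulVec (H (z + t))) := by
  obtain ⟨R, hRu, -, -, hR⟩ := hequiv
  set M : Matrix (Fin 3) (Fin 3) ℂ := (R t : Matrix (Fin 3) (Fin 3) ℂ) with hM
  have hMM : M * M.conjTranspose = 1 := (Matrix.mem_unitaryGroup_iff).mp (hRu t)
  have hMM' : M.conjTranspose * M = 1 := (Matrix.mem_unitaryGroup_iff').mp (hRu t)
  have hA : M.conjTranspose.conjTranspose * M.conjTranspose = 1 := by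
    rw [Matrix.conjTranspose_conjTranspose, hMM]
  have hs := hH.contDiff
  have hst : ContDiff ℝ ∞ (fun z : ℂ => H (z + t)) := hs.comp (contDiff_id.add contDiff_const)
  refine ⟨M.conjTranspose, hA, ⟨contDiff_mulVec _ hst, fun z => ⟨?_, ?_⟩⟩, fun z => ⟨?_, ?_⟩⟩
  · rw [hdot_mulVec_mulVec hA, hH.self]
  · have h1 := (hH.lift.1.2 (z + t)).2
    rw [hR z t] at h1
    induction hz : f z using Projectivization.ind with
    | h v hv =>
      rw [hz, Projectivization.smul_mk, Projectivization.submodule_mk,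
        Submodule.mem_span_singleton] at h1
      obtain ⟨a, ha⟩ := h1
      have hsm : R t • v = M.mulVec v := rfl
      rw [Projectivization.submodule_mk, Submodule.mem_span_singleton]
      refine ⟨a, ?_⟩
      show a • v = M.conjTranspose.mulVec (H (z + t))
      rw [← ha, hsm, Matrix.mulVec_smul, Matrix.mulVec_mulVec, hMM', Matrix.one_mulVec]
  · rw [dX_mulVec _ (ContDiff.diffAt hst z), hdot_mulVec_mulVec hA, dX_translate]
    exact (hH.lift.2 _).1
  · rw [dY_mulVec _ (ContDiff.diffAt hst z), hdot_mulVec_mulVec hA, dY_translate]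
    exact (hH.lift.2 _).2

theorem IsConformalLift.u_translate (hH : IsConformalLift f u H)
    (hequiv : IsTranslationallyEquivariant f) (z : ℂ) (t : ℝ) : u (z + t) = u z := by
  obtain ⟨A, hA, hG⟩ := hH.translate hequiv t
  have hst : ContDiff ℝ ∞ (fun z : ℂ => H (z + t)) :=
    hH.contDiff.comp (contDiff_id.add contDiff_const)
  have h1 := (hH.of_isHorizontalLift hG).xx z
  rw [dX_mulVec _ (ContDiff.diffAt hst z), hdot_mulVec_mulVec hA, dX_translate, hH.xx] at h1
  have h2 : Real.exp (u (z + t)) = Real.exp (u z) := by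
    exact_mod_cast mul_left_cancel₀ two_ne_zero h1
  exact Real.exp_injective h2

theorem IsConformalLift.hopf_translate (hH : IsConformalLift f u H)
    (hequiv : IsTranslationallyEquivariant f) {φ : ℂ → ℂ} (hφ : HasHopfDifferential f φ) (z : ℂ)
    (t : ℝ) : φ (z + t) = φ z := by
  obtain ⟨A, hA, hG⟩ := hH.translate hequiv t
  have hst : ContDiff ℝ ∞ (fun z : ℂ => H (z + t)) :=
    hH.contDiff.comp (contDiff_id.add contDiff_const)
  have h1 := hφ _ hG z
  rw [← h1, ← hφ H hH.lift (z + t)]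
  have e1 : dZ (fun z : ℂ => A.mulVec (H (z + t))) = fun z => A.mulVec (dZ H (z + t)) := by
    ext1 w; rw [dZ_mulVec _ (ContDiff.diffAt hst w), dZ_translate]
  have hzt : ContDiff ℝ ∞ (fun z : ℂ => dZ H (z + t)) :=
    (contDiff_dZ hH.contDiff).comp (contDiff_id.add contDiff_const)
  rw [e1, dZ_mulVec _ (ContDiff.diffAt hzt z), dZ_translate,
    dZbar_mulVec _ (ContDiff.diffAt hst z), dZbar_translate, hdot_mulVec_mulVec hA]

theorem dX_eq_zero_of_translate {E : Type} [NormedAddCommGroup E] [NormedSpace ℝ E] {g : ℂ → E}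
    (hg : ContDiff ℝ ∞ g) (h : ∀ (z : ℂ) (t : ℝ), g (z + t) = g z) (z : ℂ) : dX g z = 0 := by
  have h1 := hasDerivAt_line_x (g := g) (z := z) (x := 0) (ContDiff.diffAt hg _)
  simp only [h, Complex.ofReal_zero, add_zero] at h1
  exact h1.unique (hasDerivAt_const _ _)

/-- The coefficient is holomorphic and independent of x, so its y-derivative vanishes too. -/
theorem IsConformalLift.hopf_const (hH : IsConformalLift f u H) (hmin : HasZeroMeanCurvature f)
    (hequiv : IsTranslationallyEquivariant f) {φ : ℂ → ℂ} (hφ : HasHopfDifferential f φ) (z : ℂ) :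
    φ z = φ 0 := by
  have he : (fun w => hdot (dZ (dZ H) w) (dZbar H w)) = φ := funext (hφ H hH.lift)
  have hs : ContDiff ℝ ∞ φ := by
    rw [← he]
    exact contDiff_hdot (contDiff_dZ (contDiff_dZ hH.contDiff)) (contDiff_dZbar hH.contDiff)
  have hx := dX_eq_zero_of_translate hs (hH.hopf_translate hequiv hφ)
  refine eq_of_dX_dY_eq_zero (hs.differentiable (by simp)) hx (fun w => ?_) z 0
  have h := hH.zbar_hopf hmin w
  rw [he, dZbar, hx] at h
  simpa using h

/-! ### Existence of a frame -/

theorem dZ_apply {g : ℂ → Fin 3 → ℂ} (hg : ContDiff ℝ ∞ g) (z : ℂ) (i : Fin 3) :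
    dZ (fun w => g w i) z = dZ g z i := by
  have h : ∀ v, fderiv ℝ (fun w => g w i) z v = fderiv ℝ g z v i := fun v => by
    rw [fderiv_pi (fun i => (differentiableAt_pi.mp (ContDiff.diffAt hg z)) i)]; rfl
  simp [dZ, dX, dY, h]

theorem dZbar_apply {g : ℂ → Fin 3 → ℂ} (hg : ContDiff ℝ ∞ g) (z : ℂ) (i : Fin 3) :
    dZbar (fun w => g w i) z = dZbar g z i := by
  have h : ∀ v, fderiv ℝ (fun w => g w i) z v = fderiv ℝ g z v i := fun v => by
    rw [fderiv_pi (fun i => (differentiableAt_pi.mp (ContDiff.diffAt hg z)) i)]; rfl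
  simp [dZbar, dX, dY, h]

/-- Jacobi's formula along one direction. The coefficient matrices are trace free, so it makes the
determinant of the adapted frame constant. -/
theorem fderiv_det_eq_mul_trace {K : ℂ → Matrix (Fin 3) (Fin 3) ℂ} {B : Matrix (Fin 3) (Fin 3) ℂ}
    {z v : ℂ} (hK : ∀ i j, DifferentiableAt ℝ (fun w => K w i j) z)
    (h : ∀ i j, fderiv ℝ (fun w => K w i j) z v = (K z * B) i j) :
    fderiv ℝ (fun w => (K w).det) z v = (K z).det * B.trace := by
  have d := fun i j => (hK i j).hasFDerivAt
  have hd : fderiv ℝ (fun w => K w 0 0 * K w 1 1 * K w 2 2 - K w 0 0 * K w 1 2 * K w 2 1 -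
      K w 0 1 * K w 1 0 * K w 2 2 + K w 0 1 * K w 1 2 * K w 2 0 + K w 0 2 * K w 1 0 * K w 2 1 -
      K w 0 2 * K w 1 1 * K w 2 0) z = _ :=
    (((((((d 0 0).mul (d 1 1)).mul (d 2 2)).sub (((d 0 0).mul (d 1 2)).mul (d 2 1))).sub
    (((d 0 1).mul (d 1 0)).mul (d 2 2))).add (((d 0 1).mul (d 1 2)).mul (d 2 0))).add
    (((d 0 2).mul (d 1 0)).mul (d 2 1))).sub (((d 0 2).mul (d 1 1)).mul (d 2 0)) |>.fderiv
  simp only [Matrix.det_fin_three]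
  rw [hd]
  simp only [sub_apply, add_apply,
    smul_apply, smul_eq_mul, h, Matrix.mul_apply, Fin.sum_univ_three,
    Matrix.trace, Matrix.diag, Pi.mul_apply]
  ring

/-- The function `e^{-u/2}` as a complex valued function. -/
def expHalf (u : ℂ → ℝ) (z : ℂ) : ℂ := (Real.exp (-(u z / 2)) : ℂ)

theorem contDiff_expHalf {u : ℂ → ℝ} (hu : ContDiff ℝ ∞ u) : ContDiff ℝ ∞ (expHalf u) :=
  contDiff_ofReal (Real.contDiff_exp.comp (hu.div_const 2).neg)

theorem conj_expHalf (u : ℂ → ℝ) (z : ℂ) : (starRingEnd ℂ) (expHalf u z) = expHalf u z :=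
  Complex.conj_ofReal _

theorem expHalf_ne_zero (u : ℂ → ℝ) (z : ℂ) : expHalf u z ≠ 0 := by
  simp only [expHalf, ne_eq, Complex.ofReal_eq_zero]; exact (Real.exp_pos _).ne'

theorem dZ_expHalf {u : ℂ → ℝ} (hu : ContDiff ℝ ∞ u) (z : ℂ) :
    dZ (expHalf u) z = -(1 / 2) * expHalf u z * dZ (ofRealFun u) z := by
  have h := dZ_exp_mul hu (-(1 / 2)) z
  have e : ∀ w, -(1 / 2) * u w = -(u w / 2) := fun w => by ring
  have e2 : ((-(1 / 2) : ℝ) : ℂ) = -(1 / 2) := by norm_num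
  simp only [e, e2] at h
  exact h

theorem dZbar_expHalf {u : ℂ → ℝ} (hu : ContDiff ℝ ∞ u) (z : ℂ) :
    dZbar (expHalf u) z = -(1 / 2) * expHalf u z * dZbar (ofRealFun u) z := by
  have h := dZbar_exp_mul hu (-(1 / 2)) z
  have e : ∀ w, -(1 / 2) * u w = -(u w / 2) := fun w => by ring
  have e2 : ((-(1 / 2) : ℝ) : ℂ) = -(1 / 2) := by norm_num
  simp only [e, e2] at h
  exact h

theorem exp_half_eq (u : ℂ → ℝ) (z : ℂ) : (Real.exp (u z / 2) : ℂ) = (expHalf u z)⁻¹ := by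
  rw [expHalf, Real.exp_neg, Complex.ofReal_inv, inv_inv]

theorem exp_neg_eq (u : ℂ → ℝ) (z : ℂ) : (Real.exp (-u z) : ℂ) = expHalf u z ^ 2 := by
  rw [expHalf, ← Complex.ofReal_pow, ← Real.exp_nat_mul]
  congr 2; push_cast; ring

theorem expC_eq (u : ℂ → ℝ) (z : ℂ) : expC u z = (expHalf u z ^ 2)⁻¹ := by
  rw [← exp_neg_eq, ← Complex.ofReal_inv, ← Real.exp_neg, neg_neg]; rfl

theorem mul_conj_of_norm_eq_one {lam : ℂ} (hlam : ‖lam‖ = 1) : lam * (starRingEnd ℂ) lam = 1 := by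
  rw [Complex.mul_conj, Complex.normSq_eq_norm_sq, hlam]; simp

theorem conj_eq_inv_of_norm_eq_one {lam : ℂ} (hlam : ‖lam‖ = 1) :
    (starRingEnd ℂ) lam = lam⁻¹ :=
  eq_inv_of_mul_eq_one_right (mul_conj_of_norm_eq_one hlam)

/-- The columns of the unitary frame adapted to a horizontal lift. -/
def adaptedCol (lam : ℂ) (u : ℂ → ℝ) (H : ℂ → Fin 3 → ℂ) : Fin 3 → ℂ → Fin 3 → ℂ :=
  ![fun z => (-Complex.I * lam * expHalf u z) • dZ H z,
    fun z => (-Complex.I * lam⁻¹ * expHalf u z) • dZbar H z, H]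

/-- The unitary frame adapted to a horizontal lift. -/
def adaptedFrame (lam : ℂ) (u : ℂ → ℝ) (H : ℂ → Fin 3 → ℂ) (z : ℂ) : Matrix (Fin 3) (Fin 3) ℂ :=
  Matrix.of fun i j => adaptedCol lam u H j z i

/-! ### The adapted frame solves the frame equations -/

section AdaptedFrame

variable {f : ℂ → ℙ ℂ (Fin 3 → ℂ)} {u : ℂ → ℝ} {H : ℂ → Fin 3 → ℂ} {lam : ℂ} {ψ : ℂ → ℂ}

theorem contDiff_adaptedCol (hH : IsConformalLift f u H) (j : Fin 3) :
    ContDiff ℝ ∞ (adaptedCol lam u H j) := by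
  have hs := hH.contDiff
  have hE := contDiff_expHalf hH.contDiff_u
  fin_cases j
  · exact (contDiff_const.mul hE).smul (contDiff_dZ hs)
  · exact (contDiff_const.mul hE).smul (contDiff_dZbar hs)
  · exact hs

theorem hdot_adaptedCol (hH : IsConformalLift f u H) (hlam : ‖lam‖ = 1) (z : ℂ) (i j : Fin 3) :
    hdot (adaptedCol lam u H j z) (adaptedCol lam u H i z) = if i = j then 1 else 0 := by
  have hl0 : lam ≠ 0 := by rintro rfl; simp at hlam
  have hinv := conj_eq_inv_of_norm_eq_one hlam
  have hE := expHalf_ne_zero u z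
  fin_cases i <;> fin_cases j <;>
    simp [adaptedCol, hdot_neg_left, hdot_neg_right, hdot_smul_left, hdot_smul_right, hH.z_z, hH.zbar_zbar, hH.self, hH.z_zbar,
      hH.z_self, hH.zbar_self, hdot_eq_zero_comm (hH.z_zbar z), hdot_eq_zero_comm (hH.z_self z),
      hdot_eq_zero_comm (hH.zbar_self z), hinv, conj_expHalf, expC_eq]
  · field_simp; linear_combination -Complex.I_mul_I
  · field_simp; linear_combination -Complex.I_mul_I

theorem conjTranspose_mul_adaptedFrame (hH : IsConformalLift f u H) (hlam : ‖lam‖ = 1) (z : ℂ) :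
    (adaptedFrame lam u H z).conjTranspose * adaptedFrame lam u H z = 1 := by
  ext i j
  rw [Matrix.one_apply, ← hdot_adaptedCol hH hlam z i j]
  simp only [Matrix.mul_apply, Matrix.conjTranspose_apply, adaptedFrame, Matrix.of_apply,
    RCLike.star_def, hdot]
  exact Finset.sum_congr rfl fun k _ => mul_comm _ _

/-- These are the structure equations in the normalised basis. The phases -iλ and -iλ⁻¹ of the first
two columns turn the Hopf coefficient -iλ⁻³ψ into the entry -iλ⁻¹ψe^{-u} and H_z into iλ⁻¹e^{u/2}
times the first column. -/
theorem dZ_adaptedCol (hH : IsConformalLift f u H) (hmin : HasZeroMeanCurvature f)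
    (hHopf : HasHopfDifferential f (fun z => -Complex.I * (lam ^ 3)⁻¹ * ψ z))
    (hlam : ‖lam‖ = 1) (z : ℂ) (j : Fin 3) :
    dZ (adaptedCol lam u H j) z = ∑ k, matU lam (Real.exp (u z / 2)) (ψ z * Real.exp (-u z))
      (dZ (fun w => (u w : ℂ)) z) k j • adaptedCol lam u H k z := by
  have hl0 : lam ≠ 0 := by rintro rfl; simp at hlam
  have hE := expHalf_ne_zero u z
  have hs := hH.contDiff
  have hEs := contDiff_expHalf hH.contDiff_u
  have hI := Complex.I_mul_I
  change _ = ∑ k, matU lam _ _ (dZ (ofRealFun u) z) k j • _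
  rw [exp_half_eq, exp_neg_eq, Fin.sum_univ_three]
  fin_cases j
  · change dZ (fun z => (-Complex.I * lam * expHalf u z) • dZ H z) z = _
    have h1 : dZ (fun z => -Complex.I * lam * expHalf u z) z =
        -Complex.I * lam * dZ (expHalf u) z :=
      dZ_const_smul (-Complex.I * lam) (ContDiff.diffAt hEs z)
    rw [dZ_smul (ContDiff.diffAt (contDiff_const.mul hEs) z) (ContDiff.diffAt (contDiff_dZ hs) z),
      h1, dZ_expHalf hH.contDiff_u, hH.zz hmin, hHopf H hH.lift, expC_eq]
    simp [matU, adaptedCol]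
    match_scalars
    · ring
    · field_simp
  · change dZ (fun z => (-Complex.I * lam⁻¹ * expHalf u z) • dZbar H z) z = _
    have h1 : dZ (fun z => -Complex.I * lam⁻¹ * expHalf u z) z =
        -Complex.I * lam⁻¹ * dZ (expHalf u) z :=
      dZ_const_smul (-Complex.I * lam⁻¹) (ContDiff.diffAt hEs z)
    rw [dZ_smul (ContDiff.diffAt (contDiff_const.mul hEs) z)
      (ContDiff.diffAt (contDiff_dZbar hs) z), h1, dZ_expHalf hH.contDiff_u, dZ_dZbar hs,
      hH.laplace hmin, expC_eq]
    simp [matU, adaptedCol]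
    match_scalars
    · ring
    · field_simp
  · change dZ H z = _
    simp [matU, adaptedCol, smul_smul]
    match_scalars
    field_simp
    linear_combination hI

theorem dZbar_adaptedCol (hH : IsConformalLift f u H) (hmin : HasZeroMeanCurvature f)
    (hHopf : HasHopfDifferential f (fun z => -Complex.I * (lam ^ 3)⁻¹ * ψ z))
    (hlam : ‖lam‖ = 1) (z : ℂ) (j : Fin 3) :
    dZbar (adaptedCol lam u H j) z =
      ∑ k, matV lam (Real.exp (u z / 2)) ((starRingEnd ℂ) (ψ z) * Real.exp (-u z))
      (dZbar (fun w => (u w : ℂ)) z) k j • adaptedCol lam u H k z := by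
  have hl0 : lam ≠ 0 := by rintro rfl; simp at hlam
  have hE := expHalf_ne_zero u z
  have hs := hH.contDiff
  have hEs := contDiff_expHalf hH.contDiff_u
  have hI := Complex.I_mul_I
  change _ = ∑ k, matV lam _ _ (dZbar (ofRealFun u) z) k j • _
  rw [exp_half_eq, exp_neg_eq, Fin.sum_univ_three]
  fin_cases j
  · change dZbar (fun z => (-Complex.I * lam * expHalf u z) • dZ H z) z = _
    have h1 : dZbar (fun z => -Complex.I * lam * expHalf u z) z =
        -Complex.I * lam * dZbar (expHalf u) z :=
      dZbar_const_smul (-Complex.I * lam) (ContDiff.diffAt hEs z)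
    rw [dZbar_smul (ContDiff.diffAt (contDiff_const.mul hEs) z)
      (ContDiff.diffAt (contDiff_dZ hs) z), h1, dZbar_expHalf hH.contDiff_u,
      hH.laplace hmin, expC_eq]
    simp [matV, adaptedCol]
    match_scalars
    · ring
    · field_simp
  · change dZbar (fun z => (-Complex.I * lam⁻¹ * expHalf u z) • dZbar H z) z = _
    have h1 : dZbar (fun z => -Complex.I * lam⁻¹ * expHalf u z) z =
        -Complex.I * lam⁻¹ * dZbar (expHalf u) z :=
      dZbar_const_smul (-Complex.I * lam⁻¹) (ContDiff.diffAt hEs z)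
    rw [dZbar_smul (ContDiff.diffAt (contDiff_const.mul hEs) z)
      (ContDiff.diffAt (contDiff_dZbar hs) z), h1, dZbar_expHalf hH.contDiff_u,
      hH.zbarzbar hmin, hHopf H hH.lift, expC_eq]
    simp [matV, adaptedCol, conj_eq_inv_of_norm_eq_one hlam]
    match_scalars
    · ring
    · field_simp
  · change dZbar H z = _
    simp [matV, adaptedCol, smul_smul]
    match_scalars
    field_simp
    linear_combination hI

theorem trace_matU_add_matV (lam e p pbar a b : ℂ) :
    (matU lam e p a + matV lam e pbar b).trace = 0 := by
  simp [Matrix.trace, Fin.sum_univ_three, matU, matV]; ring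

theorem trace_matU_sub_matV (lam e p pbar a b : ℂ) :
    (Complex.I • (matU lam e p a - matV lam e pbar b)).trace = 0 := by
  simp [Matrix.trace, Fin.sum_univ_three, matU, matV]; ring

theorem dZ_adaptedFrame (hH : IsConformalLift f u H) (hmin : HasZeroMeanCurvature f)
    (hHopf : HasHopfDifferential f (fun z => -Complex.I * (lam ^ 3)⁻¹ * ψ z))
    (hlam : ‖lam‖ = 1) (z : ℂ) (i j : Fin 3) :
    dZ (fun w => adaptedFrame lam u H w i j) z = (adaptedFrame lam u H z *
      matU lam (Real.exp (u z / 2)) (ψ z * Real.exp (-u z)) (dZ (fun w => (u w : ℂ)) z)) i j := by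
  have h := congrFun (dZ_adaptedCol hH hmin hHopf hlam z j) i
  rw [← dZ_apply (contDiff_adaptedCol hH j)] at h
  refine h.trans ?_
  rw [Finset.sum_apply, Matrix.mul_apply]
  exact Finset.sum_congr rfl fun k _ => mul_comm _ _

theorem dZbar_adaptedFrame (hH : IsConformalLift f u H) (hmin : HasZeroMeanCurvature f)
    (hHopf : HasHopfDifferential f (fun z => -Complex.I * (lam ^ 3)⁻¹ * ψ z))
    (hlam : ‖lam‖ = 1) (z : ℂ) (i j : Fin 3) :
    dZbar (fun w => adaptedFrame lam u H w i j) z = (adaptedFrame lam u H z *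
      matV lam (Real.exp (u z / 2)) ((starRingEnd ℂ) (ψ z) * Real.exp (-u z))
        (dZbar (fun w => (u w : ℂ)) z)) i j := by
  have h := congrFun (dZbar_adaptedCol hH hmin hHopf hlam z j) i
  rw [← dZbar_apply (contDiff_adaptedCol hH j)] at h
  refine h.trans ?_
  rw [Finset.sum_apply, Matrix.mul_apply]
  exact Finset.sum_congr rfl fun k _ => mul_comm _ _

theorem contDiff_adaptedFrame (hH : IsConformalLift f u H) (i j : Fin 3) :
    ContDiff ℝ ∞ (fun z => adaptedFrame lam u H z i j) :=
  contDiff_pi.mp (contDiff_adaptedCol hH j) i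

theorem det_adaptedFrame (hH : IsConformalLift f u H) (hmin : HasZeroMeanCurvature f)
    (hHopf : HasHopfDifferential f (fun z => -Complex.I * (lam ^ 3)⁻¹ * ψ z))
    (hlam : ‖lam‖ = 1) (z : ℂ) :
    (adaptedFrame lam u H z).det = (adaptedFrame lam u H 0).det := by
  have hd := fun i j => contDiff_adaptedFrame (lam := lam) hH i j
  refine eq_of_dX_dY_eq_zero (g := fun z => (adaptedFrame lam u H z).det) ?_ (fun z => ?_)
    (fun z => ?_) z 0
  · simp only [Matrix.det_fin_three]
    have := fun i j => (hd i j).differentiable (by simp)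
    fun_prop
  · refine (fderiv_det_eq_mul_trace (B := matU lam (Real.exp (u z / 2)) (ψ z * Real.exp (-u z))
      (dZ (fun w => (u w : ℂ)) z) +
      matV lam (Real.exp (u z / 2)) ((starRingEnd ℂ) (ψ z) * Real.exp (-u z))
        (dZbar (fun w => (u w : ℂ)) z)) (fun i j => ContDiff.diffAt (hd i j) z) (fun i j => ?_)).trans
      (by rw [trace_matU_add_matV, mul_zero])
    · change dX (fun w => adaptedFrame lam u H w i j) z = _
      rw [dX_eq_dZ_add_dZbar, dZ_adaptedFrame hH hmin hHopf hlam,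
        dZbar_adaptedFrame hH hmin hHopf hlam, Matrix.mul_add, Matrix.add_apply]
  · refine (fderiv_det_eq_mul_trace (B := Complex.I • (matU lam (Real.exp (u z / 2)) (ψ z * Real.exp (-u z))
      (dZ (fun w => (u w : ℂ)) z) -
      matV lam (Real.exp (u z / 2)) ((starRingEnd ℂ) (ψ z) * Real.exp (-u z))
        (dZbar (fun w => (u w : ℂ)) z))) (fun i j => ContDiff.diffAt (hd i j) z) (fun i j => ?_)).trans
      (by rw [trace_matU_sub_matV, mul_zero])
    · change dY (fun w => adaptedFrame lam u H w i j) z = _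
      rw [dY_eq_dZ_sub_dZbar, dZ_adaptedFrame hH hmin hHopf hlam,
        dZbar_adaptedFrame hH hmin hHopf hlam, Matrix.mul_smul, Matrix.mul_sub, Matrix.smul_apply,
        Matrix.sub_apply]

theorem IsConformalLift.const_smul (hH : IsConformalLift f u H) {κ : ℂ}
    (hκ : κ * (starRingEnd ℂ) κ = 1) : IsConformalLift f u (fun z => κ • H z) := by
  have hs := hH.contDiff
  have hdd : ∀ v w, hdot (κ • v) (κ • w) = hdot v w := by
    intro v w
    rw [hdot_smul_left, hdot_smul_right]
    linear_combination hdot v w * hκ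
  refine hH.of_isHorizontalLift ⟨⟨hs.const_smul κ, fun z => ⟨?_, ?_⟩⟩, fun z => ⟨?_, ?_⟩⟩
  · rw [hdd, hH.self]
  · exact Submodule.smul_mem _ _ (hH.lift.1.2 z).2
  · rw [dX_const_smul _ (ContDiff.diffAt hs z), hdd, (hH.lift.2 z).1]
  · rw [dY_const_smul _ (ContDiff.diffAt hs z), hdd, (hH.lift.2 z).2]

theorem adaptedFrame_const_smul (hH : IsConformalLift f u H) (κ z : ℂ) :
    adaptedFrame lam u (fun z => κ • H z) z = κ • adaptedFrame lam u H z := by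
  have hs := hH.contDiff
  ext i j
  fin_cases j <;> simp [adaptedFrame, adaptedCol, dZ_const_smul _ (ContDiff.diffAt hs z),
    dZbar_const_smul _ (ContDiff.diffAt hs z)]
  all_goals ring

theorem exists_isFrame (hf : IsMinimalLagrangian f u)
    (hHopf : HasHopfDifferential f (fun z => -Complex.I * (lam ^ 3)⁻¹ * ψ z))
    (hlam : ‖lam‖ = 1) : ∃ Fr, IsFrame f u ψ lam Fr := by
  obtain ⟨H, hH⟩ := exists_isConformalLift hf.1
  set δ := (adaptedFrame lam u H 0).det with hδ
  have hδ1 : (starRingEnd ℂ) δ * δ = 1 := by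
    have h := congrArg Matrix.det (conjTranspose_mul_adaptedFrame hH hlam 0)
    rw [Matrix.det_mul, Matrix.det_conjTranspose, Matrix.det_one] at h
    exact h
  -- Multiplying the lift by κ multiplies the constant unimodular determinant δ by κ³, so a cube
  -- root of δ̄ normalises it to 1.
  obtain ⟨κ, hκ⟩ := IsAlgClosed.exists_pow_nat_eq ((starRingEnd ℂ) δ) (n := 3) (by norm_num)
  have hκ1 : κ * (starRingEnd ℂ) κ = 1 := by
    have h : ‖κ‖ ^ 3 = 1 := by
      rw [← norm_pow, hκ, RCLike.norm_conj]
      have := congrArg norm hδ1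
      rw [norm_mul, RCLike.norm_conj, norm_one] at this
      nlinarith [norm_nonneg δ]
    exact mul_conj_of_norm_eq_one ((pow_eq_one_iff_of_nonneg (norm_nonneg _) (by norm_num)).mp h)
  have hK := hH.const_smul hκ1
  refine ⟨adaptedFrame lam u (fun z => κ • H z), contDiff_adaptedFrame hK, fun z => ?_,
    dZ_adaptedFrame hK hf.2 hHopf hlam, dZbar_adaptedFrame hK hf.2 hHopf hlam, fun z => ?_⟩
  · rw [Matrix.mem_specialUnitaryGroup_iff, Matrix.mem_unitaryGroup_iff']
    refine ⟨conjTranspose_mul_adaptedFrame hK hlam z, ?_⟩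
    rw [adaptedFrame_const_smul hH, Matrix.det_smul, det_adaptedFrame hH hf.2 hHopf hlam,
      Fintype.card_fin, hκ, hδ1]
  · exact (hK.lift.1.2 z).2

end AdaptedFrame

/-! ### The differential equation of the conformal factor -/

section Metric

variable {f : ℂ → ℙ ℂ (Fin 3 → ℂ)} {u : ℂ → ℝ} {H : ℂ → Fin 3 → ℂ}

theorem dY_exp_comp {u : ℂ → ℝ} (hu : ContDiff ℝ ∞ u) (z : ℂ) :
    dY (fun w => Real.exp (u w)) z = Real.exp (u z) * dY u z := by
  simp only [dY]
  rw [(ContDiff.diffAt hu z).hasFDerivAt.exp.fderiv]; rfl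

theorem dZ_ofRealFun_of_dX_eq_zero {u : ℂ → ℝ} (hu : ContDiff ℝ ∞ u) {z : ℂ} (h : dX u z = 0) :
    dZ (ofRealFun u) z = -(Complex.I / 2) * dY u z := by
  have h1 : dX (ofRealFun u) z = (dX u z : ℝ) := dX_ofReal (ContDiff.diffAt hu z)
  have h2 : dY (ofRealFun u) z = (dY u z : ℝ) := dY_ofReal (ContDiff.diffAt hu z)
  rw [dZ, h1, h2, h, smul_eq_mul, smul_eq_mul, Complex.ofReal_zero]; ring

theorem dZbar_ofRealFun_of_dX_eq_zero {u : ℂ → ℝ} (hu : ContDiff ℝ ∞ u) {z : ℂ} (h : dX u z = 0) :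
    dZbar (ofRealFun u) z = (Complex.I / 2) * dY u z := by
  have h1 : dX (ofRealFun u) z = (dX u z : ℝ) := dX_ofReal (ContDiff.diffAt hu z)
  have h2 : dY (ofRealFun u) z = (dY u z : ℝ) := dY_ofReal (ContDiff.diffAt hu z)
  rw [dZbar, h1, h2, h, smul_eq_mul, smul_eq_mul, Complex.ofReal_zero]; ring

theorem IsConformalLift.dX_u (hH : IsConformalLift f u H)
    (hequiv : IsTranslationallyEquivariant f) (z : ℂ) : dX u z = 0 :=
  dX_eq_zero_of_translate hH.contDiff_u (hH.u_translate hequiv) z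

/-- Without x-dependence, u_z = -(i/2) u_y and ∂_z̄∂_z = ¼ ∂_y², so the Gauss equation is an
ordinary differential equation in y. -/
theorem IsConformalLift.gauss_real (hH : IsConformalLift f u H) (hmin : HasZeroMeanCurvature f)
    (hequiv : IsTranslationallyEquivariant f) (z : ℂ) :
    dY (dY (fun w => Real.exp (u w))) z = -4 * Real.exp (u z) ^ 2 +
      (Real.exp (u z) * dY u z) ^ 2 / Real.exp (u z) +
      4 * ‖hdot (dZ (dZ H) z) (dZbar H z)‖ ^ 2 / Real.exp (u z) := by
  have hus := hH.contDiff_u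
  have hgs : ContDiff ℝ ∞ (fun w => Real.exp (u w)) := Real.contDiff_exp.comp hus
  have hx := hH.dX_u hequiv
  have hxe : dX (expC u) = fun _ => 0 := by
    ext w
    refine dX_eq_zero_of_translate (contDiff_expC hus) (fun z t => ?_) w
    simp only [expC, hH.u_translate hequiv]
  have hye : dY (expC u) = fun w => ((dY (fun w => Real.exp (u w)) w : ℝ) : ℂ) := by
    ext w; exact dY_ofReal (ContDiff.diffAt hgs w)
  have h := hH.gauss hmin z
  rw [dZbar_dZ_eq (contDiff_expC hus), hxe, dX_const, hye,
    dY_ofReal (ContDiff.diffAt (contDiff_dY hgs) z), dZ_ofRealFun_of_dX_eq_zero hus (hx z),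
    dZbar_ofRealFun_of_dX_eq_zero hus (hx z), Complex.mul_conj, Complex.normSq_eq_norm_sq] at h
  have hE : (Real.exp (u z) : ℂ) ≠ 0 := expC_ne_zero u z
  have h2 : ((dY (dY (fun w => Real.exp (u w))) z : ℝ) : ℂ) =
      ((-4 * Real.exp (u z) ^ 2 + (Real.exp (u z) * dY u z) ^ 2 / Real.exp (u z) +
      4 * ‖hdot (dZ (dZ H) z) (dZbar H z)‖ ^ 2 / Real.exp (u z) : ℝ) : ℂ) := by
    simp only [Complex.ofReal_add, Complex.ofReal_mul, Complex.ofReal_div, Complex.ofReal_pow,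
      Complex.ofReal_neg, Complex.ofReal_ofNat]
    rw [smul_eq_mul, expC, Complex.ofReal_pow] at h
    field_simp at h ⊢
    ring_nf at h ⊢
    simp only [Complex.I_sq] at h
    linear_combination h / 4
  exact_mod_cast h2

end Metric

/-! ### The conformal factor as a function of one variable -/

section WODE

variable {w w₁ : ℝ → ℝ} {m : ℝ}

/-- The conservation law of the equation of the conformal factor. -/
theorem energy_of_gauss (hpos : ∀ y, 0 < w y) (h1 : ∀ y, HasDerivAt w (w₁ y) y)
    (h2 : ∀ y, HasDerivAt w₁ (-4 * w y ^ 2 + w₁ y ^ 2 / w y + 4 * m ^ 2 / w y) y)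
    (h0 : w₁ 0 = 0) (y : ℝ) :
    w₁ y ^ 2 = 4 * betaConst (w 0) m * w y ^ 2 - 8 * w y ^ 3 - 4 * m ^ 2 := by
  -- This quotient is a first integral; at 0, where w' vanishes, its value is 8w(0) + 4m²/w(0)² =
  -- 4β.
  have hd : ∀ y, HasDerivAt (fun y => (w₁ y ^ 2 + 8 * w y ^ 3 + 4 * m ^ 2) / w y ^ 2) 0 y := by
    intro y
    have hw := (hpos y).ne'
    have h := ((((h2 y).pow 2).add (((h1 y).pow 3).const_mul 8)).add_const (4 * m ^ 2)).div
      ((h1 y).pow 2) (pow_ne_zero 2 hw)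
    refine h.congr_deriv ?_
    simp only [Pi.pow_apply, Pi.add_apply, Nat.cast_ofNat]
    field_simp
    ring
  have hc := is_const_of_deriv_eq_zero (fun y => (hd y).differentiableAt) (fun y => (hd y).deriv)
    y 0
  have hw := (hpos y).ne'
  have hw0 := (hpos 0).ne'
  simp only [h0] at hc
  rw [betaConst]
  field_simp at hc ⊢
  linear_combination hc

/-- The first integral eliminates w'² and leaves a polynomial right-hand side. Unlike the first
order energy equation, this form determines w uniquely across its turning points. -/
theorem second_order_of_gauss (hpos : ∀ y, 0 < w y) (h1 : ∀ y, HasDerivAt w (w₁ y) y)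
    (h2 : ∀ y, HasDerivAt w₁ (-4 * w y ^ 2 + w₁ y ^ 2 / w y + 4 * m ^ 2 / w y) y)
    (h0 : w₁ 0 = 0) (y : ℝ) :
    HasDerivAt w₁ (4 * betaConst (w 0) m * w y - 12 * w y ^ 2) y := by
  refine (h2 y).congr_deriv ?_
  rw [energy_of_gauss hpos h1 h2 h0 y]
  have hw := (hpos y).ne'
  field_simp
  ring

end WODE

/-! ### The eigenvalues of the generating matrix -/

/-- Real numbers `d 0, d 1, d 2` are the roots of `X³ - β X + 2 ρ`, a cubic with `ρ ≠ 0` and positive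
discriminant. -/
structure IsSpectrum (d : Fin 3 → ℝ) (β ρ : ℝ) : Prop where
  sum : d 0 + d 1 + d 2 = 0
  pair : d 0 * d 1 + d 0 * d 2 + d 1 * d 2 = -β
  prod : d 0 * d 1 * d 2 = -2 * ρ
  disc : 27 * ρ ^ 2 < β ^ 3
  ne_zero : ρ ≠ 0

namespace IsSpectrum

variable {d : Fin 3 → ℝ} {β ρ : ℝ}

theorem cubic (h : IsSpectrum d β ρ) (j : Fin 3) : d j ^ 3 - β * d j + 2 * ρ = 0 := by
  have e1 := h.sum
  have e2 := h.pair
  have e3 := h.prod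
  fin_cases j <;> simp only [Fin.zero_eta, Fin.mk_one, Fin.reduceFinMk]
  · linear_combination d 0 ^ 2 * e1 - d 0 * e2 + e3
  · linear_combination d 1 ^ 2 * e1 - d 1 * e2 + e3
  · linear_combination d 2 ^ 2 * e1 - d 2 * e2 + e3

theorem d_ne_zero (h : IsSpectrum d β ρ) (j : Fin 3) : d j ≠ 0 := by
  intro h0
  have := h.cubic j
  rw [h0] at this
  exact h.ne_zero (by linarith)

/-- A root with d³ = ρ would satisfy βd = 3ρ, and cubing this contradicts the discriminant
inequality. These differences are the denominators of h_j. -/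
theorem cube_ne (h : IsSpectrum d β ρ) (j : Fin 3) : d j ^ 3 ≠ ρ := by
  intro h0
  have h1 := h.cubic j
  have h2 : β * d j = 3 * ρ := by linarith
  have h3 : β ^ 3 * ρ = 27 * ρ ^ 2 * ρ := by
    calc β ^ 3 * ρ = (β * d j) ^ 3 := by rw [mul_pow, h0]
      _ = _ := by rw [h2]; ring
  exact h.disc.ne' (mul_right_cancel₀ h.ne_zero h3)

/-- With χ(X) = X³ - βX + 2ρ this is d χ'(d) = 2(d³ - ρ): it translates the Vandermonde denominators
χ'(d_j) into those of h_j. -/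
theorem quad (h : IsSpectrum d β ρ) (j : Fin 3) :
    d j * (3 * d j ^ 2 - β) = 2 * (d j ^ 3 - ρ) := by
  linear_combination h.cubic j

/-- A double root s forces the roots s, s, -2s, hence β = 3s² and ρ = s³, where the discriminant
vanishes. -/
theorem injective (h : IsSpectrum d β ρ) : Function.Injective d := by
  have key : ∀ s t : ℝ, s + s + t = 0 → s * s + s * t + s * t = -β → s * s * t = -2 * ρ → False := by
    intro s t h1 h2 h3
    obtain rfl : t = -2 * s := by linarith
    have e1 : β = 3 * s ^ 2 := by linarith
    have e2 : ρ = s ^ 3 := by linarith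
    have := h.disc
    rw [e1, e2] at this
    nlinarith
  have e1 := h.sum
  have e2 := h.pair
  have e3 := h.prod
  have h01 : d 0 ≠ d 1 := by
    intro h0; rw [h0] at e1 e2 e3
    exact key (d 1) (d 2) e1 e2 e3
  have h02 : d 0 ≠ d 2 := by
    intro h0; rw [h0] at e1 e2 e3
    exact key (d 2) (d 1) (by linarith) (by linarith) (by linarith)
  have h12 : d 1 ≠ d 2 := by
    intro h0; rw [h0] at e1 e2 e3
    exact key (d 2) (d 0) (by linarith) (by linarith) (by linarith)
  intro i j hij
  fin_cases i <;> fin_cases j <;> simp_all [eq_comm]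

/-- Inversion of the Vandermonde system of the eigenvalues. -/
theorem solve (h : IsSpectrum d β ρ) {X : Fin 3 → ℂ} {s₀ s₁ s₂ : ℂ} (h0 : ∑ j, X j = s₀)
    (h1 : ∑ j, (d j : ℂ) * X j = s₁) (h2 : ∑ j, (d j : ℂ) ^ 2 * X j = s₂) (j : Fin 3) :
    X j * (3 * d j ^ 2 - β) = s₂ + d j * s₁ + (d j ^ 2 - β) * s₀ := by
  have e1 : (d 0 : ℂ) + d 1 + d 2 = 0 := by exact_mod_cast h.sum
  have e2 : (d 0 : ℂ) * d 1 + d 0 * d 2 + d 1 * d 2 = -β := by exact_mod_cast h.pair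
  rw [Fin.sum_univ_three] at h0 h1 h2
  -- The polynomial t² + d_j t + d_j² - β is the cubic divided by t - d_j: it vanishes at the other
  -- two roots and equals 3d_j² - β at d_j. The claim is its pairing with X; in coordinates only ∑
  -- d_j = 0 and the formula for β are needed.
  obtain hd : (d 2 : ℂ) = -d 0 - d 1 := by linear_combination e1
  have hβ : (β : ℂ) = -((d 0 : ℂ) * d 1 + d 0 * d 2 + d 1 * d 2) := by linear_combination e2
  rw [← h0, ← h1, ← h2, hβ]
  fin_cases j <;> simp only [Fin.zero_eta, Fin.mk_one, Fin.reduceFinMk] <;> rw [hd] <;> ring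

/-- The polynomial identity behind the non-vanishing of `d w - ρ`. -/
theorem mul_sub_ne_zero (h : IsSpectrum d β ρ) {w w₁ m b : ℝ} (hb : b ≠ 0)
    (hm : m ^ 2 = ρ ^ 2 + b ^ 2) (hE : w₁ ^ 2 = 4 * β * w ^ 2 - 8 * w ^ 3 - 4 * m ^ 2) (j : Fin 3) :
    d j * w - ρ ≠ 0 := by
  intro h0
  have hd := h.d_ne_zero j
  have hc := h.cubic j
  have hw : d j * w = ρ := by linarith
  -- At w = ρ/d the energy equation becomes a multiple of the cubic at d once m² is replaced by ρ² +
  -- b². This leaves w'² + 4b² = 0, which b ≠ 0 excludes.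
  have h2 : d j ^ 2 * (w₁ ^ 2 + 4 * b ^ 2) = 0 := by
    have e : d j * (d j ^ 2 * (w₁ ^ 2 + 4 * b ^ 2)) = 0 := by
      rw [hE, hm, ← hw]
      linear_combination (-4 * d j ^ 2 * w ^ 2) * hc - 8 * d j ^ 2 * w ^ 2 * hw
    exact (mul_eq_zero.mp e).resolve_left hd
  have h3 : 0 < d j ^ 2 * (w₁ ^ 2 + 4 * b ^ 2) := by positivity
  linarith

end IsSpectrum

/-- The characteristic polynomial of D is t³ + βt - 2iρ, which at t = ix equals -i(x³ - βx + 2ρ). -/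
theorem isSpectrum_of_charpoly {lam : ℂ} (hlam : ‖lam‖ = 1) {u₀ : ℝ} {ψ₀ c : ℂ}
    (hc : c = (lam ^ 3)⁻¹ * ψ₀) (him : c.im ≠ 0) (hre : c.re ≠ 0) {d : Fin 3 → ℝ}
    (hd : (matD lam u₀ ψ₀).charpoly =
      ∏ j, (Polynomial.X - Polynomial.C (Complex.I * (d j : ℂ)))) :
    IsSpectrum d (betaConst (Real.exp u₀) ‖ψ₀‖) c.re := by
  have hl0 : lam ≠ 0 := by rintro rfl; simp at hlam
  have hI := Complex.I_mul_I
  have ha : 0 < Real.exp u₀ := Real.exp_pos _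
  set a := Real.exp u₀ with hadef
  set β := betaConst a ‖ψ₀‖ with hβ
  have hm : ‖ψ₀‖ ^ 2 = c.re ^ 2 + c.im ^ 2 := by
    have h1 : ‖c‖ = ‖ψ₀‖ := by rw [hc, norm_mul, norm_inv, norm_pow, hlam]; simp
    rw [← h1, Complex.sq_norm, Complex.normSq_apply]; ring
  have hβC : (β : ℂ) = 2 * a + ψ₀ * (starRingEnd ℂ) ψ₀ * (a : ℂ)⁻¹ ^ 2 := by
    rw [Complex.mul_conj, Complex.normSq_eq_norm_sq, hβ, betaConst]
    push_cast
    ring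
  have hρ : (2 * c.re : ℂ) = (lam⁻¹) ^ 3 * ψ₀ + lam ^ 3 * (starRingEnd ℂ) ψ₀ := by
    have h1 := Complex.add_conj c
    push_cast at h1
    rw [← h1, hc, map_mul, map_inv₀, map_pow, conj_eq_inv_of_norm_eq_one hlam, inv_pow, inv_inv]
  have he2 : (Real.exp (u₀ / 2) : ℂ) ^ 2 = a := by
    rw [hadef, ← Complex.ofReal_pow, ← Real.exp_nat_mul]; congr 2; push_cast; ring
  have hq : (Real.exp (-u₀) : ℂ) = (a : ℂ)⁻¹ := by rw [Real.exp_neg, Complex.ofReal_inv]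
  have haC : (a : ℂ) ≠ 0 := by exact_mod_cast ha.ne'
  have hdet : ∀ t : ℂ, t ^ 3 + β * t - 2 * Complex.I * c.re =
      (t - Complex.I * d 0) * (t - Complex.I * d 1) * (t - Complex.I * d 2) := by
    intro t
    have h := congrArg (Polynomial.eval t) hd
    rw [Matrix.eval_charpoly, Polynomial.eval_prod, Fin.prod_univ_three] at h
    simp only [Polynomial.eval_sub, Polynomial.eval_X, Polynomial.eval_C] at h
    rw [← h, Matrix.det_fin_three]
    simp only [matD, hq, Matrix.sub_apply, Matrix.scalar_apply, Matrix.diagonal_apply,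
      Matrix.of_apply, Matrix.cons_val, Fin.isValue, Fin.reduceEq, if_true, if_false]
    set e := (Real.exp (u₀ / 2) : ℂ)
    have hll : lam * lam⁻¹ = 1 := mul_inv_cancel₀ hl0
    have haa : (a : ℂ) * (a : ℂ)⁻¹ = 1 := mul_inv_cancel₀ haC
    rw [hβC, mul_comm (2 : ℂ) Complex.I, mul_assoc Complex.I, hρ]
    set q : ℂ := (a : ℂ)⁻¹
    set k := lam⁻¹
    set ψb := (starRingEnd ℂ) ψ₀
    linear_combination (t * (ψ₀ * ψb * q ^ 2 + 2 * e ^ 2) * (lam * k)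
      - Complex.I * (k ^ 3 * ψ₀ + lam ^ 3 * ψb) * q * e ^ 2) * hI
      - t * (ψ₀ * ψb * q ^ 2 + 2 * e ^ 2) * hll
      + (Complex.I * (k ^ 3 * ψ₀ + lam ^ 3 * ψb) * q - 2 * t) * he2
      + Complex.I * (k ^ 3 * ψ₀ + lam ^ 3 * ψb) * haa
  -- The values at 0, 1 and -1 isolate the three elementary symmetric functions of the eigenvalues.
  have e0 := hdet 0
  have e1 := hdet 1
  have e2 := hdet (-1)
  refine ⟨?_, ?_, ?_, ?_, hre⟩
  · have : Complex.I * ((d 0 : ℂ) + d 1 + d 2) = 0 := by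
      linear_combination (e1 + e2) / 2 - e0
    have := (mul_eq_zero.mp this).resolve_left Complex.I_ne_zero
    exact_mod_cast this
  · have : (d 0 : ℂ) * d 1 + d 0 * d 2 + d 1 * d 2 = -β := by
      linear_combination (e1 - e2) / 2 + (d 0 * d 1 + d 0 * d 2 + d 1 * d 2 : ℂ) * hI
    exact_mod_cast this
  · have : Complex.I * ((d 0 : ℂ) * d 1 * d 2) = Complex.I * (-2 * c.re) := by
      linear_combination -e0 + (Complex.I * d 0 * d 1 * d 2) * hI
    have := mul_left_cancel₀ Complex.I_ne_zero this
    exact_mod_cast this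
  · have h1 : 0 < ‖ψ₀‖ ^ 2 / a ^ 2 := by
      have : 0 < c.im ^ 2 := by positivity
      have : 0 < ‖ψ₀‖ ^ 2 := by nlinarith [sq_nonneg c.re]
      positivity
    have h2 : ‖ψ₀‖ ^ 2 = a ^ 2 * (‖ψ₀‖ ^ 2 / a ^ 2) := by field_simp
    rw [hβ, betaConst]
    set b := ‖ψ₀‖ ^ 2 / a ^ 2
    have h3 : c.re ^ 2 < a ^ 2 * b := by
      have : 0 < c.im ^ 2 := by positivity
      linarith
    -- With b = |ψ|²/a² this is the AM-GM inequality 27a²b ≤ (2a + b)³, whose difference factors as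
    -- (a - b)²(8a + b); Im c ≠ 0 gives the strict bound ρ² < a²b.
    have h4 : 0 ≤ (a - b) ^ 2 * (8 * a + b) := by positivity
    nlinarith

/-! ### Frames of translationally equivariant surfaces -/

section SkewHermitian

variable {lam e p pbar uz uzb : ℂ}

theorem conjTranspose_matU_add_matV (hlam : ‖lam‖ = 1) (he : (starRingEnd ℂ) e = e)
    (hp : (starRingEnd ℂ) p = pbar) (hu : (starRingEnd ℂ) uz = uzb) :
    (matU lam e p uz + matV lam e pbar uzb).conjTranspose =
      -(matU lam e p uz + matV lam e pbar uzb) := by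
  have hl := conj_eq_inv_of_norm_eq_one hlam
  subst hp hu
  ext i j
  fin_cases i <;> fin_cases j <;>
    simp [matU, matV, hl, he]

theorem conjTranspose_matU_sub_matV (hlam : ‖lam‖ = 1) (he : (starRingEnd ℂ) e = e)
    (hp : (starRingEnd ℂ) p = pbar) (hu : (starRingEnd ℂ) uz = uzb) :
    (Complex.I • (matU lam e p uz - matV lam e pbar uzb)).conjTranspose =
      -(Complex.I • (matU lam e p uz - matV lam e pbar uzb)) := by
  have hl := conj_eq_inv_of_norm_eq_one hlam
  subst hp hu
  ext i j
  fin_cases i <;> fin_cases j <;>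
    simp [matU, matV, hl, he] <;> ring

/-- Infinitesimal invariance of the Hermitian product: if two rows evolve by the same skew-Hermitian
matrix, their product is constant. -/
theorem hdot_vecMul_add (v w : Fin 3 → ℂ) {A : Matrix (Fin 3) (Fin 3) ℂ}
    (hA : A.conjTranspose = -A) :
    hdot (Matrix.vecMul v A) w + hdot v (Matrix.vecMul w A) = 0 := by
  have h : ∀ i j, (starRingEnd ℂ) (A j i) = -A i j := fun i j => by
    have := congrFun (congrFun hA i) j
    simpa using this
  simp only [hdot_eq, Matrix.vecMul, dotProduct, Fin.sum_univ_three, map_add, map_mul, h]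
  ring

end SkewHermitian

namespace IsFrame

variable {f : ℂ → ℙ ℂ (Fin 3 → ℂ)} {u : ℂ → ℝ} {ψ : ℂ → ℂ} {lam : ℂ}
  {Fr : ℂ → Matrix (Fin 3) (Fin 3) ℂ}

/-- The coefficient matrix `Fr⁻¹ ∂Fr/∂x`. -/
def coeffX (u : ℂ → ℝ) (ψ : ℂ → ℂ) (lam : ℂ) (z : ℂ) : Matrix (Fin 3) (Fin 3) ℂ :=
  matU lam (Real.exp (u z / 2)) (ψ z * Real.exp (-u z)) (dZ (ofRealFun u) z) +
    matV lam (Real.exp (u z / 2)) ((starRingEnd ℂ) (ψ z) * Real.exp (-u z))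
      (dZbar (ofRealFun u) z)

/-- The coefficient matrix `Fr⁻¹ ∂Fr/∂y`. -/
def coeffY (u : ℂ → ℝ) (ψ : ℂ → ℂ) (lam : ℂ) (z : ℂ) : Matrix (Fin 3) (Fin 3) ℂ :=
  Complex.I • (matU lam (Real.exp (u z / 2)) (ψ z * Real.exp (-u z)) (dZ (ofRealFun u) z) -
    matV lam (Real.exp (u z / 2)) ((starRingEnd ℂ) (ψ z) * Real.exp (-u z))
      (dZbar (ofRealFun u) z))

theorem conjTranspose_coeffX (hu : ContDiff ℝ ∞ u) (hlam : ‖lam‖ = 1) (z : ℂ) :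
    (coeffX u ψ lam z).conjTranspose = -coeffX u ψ lam z := by
  refine conjTranspose_matU_add_matV hlam (Complex.conj_ofReal _) ?_ (conj_dZ_ofRealFun hu z)
  rw [map_mul, Complex.conj_ofReal]

theorem conjTranspose_coeffY (hu : ContDiff ℝ ∞ u) (hlam : ‖lam‖ = 1) (z : ℂ) :
    (coeffY u ψ lam z).conjTranspose = -coeffY u ψ lam z := by
  refine conjTranspose_matU_sub_matV hlam (Complex.conj_ofReal _) ?_ (conj_dZ_ofRealFun hu z)
  rw [map_mul, Complex.conj_ofReal]

theorem contDiff_row (hF : IsFrame f u ψ lam Fr) (i : Fin 3) : ContDiff ℝ ∞ (fun z => Fr z i) :=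
  contDiff_pi.mpr (hF.smooth i)

theorem dX_row (hF : IsFrame f u ψ lam Fr) (i : Fin 3) (z : ℂ) :
    dX (fun z => Fr z i) z = Matrix.vecMul (Fr z i) (coeffX u ψ lam z) := by
  ext j
  rw [dX_eq_dZ_add_dZbar, Pi.add_apply, ← dZ_apply (hF.contDiff_row i),
    ← dZbar_apply (hF.contDiff_row i), hF.deriv_z, hF.deriv_zbar, ← Matrix.add_apply,
    ← Matrix.mul_add]
  rfl

theorem dY_row (hF : IsFrame f u ψ lam Fr) (i : Fin 3) (z : ℂ) :
    dY (fun z => Fr z i) z = Matrix.vecMul (Fr z i) (coeffY u ψ lam z) := by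
  ext j
  rw [dY_eq_dZ_sub_dZbar, Pi.smul_apply, Pi.sub_apply, ← dZ_apply (hF.contDiff_row i),
    ← dZbar_apply (hF.contDiff_row i), hF.deriv_z, hF.deriv_zbar, ← Matrix.sub_apply,
    ← Matrix.mul_sub, ← Matrix.smul_apply, ← Matrix.mul_smul]
  rfl

theorem conjTranspose_mul (hF : IsFrame f u ψ lam Fr) (z : ℂ) :
    (Fr z).conjTranspose * Fr z = 1 :=
  Matrix.mem_unitaryGroup_iff'.mp (Matrix.mem_specialUnitaryGroup_iff.mp (hF.special_unitary z)).1

theorem hdot_col (hF : IsFrame f u ψ lam Fr) (z : ℂ) (i j : Fin 3) :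
    hdot (fun k => Fr z k j) (fun k => Fr z k i) = if i = j then 1 else 0 := by
  rw [← Matrix.one_apply, ← hF.conjTranspose_mul z]
  simp only [hdot, Matrix.mul_apply, Matrix.conjTranspose_apply, RCLike.star_def]
  exact Finset.sum_congr rfl fun k _ => mul_comm _ _

/-- The third columns of the coefficient matrices say that F_z and F_z̄ are multiples of the first
two columns of the frame, which are orthogonal to the third. -/
theorem isHorizontalLift (hF : IsFrame f u ψ lam Fr) : IsHorizontalLift f (canonicalLift Fr) := by
  have hs : ContDiff ℝ ∞ (canonicalLift Fr) := contDiff_pi.mpr fun i => hF.smooth i 2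
  have hz : ∀ z, dZ (canonicalLift Fr) z =
      (lam⁻¹ * (Complex.I * Real.exp (u z / 2))) • fun k => Fr z k 0 := by
    intro z
    ext i
    rw [← dZ_apply hs]
    refine (hF.deriv_z z i 2).trans ?_
    simp [Matrix.mul_apply, Fin.sum_univ_three, matU]
    ring
  have hzb : ∀ z, dZbar (canonicalLift Fr) z =
      (lam * (Complex.I * Real.exp (u z / 2))) • fun k => Fr z k 1 := by
    intro z
    ext i
    rw [← dZbar_apply hs]
    refine (hF.deriv_zbar z i 2).trans ?_
    simp [Matrix.mul_apply, Fin.sum_univ_three, matV]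
    ring
  have h0 : ∀ z, hdot (fun k => Fr z k 0) (canonicalLift Fr z) = 0 := fun z => hF.hdot_col z 2 0
  have h1 : ∀ z, hdot (fun k => Fr z k 1) (canonicalLift Fr z) = 0 := fun z => hF.hdot_col z 2 1
  refine ⟨⟨hs, fun z => ⟨hF.hdot_col z 2 2, hF.lifts z⟩⟩, fun z => ⟨?_, ?_⟩⟩
  · rw [dX_eq_dZ_add_dZbar, hz, hzb, hdot_add_left, hdot_smul_left, hdot_smul_left, h0, h1]; ring
  · rw [dY_eq_dZ_sub_dZbar, hz, hzb, hdot_smul_left, hdot_sub_left, hdot_smul_left,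
      hdot_smul_left, h0, h1]
    ring

/-- Since the coefficient matrices do not depend on `x`, the matrix `Fr(z + t) Fr(z)⁻¹` does not
depend on `z`. -/
theorem hdot_row_translate (hF : IsFrame f u ψ lam Fr) (hu : ContDiff ℝ ∞ u) (hlam : ‖lam‖ = 1)
    {t : ℝ} (hX : ∀ z, coeffX u ψ lam (z + t) = coeffX u ψ lam z)
    (hY : ∀ z, coeffY u ψ lam (z + t) = coeffY u ψ lam z) (i j : Fin 3) (z z' : ℂ) :
    hdot (Fr (z + t) i) (Fr z j) = hdot (Fr (z' + t) i) (Fr z' j) := by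
  have hi : ContDiff ℝ ∞ (fun z : ℂ => Fr (z + t) i) :=
    (hF.contDiff_row i).comp (contDiff_id.add contDiff_const)
  have hj := hF.contDiff_row j
  refine eq_of_dX_dY_eq_zero (g := fun z : ℂ => hdot (Fr (z + t) i) (Fr z j))
    ((contDiff_hdot hi hj).differentiable (by simp)) (fun z => ?_) (fun z => ?_) z z'
  · rw [dX_hdot (ContDiff.diffAt hi z) (ContDiff.diffAt hj z), hF.dX_row j,
      dX_translate (fun z => Fr z i), hF.dX_row i, hX]
    exact hdot_vecMul_add _ _ (conjTranspose_coeffX hu hlam z)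
  · rw [dY_hdot (ContDiff.diffAt hi z) (ContDiff.diffAt hj z), hF.dY_row j,
      dY_translate (fun z => Fr z i), hF.dY_row i, hY]
    exact hdot_vecMul_add _ _ (conjTranspose_coeffY hu hlam z)

/-- The derivative at t = 0 of Fr(z + t) Fr(z)*, which is the same matrix for every z. -/
theorem coeffX_mul_const (hF : IsFrame f u ψ lam Fr) (hu : ContDiff ℝ ∞ u) (hlam : ‖lam‖ = 1)
    (hX : ∀ (z : ℂ) (t : ℝ), coeffX u ψ lam (z + t) = coeffX u ψ lam z)
    (hY : ∀ (z : ℂ) (t : ℝ), coeffY u ψ lam (z + t) = coeffY u ψ lam z) (z : ℂ) :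
    Fr z * coeffX u ψ lam z * (Fr z).conjTranspose =
      Fr 0 * coeffX u ψ lam 0 * (Fr 0).conjTranspose := by
  ext i j
  have key : ∀ z : ℂ, HasDerivAt (fun t : ℝ => hdot (Fr (z + t) i) (Fr z j))
      ((Fr z * coeffX u ψ lam z * (Fr z).conjTranspose) i j) 0 := by
    intro z
    have hi := hF.contDiff_row i
    have hg : ContDiff ℝ ∞ (fun w : ℂ => hdot (Fr w i) (Fr z j)) := contDiff_hdot hi contDiff_const
    have h := hasDerivAt_line_x (g := fun w : ℂ => hdot (Fr w i) (Fr z j)) (z := z) (x := 0)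
      (ContDiff.diffAt hg _)
    refine h.congr_deriv ?_
    rw [dX_hdot (ContDiff.diffAt hi _) (differentiableAt_const _), dX_const, hF.dX_row]
    simp [hdot, Matrix.mul_apply, Matrix.vecMul, dotProduct]
  have h1 := key z
  rw [funext fun t : ℝ => hF.hdot_row_translate hu hlam (fun z => hX z t) (fun z => hY z t) i j z 0]
    at h1
  exact h1.unique (key 0)

/-- Translation in x is generated by one constant matrix, conjugate to D when u'(0) = 0, so
diagonalising it separates the variable x. -/
theorem dX_canonicalLift (hF : IsFrame f u ψ lam Fr) (hu : ContDiff ℝ ∞ u) (hlam : ‖lam‖ = 1)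
    (hX : ∀ (z : ℂ) (t : ℝ), coeffX u ψ lam (z + t) = coeffX u ψ lam z)
    (hY : ∀ (z : ℂ) (t : ℝ), coeffY u ψ lam (z + t) = coeffY u ψ lam z) (z : ℂ) :
    dX (canonicalLift Fr) z =
      (Fr 0 * coeffX u ψ lam 0 * (Fr 0).conjTranspose).mulVec (canonicalLift Fr z) := by
  have hs : ContDiff ℝ ∞ (canonicalLift Fr) := contDiff_pi.mpr fun i => hF.smooth i 2
  rw [← hF.coeffX_mul_const hu hlam hX hY z]
  ext i
  have h1 : dX (canonicalLift Fr) z i = dX (fun z => Fr z i) z 2 := by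
    rw [dX_eq_dZ_add_dZbar, dX_eq_dZ_add_dZbar, Pi.add_apply, Pi.add_apply, ← dZ_apply hs,
      ← dZbar_apply hs, ← dZ_apply (hF.contDiff_row i), ← dZbar_apply (hF.contDiff_row i)]
    rfl
  rw [h1, hF.dX_row]
  have h2 : (Fr z * coeffX u ψ lam z * (Fr z).conjTranspose).mulVec (canonicalLift Fr z) i =
      (Fr z * coeffX u ψ lam z * (Fr z).conjTranspose * Fr z) i 2 := rfl
  rw [h2, Matrix.mul_assoc, hF.conjTranspose_mul, Matrix.mul_one]
  rfl

theorem coeffX_zero (h : dZ (ofRealFun u) 0 = 0) (h' : dZbar (ofRealFun u) 0 = 0) :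
    coeffX u ψ lam 0 = matD lam (u 0) (ψ 0) := by
  rw [coeffX, h, h']
  ext i j
  fin_cases i <;> fin_cases j <;> simp [matU, matV, matD] <;> ring

end IsFrame

/-! ### Orthonormal bases of eigenvectors -/

theorem eq_sum_of_orthonormal {m : Fin 3 → Fin 3 → ℂ}
    (hm : ∀ j k, hdot (m j) (m k) = if j = k then 1 else 0) (v : Fin 3 → ℂ) :
    v = ∑ j, hdot v (m j) • m j := by
  rw [← sub_eq_zero]
  apply eq_zero_of_orthogonal (a := m 0) (b := m 1) (c := m 2) <;>
    simp [hm, hdot_sub_left, hdot_sum_left, hdot_smul_left]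

theorem hdot_eq_sum_of_orthonormal {m : Fin 3 → Fin 3 → ℂ}
    (hm : ∀ j k, hdot (m j) (m k) = if j = k then 1 else 0) (v w : Fin 3 → ℂ) :
    hdot v w = ∑ j, hdot v (m j) * (starRingEnd ℂ) (hdot w (m j)) := by
  conv_lhs => rw [eq_sum_of_orthonormal hm v]
  rw [hdot_sum_left]
  refine Finset.sum_congr rfl fun j _ => ?_
  rw [hdot_smul_left, conj_hdot]

/-- Skew-Hermitian symmetry gives i(d_j - d_k) l_j·l_k = 0, so eigenvectors of the distinct
eigenvalues are orthogonal and need only be normalised. -/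
theorem exists_orthonormal_eigenvectors {D : Matrix (Fin 3) (Fin 3) ℂ}
    (hD : D.conjTranspose = -D) {d : Fin 3 → ℝ} (hinj : Function.Injective d)
    (hd : D.charpoly = ∏ j, (Polynomial.X - Polynomial.C (Complex.I * (d j : ℂ)))) :
    ∃ l : Fin 3 → Fin 3 → ℂ, (∀ j k, hdot (l j) (l k) = if j = k then 1 else 0) ∧
      ∀ j, D.mulVec (l j) = (Complex.I * (d j : ℂ)) • l j := by
  have hex : ∀ j, ∃ v : Fin 3 → ℂ, hdot v v = 1 ∧ D.mulVec v = (Complex.I * (d j : ℂ)) • v := by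
    intro j
    have h0 : (Matrix.scalar (Fin 3) (Complex.I * (d j : ℂ)) - D).det = 0 := by
      rw [← Matrix.eval_charpoly, hd, Polynomial.eval_prod]
      exact Finset.prod_eq_zero (Finset.mem_univ j) (by simp)
    obtain ⟨v, hv, hDv⟩ := Matrix.exists_mulVec_eq_zero_iff.mpr h0
    have hDv' : D.mulVec v = (Complex.I * (d j : ℂ)) • v := by
      rw [Matrix.sub_mulVec, sub_eq_zero] at hDv
      rw [← hDv, Matrix.scalar_apply]
      ext i
      simp [Matrix.mulVec_diagonal]
    have hr : 0 < (hdot v v).re := by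
      refine lt_of_le_of_ne (hdot_self_re_nonneg v) fun h => hv (hdot_self_eq_zero ?_)
      exact Complex.ext h.symm (hdot_self_im v)
    have hvv : hdot v v = ((hdot v v).re : ℂ) := Complex.ext rfl (hdot_self_im v)
    refine ⟨((√(hdot v v).re)⁻¹ : ℂ) • v, ?_, ?_⟩
    · rw [hdot_smul_left, hdot_smul_right, ← Complex.ofReal_inv, Complex.conj_ofReal]
      conv_lhs => rw [hvv]
      norm_cast
      have := Real.mul_self_sqrt hr.le
      have hs := (Real.sqrt_pos.mpr hr).ne'
      field_simp
      linarith
    · rw [Matrix.mulVec_smul, hDv', smul_comm]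
  choose l hl1 hl2 using hex
  refine ⟨l, fun j k => ?_, hl2⟩
  split_ifs with hjk
  · rw [← hjk]; exact hl1 j
  · have h := hdot_mulVec_left D (l j) (l k)
    rw [hD, Matrix.neg_mulVec, hl2, hl2, hdot_neg_right, hdot_smul_left, hdot_smul_right, map_mul,
      Complex.conj_I, Complex.conj_ofReal] at h
    have h2 : Complex.I * ((d j - d k : ℝ) : ℂ) * hdot (l j) (l k) = 0 := by
      push_cast; linear_combination h
    refine (mul_eq_zero.mp h2).resolve_left (mul_ne_zero Complex.I_ne_zero ?_)
    exact_mod_cast sub_ne_zero.mpr fun h => hjk (hinj h)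

/-! ### The coordinates of a horizontal lift in a basis of eigenvectors -/

section Coordinates

variable {f : ℂ → ℙ ℂ (Fin 3 → ℂ)} {u : ℂ → ℝ} {F : ℂ → Fin 3 → ℂ} {c : ℂ} {d : Fin 3 → ℝ}
  {β : ℝ} {m : Fin 3 → Fin 3 → ℂ}

/-- The second moment for F_y: in the eigenbasis F_xx has coordinates -d_j² P_j. Expanding F_xx =
F_zz + 2F_zz̄ + F_z̄z̄ brings in the Hopf coefficient, of which only Im c survives. -/
theorem IsConformalLift.hdot_dY_dXX (hH : IsConformalLift f u F) (hmin : HasZeroMeanCurvature f)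
    (hφ : ∀ z, hdot (dZ (dZ F) z) (dZbar F z) = -Complex.I * c) {z : ℂ} (hx : dX u z = 0) :
    hdot (dY F z) (dX (dX F) z) =
      -((Real.exp (u z) * dY u z : ℝ) + 2 * Complex.I * c.im : ℂ) := by
  have hs := hH.contDiff
  have hus := hH.contDiff_u
  have hw := expC_ne_zero u z
  have h1 : dX (dX F) z = dZ (dZ F) z + dZbar (dZ F) z + (dZ (dZbar F) z + dZbar (dZbar F) z) := by
    rw [funext (dX_eq_dZ_add_dZbar F), dX_add (ContDiff.diffAt (contDiff_dZ hs) z)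
      (ContDiff.diffAt (contDiff_dZbar hs) z), dX_eq_dZ_add_dZbar, dX_eq_dZ_add_dZbar]
  rw [h1, dZ_dZbar hs, hH.laplace hmin, hH.zz hmin, hH.zbarzbar hmin, hφ, dY_eq_dZ_sub_dZbar]
  simp only [hdot_smul_left, hdot_sub_left, hdot_add_right, hdot_sub_right, hdot_smul_right,
    hH.z_z, hH.z_zbar, hH.zbar_zbar, hH.z_self, hH.zbar_self, hdot_eq_zero_comm (hH.z_zbar z),
    map_mul, map_neg, map_inv₀, conj_expC, Complex.conj_I, Complex.conj_conj,
    ← conj_dZ_ofRealFun hus]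
  rw [dZ_ofRealFun_of_dX_eq_zero hus hx]
  have hcc := Complex.sub_conj c
  push_cast at hcc
  have hE : expC u z = (Real.exp (u z) : ℂ) := rfl
  simp only [map_mul, map_neg, map_div₀, Complex.conj_I, Complex.conj_ofReal, map_ofNat]
  rw [Complex.ofReal_mul, ← hE]
  field_simp
  linear_combination (2 * ((dY u z : ℝ) : ℂ) * expC u z ^ 2 +
    2 * expC u z * (c - (starRingEnd ℂ) c)) * Complex.I_mul_I - 2 * expC u z * hcc

variable (hH : IsConformalLift f u F) (hm : ∀ j k, hdot (m j) (m k) = if j = k then 1 else 0)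
  (hX : ∀ z j, hdot (dX F z) (m j) = Complex.I * d j * hdot (F z) (m j))

include hH hX in
theorem hdot_dXX_eigen (z : ℂ) (j : Fin 3) :
    hdot (dX (dX F) z) (m j) = -(d j : ℂ) ^ 2 * hdot (F z) (m j) := by
  have hs := hH.contDiff
  have h1 : dX (fun w => hdot (dX F w) (m j)) z = hdot (dX (dX F) z) (m j) := by
    rw [dX_hdot (ContDiff.diffAt (contDiff_dX hs) z) (differentiableAt_const _), dX_const]
    simp [hdot]
  have h2 : dX (fun w => hdot (F w) (m j)) z = hdot (dX F z) (m j) := by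
    rw [dX_hdot (ContDiff.diffAt hs z) (differentiableAt_const _), dX_const]
    simp [hdot]
  have hP : ContDiff ℝ ∞ (fun w => hdot (F w) (m j)) := contDiff_hdot hs contDiff_const
  have h3 : (fun w => hdot (dX F w) (m j)) = fun w => (Complex.I * d j) • hdot (F w) (m j) := by
    ext w; rw [hX, smul_eq_mul]
  rw [← h1, h3, dX_const_smul _ (ContDiff.diffAt hP z), h2, hX, smul_eq_mul]
  linear_combination ((d j : ℂ) ^ 2 * hdot (F z) (m j)) * Complex.I_mul_I

include hH hm hX in
-- The numbers |P_j|² have the moments 1, 0, 2e^u with respect to the d_j, from |F|² = 1, F_x·F = 0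
-- and |F_x|² = 2e^u. Inverting the Vandermonde system and simplifying with the cubic gives the
-- radicand of h_j.
theorem coord_mul_conj (hsp : IsSpectrum d β c.re) (z : ℂ) (j : Fin 3) :
    hdot (F z) (m j) * (starRingEnd ℂ) (hdot (F z) (m j)) * (d j ^ 3 - c.re) =
      d j * (Real.exp (u z) : ℂ) - c.re := by
  have h0 := hdot_eq_sum_of_orthonormal hm (F z) (F z)
  have h1 := hdot_eq_sum_of_orthonormal hm (dX F z) (F z)
  have h2 := hdot_eq_sum_of_orthonormal hm (dX F z) (dX F z)
  rw [hH.self] at h0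
  rw [(hH.lift.2 z).1] at h1
  rw [hH.xx] at h2
  have e1 : ∑ j, (d j : ℂ) * (hdot (F z) (m j) * (starRingEnd ℂ) (hdot (F z) (m j))) = 0 := by
    have : Complex.I * ∑ j, (d j : ℂ) * (hdot (F z) (m j) * (starRingEnd ℂ) (hdot (F z) (m j)))
        = 0 := by
      rw [h1, Finset.mul_sum]
      exact Finset.sum_congr rfl fun j _ => by rw [hX]; ring
    exact (mul_eq_zero.mp this).resolve_left Complex.I_ne_zero
  have e2 : ∑ j, (d j : ℂ) ^ 2 * (hdot (F z) (m j) * (starRingEnd ℂ) (hdot (F z) (m j))) =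
      2 * (Real.exp (u z) : ℂ) := by
    rw [h2]
    refine Finset.sum_congr rfl fun j _ => ?_
    rw [hX, map_mul, map_mul, Complex.conj_I, Complex.conj_ofReal]
    linear_combination ((d j : ℂ) ^ 2 * (hdot (F z) (m j) * (starRingEnd ℂ) (hdot (F z) (m j)))) *
      Complex.I_mul_I
  have h := hsp.solve h0.symm e1 e2 j
  have hq : (d j : ℂ) * (3 * d j ^ 2 - β) = 2 * (d j ^ 3 - c.re) := by exact_mod_cast hsp.quad j
  have hc : (d j : ℂ) ^ 3 - β * d j + 2 * c.re = 0 := by exact_mod_cast hsp.cubic j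
  linear_combination (d j / 2 : ℂ) * h
    - (hdot (F z) (m j) * (starRingEnd ℂ) (hdot (F z) (m j)) / 2) * hq + hc / 2

include hH hm hX in
-- The numbers (∂_y P_j) conj P_j have the moments 0, 0, w' + 2i Im c, read off from F_y·F, F_y·F_x
-- and F_y·F_xx.
theorem dY_coord_mul_conj (hmin : HasZeroMeanCurvature f)
    (hφ : ∀ z, hdot (dZ (dZ F) z) (dZbar F z) = -Complex.I * c) (hsp : IsSpectrum d β c.re)
    {z : ℂ} (hx : dX u z = 0) (j : Fin 3) :
    hdot (dY F z) (m j) * (starRingEnd ℂ) (hdot (F z) (m j)) * (2 * (d j ^ 3 - c.re)) =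
      d j * ((Real.exp (u z) * dY u z : ℝ) + 2 * Complex.I * c.im) := by
  have h0 := hdot_eq_sum_of_orthonormal hm (dY F z) (F z)
  have h1 := hdot_eq_sum_of_orthonormal hm (dY F z) (dX F z)
  have h2 := hdot_eq_sum_of_orthonormal hm (dY F z) (dX (dX F) z)
  rw [(hH.lift.2 z).2] at h0
  rw [hdot_eq_zero_comm (hH.xy z)] at h1
  rw [hH.hdot_dY_dXX hmin hφ hx] at h2
  have e1 : ∑ j, (d j : ℂ) * (hdot (dY F z) (m j) * (starRingEnd ℂ) (hdot (F z) (m j))) = 0 := by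
    have : -Complex.I * ∑ j, (d j : ℂ) * (hdot (dY F z) (m j) *
        (starRingEnd ℂ) (hdot (F z) (m j))) = 0 := by
      rw [h1, Finset.mul_sum]
      exact Finset.sum_congr rfl fun j _ => by
        rw [hX, map_mul, map_mul, Complex.conj_I, Complex.conj_ofReal]; ring
    exact (mul_eq_zero.mp this).resolve_left (neg_ne_zero.mpr Complex.I_ne_zero)
  have e2 : ∑ j, (d j : ℂ) ^ 2 * (hdot (dY F z) (m j) * (starRingEnd ℂ) (hdot (F z) (m j))) =
      (Real.exp (u z) * dY u z : ℝ) + 2 * Complex.I * c.im := by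
    rw [← neg_neg ((Real.exp (u z) * dY u z : ℝ) + 2 * Complex.I * c.im : ℂ), h2,
      ← Finset.sum_neg_distrib]
    refine Finset.sum_congr rfl fun j _ => ?_
    rw [hdot_dXX_eigen hH hX, map_mul, map_neg, map_pow, Complex.conj_ofReal]
    ring
  have h := hsp.solve h0.symm e1 e2 j
  have hq : (d j : ℂ) * (3 * d j ^ 2 - β) = 2 * (d j ^ 3 - c.re) := by exact_mod_cast hsp.quad j
  linear_combination (d j : ℂ) * h
    - (hdot (dY F z) (m j) * (starRingEnd ℂ) (hdot (F z) (m j))) * hq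

include hH hm hX in
-- Dividing the two moment formulas gives the logarithmic derivative: its real part belongs to h_j,
-- its imaginary part to e^{iG_j}.
theorem dY_coord (hmin : HasZeroMeanCurvature f)
    (hφ : ∀ z, hdot (dZ (dZ F) z) (dZbar F z) = -Complex.I * c) (hsp : IsSpectrum d β c.re)
    {z : ℂ} (hx : dX u z = 0) {j : Fin 3} (hne : d j * Real.exp (u z) - c.re ≠ 0) :
    hdot (dY F z) (m j) = hdot (F z) (m j) *
      (d j * ((Real.exp (u z) * dY u z : ℝ) + 2 * Complex.I * c.im) /
        (2 * (d j * Real.exp (u z) - c.re : ℝ))) := by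
  have h1 := coord_mul_conj hH hm hX hsp z j
  have h2 := dY_coord_mul_conj hH hm hX hmin hφ hsp hx j
  have hne' : (d j * (Real.exp (u z) : ℂ) - c.re) ≠ 0 := by exact_mod_cast hne
  push_cast at h2 hne' ⊢
  push_cast at h1
  field_simp
  rw [← h1]
  linear_combination hdot (F z) (m j) * h2

end Coordinates

/-! ### The functions `h` and `G` -/

section HG

variable {w w₁ : ℝ → ℝ} {c : ℂ} {d : ℝ}

theorem hasDerivAt_gFun (h1 : ∀ y, HasDerivAt w (w₁ y) y) (hne : ∀ y, d * w y - c.re ≠ 0) (y : ℝ) :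
    HasDerivAt (gFun w c d) (d * c.im / (d * w y - c.re)) y := by
  have hwc : Continuous w := continuous_iff_continuousAt.mpr fun y => (h1 y).continuousAt
  have hc : Continuous (fun s => d * c.im / (d * w s - c.re)) :=
    continuous_const.div ((continuous_const.mul hwc).sub continuous_const) hne
  exact hc.integral_hasStrictDerivAt 0 y |>.hasDerivAt

theorem hasDerivAt_hFun (h1 : ∀ y, HasDerivAt w (w₁ y) y)
    (hpos : ∀ y, 0 < (d * w y - c.re) / (d ^ 3 - c.re)) (y : ℝ) :
    HasDerivAt (hFun w c d) (hFun w c d y * (d * w₁ y / (2 * (d * w y - c.re)))) y := by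
  have h := ((((h1 y).const_mul d).sub_const c.re).div_const (d ^ 3 - c.re)).sqrt (hpos y).ne'
  refine h.congr_deriv ?_
  have hs := Real.mul_self_sqrt (hpos y).le
  have hs0 := (Real.sqrt_pos.mpr (hpos y)).ne'
  have hp := (hpos y).ne'
  rw [ne_eq, div_eq_zero_iff, not_or] at hp
  obtain ⟨hp1, hp2⟩ := hp
  rw [hFun]
  set S := √((d * w y - c.re) / (d ^ 3 - c.re))
  rw [eq_div_iff hp2] at hs
  field_simp
  linear_combination -(d * w₁ y) * hs

/-- The coordinate `h e^{iG}` on the imaginary axis. -/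
def hgFun (w : ℝ → ℝ) (c : ℂ) (d y : ℝ) : ℂ :=
  (hFun w c d y : ℂ) * Complex.exp (Complex.I * gFun w c d y)

theorem hgFun_ne_zero {y : ℝ} (hpos : 0 < (d * w y - c.re) / (d ^ 3 - c.re)) :
    hgFun w c d y ≠ 0 :=
  mul_ne_zero (by exact_mod_cast (Real.sqrt_pos.mpr hpos).ne') (Complex.exp_ne_zero _)

theorem hasDerivAt_hgFun (h1 : ∀ y, HasDerivAt w (w₁ y) y)
    (hpos : ∀ y, 0 < (d * w y - c.re) / (d ^ 3 - c.re)) (y : ℝ) :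
    HasDerivAt (hgFun w c d) (hgFun w c d y * (d * ((w₁ y : ℂ) + 2 * Complex.I * c.im) /
      (2 * (d * w y - c.re : ℝ)))) y := by
  have hne : ∀ y, d * w y - c.re ≠ 0 := fun y h0 => by
    have := hpos y; rw [h0, zero_div] at this; exact lt_irrefl _ this
  have hh := (hasDerivAt_hFun h1 hpos y).ofReal_comp
  have hg := (((hasDerivAt_gFun h1 hne y).ofReal_comp).const_mul Complex.I).cexp
  refine (hh.mul hg).congr_deriv ?_
  have hn : ((d * w y - c.re : ℝ) : ℂ) ≠ 0 := by exact_mod_cast hne y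
  rw [hgFun]
  push_cast at hn ⊢
  field_simp

end HG

/-! ### The explicit formula for the canonical lift -/

section Formula

variable {f : ℂ → ℙ ℂ (Fin 3 → ℂ)} {u : ℂ → ℝ} {ψ : ℂ → ℂ} {lam c : ℂ} {d : Fin 3 → ℝ}
  {H : ℂ → Fin 3 → ℂ} {Fr : ℂ → Matrix (Fin 3) (Fin 3) ℂ}

theorem coeffX_translate (hu : ∀ (z : ℂ) (t : ℝ), u (z + t) = u z) (hψ : ∀ z, ψ z = ψ 0) (z : ℂ)
    (t : ℝ) : IsFrame.coeffX u ψ lam (z + t) = IsFrame.coeffX u ψ lam z := by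
  have h : (fun w : ℂ => ofRealFun u (w + t)) = ofRealFun u := by
    ext w; simp only [ofRealFun, hu]
  have h1 := dX_translate (ofRealFun u) t z
  have h2 := dY_translate (ofRealFun u) t z
  rw [h] at h1 h2
  simp only [IsFrame.coeffX, hu, hψ (z + t), hψ z, dZ, dZbar, h1, h2]

theorem coeffY_translate (hu : ∀ (z : ℂ) (t : ℝ), u (z + t) = u z) (hψ : ∀ z, ψ z = ψ 0) (z : ℂ)
    (t : ℝ) : IsFrame.coeffY u ψ lam (z + t) = IsFrame.coeffY u ψ lam z := by
  have h : (fun w : ℂ => ofRealFun u (w + t)) = ofRealFun u := by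
    ext w; simp only [ofRealFun, hu]
  have h1 := dX_translate (ofRealFun u) t z
  have h2 := dY_translate (ofRealFun u) t z
  rw [h] at h1 h2
  simp only [IsFrame.coeffY, hu, hψ (z + t), hψ z, dZ, dZbar, h1, h2]

theorem IsConformalLift.psi_const (hH : IsConformalLift f u H) (hmin : HasZeroMeanCurvature f)
    (hequiv : IsTranslationallyEquivariant f) (hlam : ‖lam‖ = 1)
    (hHopf : HasHopfDifferential f (fun z => -Complex.I * (lam ^ 3)⁻¹ * ψ z)) (z : ℂ) :
    ψ z = ψ 0 := by
  have hl0 : lam ≠ 0 := by rintro rfl; simp at hlam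
  exact mul_left_cancel₀ (mul_ne_zero (neg_ne_zero.mpr Complex.I_ne_zero)
    (inv_ne_zero (pow_ne_zero 3 hl0))) (hH.hopf_const hmin hequiv hHopf z)

/-- Eigenvectors of the generator, moved by the frame at `0`, diagonalize `∂/∂x` on the canonical
lift. -/
theorem hdot_dX_canonicalLift_eigen (hFr : IsFrame f u ψ lam Fr) (hu : ContDiff ℝ ∞ u)
    (hlam : ‖lam‖ = 1) (hut : ∀ (z : ℂ) (t : ℝ), u (z + t) = u z) (hψ : ∀ z, ψ z = ψ 0)
    {D : Matrix (Fin 3) (Fin 3) ℂ} (hD : IsFrame.coeffX u ψ lam 0 = D) {v : Fin 3 → ℂ} {s : ℝ}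
    (hv : D.mulVec v = (Complex.I * (s : ℂ)) • v) (z : ℂ) :
    hdot (dX (canonicalLift Fr) z) ((Fr 0).mulVec v) =
      Complex.I * s * hdot (canonicalLift Fr z) ((Fr 0).mulVec v) := by
  have hDs := IsFrame.conjTranspose_coeffX (ψ := ψ) hu hlam 0
  rw [hD] at hDs
  have e : hdot (canonicalLift Fr z) ((Fr 0).mulVec v) =
      hdot ((Fr 0).conjTranspose.mulVec (canonicalLift Fr z)) v := by
    rw [hdot_mulVec_left, Matrix.conjTranspose_conjTranspose]
  rw [hFr.dX_canonicalLift hu hlam (coeffX_translate hut hψ) (coeffY_translate hut hψ), hD, e,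
    Matrix.mul_assoc, ← Matrix.mulVec_mulVec, hdot_mulVec_mulVec (hFr.conjTranspose_mul 0),
    ← Matrix.mulVec_mulVec, hdot_mulVec_left, hDs, Matrix.neg_mulVec, hv, hdot_neg_right,
    hdot_smul_right, map_mul, Complex.conj_I, Complex.conj_ofReal]
  ring

theorem hasDerivAt_w (hu : ContDiff ℝ ∞ u) {w : ℝ → ℝ}
    (hw : ∀ y : ℝ, w y = Real.exp (u (y * Complex.I))) (y : ℝ) :
    HasDerivAt w (Real.exp (u (y * Complex.I)) * dY u (y * Complex.I)) y := by
  have hgs : ContDiff ℝ ∞ (fun w => Real.exp (u w)) := Real.contDiff_exp.comp hu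
  have h := hasDerivAt_imag_axis hgs y
  rw [dY_exp_comp hu] at h
  rw [funext hw]
  exact h

theorem hasDerivAt_w₁ (hH : IsConformalLift f u H) (hmin : HasZeroMeanCurvature f)
    (hequiv : IsTranslationallyEquivariant f)
    (hφ : ∀ z, hdot (dZ (dZ H) z) (dZbar H z) = -Complex.I * c) {w : ℝ → ℝ}
    (hw : ∀ y : ℝ, w y = Real.exp (u (y * Complex.I))) (y : ℝ) :
    HasDerivAt (fun y : ℝ => Real.exp (u (y * Complex.I)) * dY u (y * Complex.I))
      (-4 * w y ^ 2 + (Real.exp (u (y * Complex.I)) * dY u (y * Complex.I)) ^ 2 / w y +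
        4 * ‖c‖ ^ 2 / w y) y := by
  have hu := hH.contDiff_u
  have hgs : ContDiff ℝ ∞ (fun w => Real.exp (u w)) := Real.contDiff_exp.comp hu
  have h := hasDerivAt_imag_axis (contDiff_dY hgs) y
  rw [hH.gauss_real hmin hequiv, hφ, funext (dY_exp_comp hu)] at h
  rw [hw]
  refine h.congr_deriv ?_
  simp

/-- A function on the plane that satisfies the same first order system as `e^{idx} h e^{iG}` is a
multiple of it. -/
theorem eq_const_mul_hgFun {P : ℂ → ℂ} (hP : ContDiff ℝ ∞ P) {s : ℝ} {w w₁ : ℝ → ℝ}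
    (h1 : ∀ y, HasDerivAt w (w₁ y) y) (hpos : ∀ y, 0 < (s * w y - c.re) / (s ^ 3 - c.re))
    (hx : ∀ z, dX P z = Complex.I * s * P z)
    (hy : ∀ y : ℝ, dY P (y * Complex.I) = P (y * Complex.I) *
      (s * ((w₁ y : ℂ) + 2 * Complex.I * c.im) / (2 * (s * w y - c.re : ℝ)))) (x y : ℝ) :
    P (x + y * Complex.I) = P 0 / hgFun w c s 0 *
      (hgFun w c s y * Complex.exp (Complex.I * (s * x))) := by
  have hS : ∀ y, hgFun w c s y ≠ 0 := fun y => hgFun_ne_zero (hpos y)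
  have e1 : P (y * Complex.I) / hgFun w c s y = P 0 / hgFun w c s 0 := by
    have hd : ∀ y : ℝ, HasDerivAt (fun y : ℝ => P (y * Complex.I) / hgFun w c s y) 0 y := by
      intro y
      refine ((hasDerivAt_imag_axis hP y).div (hasDerivAt_hgFun h1 hpos y) (hS y)).congr_deriv ?_
      rw [hy]; ring
    have := is_const_of_deriv_eq_zero (fun y => (hd y).differentiableAt) (fun y => (hd y).deriv) y 0
    simpa using this
  have e2 : P (y * Complex.I + x) * Complex.exp (-(Complex.I * (s * x))) = P (y * Complex.I) := by
    have hd : ∀ x : ℝ, HasDerivAt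
        (fun x : ℝ => P (y * Complex.I + x) * Complex.exp (-(Complex.I * (s * x)))) 0 x := by
      intro x
      have hl : HasDerivAt (fun x : ℝ => -(Complex.I * (s * (x : ℂ)))) (-(Complex.I * s)) x := by
        simpa using (((Complex.ofRealCLM.hasDerivAt (x := x)).const_mul (s : ℂ)).const_mul
          Complex.I).fun_neg
      refine ((hasDerivAt_line_x (ContDiff.diffAt hP _)).mul hl.cexp).congr_deriv ?_
      rw [hx]; ring
    have := is_const_of_deriv_eq_zero (fun x => (hd x).differentiableAt) (fun x => (hd x).deriv) x 0
    simpa using this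
  rw [← e1, div_mul_eq_mul_div, mul_div_assoc, mul_div_right_comm, div_self (hS y), one_mul, ← e2,
    mul_assoc, ← Complex.exp_add, neg_add_cancel, Complex.exp_zero, mul_one, add_comm]

/-- The radicand of `h` is positive, and the explicit formula for the canonical lift of a frame. -/
theorem canonicalLift_formula (hH : IsConformalLift f u H) (hmin : HasZeroMeanCurvature f)
    (hequiv : IsTranslationallyEquivariant f) (hlam : ‖lam‖ = 1)
    (hHopf : HasHopfDifferential f (fun z => -Complex.I * (lam ^ 3)⁻¹ * ψ z))
    (hu0 : dY u 0 = 0) (hc : c = (lam ^ 3)⁻¹ * ψ 0) {β : ℝ} (hsp : IsSpectrum d β c.re)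
    {w : ℝ → ℝ} (hw : ∀ y : ℝ, w y = Real.exp (u (y * Complex.I)))
    (hne : ∀ j y, d j * w y - c.re ≠ 0)
    (hd : (matD lam (u 0) (ψ 0)).charpoly =
      ∏ j, (Polynomial.X - Polynomial.C (Complex.I * (d j : ℂ))))
    (hFr : IsFrame f u ψ lam Fr) :
    (∀ j y, 0 < (d j * w y - c.re) / (d j ^ 3 - c.re)) ∧
    ∃ l : Fin 3 → Fin 3 → ℂ,
      (∀ j k, hdot (l j) (l k) = if j = k then 1 else 0) ∧
      (∀ j, (matD lam (u 0) (ψ 0)).mulVec (l j) = (Complex.I * (d j : ℂ)) • l j) ∧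
      ∀ x y : ℝ, canonicalLift Fr (x + y * Complex.I) =
        (Fr 0).mulVec (∑ j, ((hFun w c (d j) y : ℂ) *
          Complex.exp (Complex.I * (d j * x) + Complex.I * gFun w c (d j) y)) • l j) := by
  have hus := hH.contDiff_u
  have hux := hH.dX_u hequiv
  have hψ := hH.psi_const hmin hequiv hlam hHopf
  have hF := hH.of_isHorizontalLift hFr.isHorizontalLift
  have hφ : ∀ z, hdot (dZ (dZ (canonicalLift Fr)) z) (dZbar (canonicalLift Fr) z) =
      -Complex.I * c := by
    intro z
    rw [hHopf _ hFr.isHorizontalLift]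
    simp only
    rw [hψ, hc, mul_assoc]
  have hD : IsFrame.coeffX u ψ lam 0 = matD lam (u 0) (ψ 0) := by
    apply IsFrame.coeffX_zero
    · rw [dZ_ofRealFun_of_dX_eq_zero hus (hux 0), hu0]; simp
    · rw [dZbar_ofRealFun_of_dX_eq_zero hus (hux 0), hu0]; simp
  have hDs := IsFrame.conjTranspose_coeffX (ψ := ψ) hus hlam 0
  rw [hD] at hDs
  obtain ⟨l, hl1, hl2⟩ := exists_orthonormal_eigenvectors hDs hsp.injective hd
  -- Fr(0) carries eigenvectors of D to eigenvectors of the generator Fr(0) D Fr(0)*.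
  set m : Fin 3 → Fin 3 → ℂ := fun j => (Fr 0).mulVec (l j) with hm
  have hm1 : ∀ j k, hdot (m j) (m k) = if j = k then 1 else 0 := fun j k => by
    rw [hm, hdot_mulVec_mulVec (hFr.conjTranspose_mul 0), hl1]
  have hX : ∀ z j, hdot (dX (canonicalLift Fr) z) (m j) =
      Complex.I * d j * hdot (canonicalLift Fr z) (m j) := fun z j =>
    hdot_dX_canonicalLift_eigen hFr hus hlam (hH.u_translate hequiv) hψ hD (hl2 j) z
  set P : Fin 3 → ℂ → ℂ := fun j z => hdot (canonicalLift Fr z) (m j) with hPdef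
  have hPs : ∀ j, ContDiff ℝ ∞ (P j) := fun j => contDiff_hdot hF.contDiff contDiff_const
  have hnorm : ∀ j (y : ℝ), ‖P j (y * Complex.I)‖ ^ 2 * (d j ^ 3 - c.re) = d j * w y - c.re := by
    intro j y
    have h := coord_mul_conj hF hm1 hX hsp (y * Complex.I) j
    rw [Complex.mul_conj, Complex.normSq_eq_norm_sq, ← hw] at h
    exact_mod_cast h
  have hsq : ∀ j (y : ℝ), (d j * w y - c.re) / (d j ^ 3 - c.re) = ‖P j (y * Complex.I)‖ ^ 2 :=
    fun j y => by rw [← hnorm, mul_div_cancel_right₀ _ (sub_ne_zero.mpr (hsp.cube_ne j))]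
  -- The radicand is the squared modulus of a coordinate, hence nonnegative, and its numerator has
  -- no zeros.
  have hpos : ∀ j y, 0 < (d j * w y - c.re) / (d j ^ 3 - c.re) := by
    intro j y
    refine lt_of_le_of_ne (by rw [hsq]; positivity) (Ne.symm (div_ne_zero (hne j y) ?_))
    exact sub_ne_zero.mpr (hsp.cube_ne j)
  refine ⟨hpos, ?_⟩
  have hPx : ∀ j z, dX (P j) z = Complex.I * d j * P j z := by
    intro j z
    rw [hPdef]
    simp only
    rw [dX_hdot (ContDiff.diffAt hF.contDiff z) (differentiableAt_const _), dX_const, hX]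
    simp [hdot]
  have hPy : ∀ j (y : ℝ), dY (P j) (y * Complex.I) = P j (y * Complex.I) *
      (d j * (((Real.exp (u (y * Complex.I)) * dY u (y * Complex.I) : ℝ) : ℂ) +
        2 * Complex.I * c.im) / (2 * (d j * w y - c.re : ℝ))) := by
    intro j y
    have h := dY_coord hF hm1 hX hmin hφ hsp (hux (y * Complex.I)) (j := j)
      (by rw [← hw]; exact hne j y)
    rw [← hw y] at h
    rw [← hw y]
    refine Eq.trans ?_ h
    rw [hPdef]
    simp only
    rw [dY_hdot (ContDiff.diffAt hF.contDiff _) (differentiableAt_const _), dY_const]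
    simp [hdot]
  have hPform := fun j => eq_const_mul_hgFun (hPs j) (hasDerivAt_w hus hw) (hpos j) (hPx j) (hPy j)
  -- These constants of integration are unimodular because |P_j(0)| = h_j(0) and G_j(0) = 0.
  -- Rescaling l_j by them keeps an orthonormal eigenbasis.
  set κ : Fin 3 → ℂ := fun j => P j 0 / hgFun w c (d j) 0 with hκ
  have hκ1 : ∀ j, κ j * (starRingEnd ℂ) (κ j) = 1 := by
    intro j
    apply mul_conj_of_norm_eq_one
    have h1 : ‖hgFun w c (d j) 0‖ = ‖P j 0‖ := by
      have h2 := hsq j 0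
      rw [hgFun, hFun, h2, Real.sqrt_sq (norm_nonneg _)]
      simp [gFun]
    have h0 := hgFun_ne_zero (hpos j 0)
    rw [hκ]
    simp only
    rw [norm_div, ← h1, div_self (norm_ne_zero_iff.mpr h0)]
  refine ⟨fun j => κ j • l j, fun j k => ?_, fun j => ?_, fun x y => ?_⟩
  · rw [hdot_smul_left, hdot_smul_right, hl1]
    split_ifs with hjk
    · rw [← hjk, mul_one, hκ1]
    · simp
  · rw [Matrix.mulVec_smul, hl2, smul_comm]
  · rw [eq_sum_of_orthonormal hm1 (canonicalLift Fr (x + y * Complex.I)), Matrix.mulVec_sum]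
    refine Finset.sum_congr rfl fun j _ => ?_
    have h := hPform j x y
    rw [Matrix.mulVec_smul, Matrix.mulVec_smul, smul_smul]
    congr 1
    refine h.trans ?_
    simp only [hκ]
    rw [hgFun.eq_def w c (d j) y, Complex.exp_add]
    ring

end Formula

/-! ### The period of the conformal factor -/

/-- Uniqueness for e'' = k e. Since k may be unbounded, the Lipschitz bound is taken on an interval
(-B, B) containing t, where |k| ≤ M; the constant M + 1 covers both components of the first order
system. -/
theorem eq_zero_of_linear_second_order {e e₁ k : ℝ → ℝ} (hk : Continuous k)
    (h1 : ∀ t, HasDerivAt e (e₁ t) t) (h2 : ∀ t, HasDerivAt e₁ (k t * e t) t) (h0 : e 0 = 0)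
    (h0' : e₁ 0 = 0) (t : ℝ) : e t = 0 := by
  set B := |t| + 1 with hB
  have hB0 : 0 < B := by positivity
  obtain ⟨M, hM⟩ := (isCompact_Icc (a := -B) (b := B)).exists_bound_of_continuousOn hk.continuousOn
  have hM0 : 0 ≤ M := (norm_nonneg _).trans (hM 0 ⟨by linarith, hB0.le⟩)
  set K : NNReal := ⟨M + 1, by linarith⟩ with hK
  have hv : ∀ s ∈ Set.Ioo (-B) B,
      LipschitzOnWith K (fun x : ℝ × ℝ => (x.2, k s * x.1)) Set.univ := by
    intro s hs
    refine LipschitzWith.lipschitzOnWith (LipschitzWith.of_dist_le_mul fun x y => ?_)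
    have hks := hM s ⟨hs.1.le, hs.2.le⟩
    have hd0 : 0 ≤ dist x y := dist_nonneg
    have d1 : dist x.1 y.1 ≤ dist x y := le_max_left _ _
    have d2 : dist x.2 y.2 ≤ dist x y := le_max_right _ _
    rw [Prod.dist_eq]
    change max (dist x.2 y.2) (dist (k s * x.1) (k s * y.1)) ≤ (M + 1) * dist x y
    refine max_le (by nlinarith) ?_
    rw [Real.dist_eq, ← mul_sub, abs_mul, ← Real.dist_eq]
    have : |k s| * dist x.1 y.1 ≤ M * dist x y :=
      mul_le_mul hks d1 dist_nonneg hM0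
    linarith
  have key := ODE_solution_unique_of_mem_Ioo (v := fun s x => (x.2, k s * x.1))
    (f := fun s => (e s, e₁ s)) (g := fun _ => (0, 0)) (t₀ := 0) hv ⟨by linarith, hB0⟩
    (fun s _ => ⟨(h1 s).prodMk (h2 s), trivial⟩)
    (fun s _ => ⟨(hasDerivAt_const s ((0, 0) : ℝ × ℝ)).congr_deriv (by simp; rfl), trivial⟩) (by simp [h0, h0'])
  have ht : t ∈ Set.Ioo (-B) B := by
    constructor <;> linarith [neg_abs_le t, le_abs_self t]
  exact congrArg Prod.fst (key ht)

/-! ### The elliptic integral of the first kind and its inverse -/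

section Elliptic

/-- The incomplete elliptic integral of the first kind. -/
def ellipticF (q θ : ℝ) : ℝ := ∫ s in (0 : ℝ)..θ, 1 / √(1 - q * Real.sin s ^ 2)

variable {q : ℝ}

theorem one_sub_mul_sin_sq_pos (hq0 : 0 ≤ q) (hq : q < 1) (θ : ℝ) : 0 < 1 - q * Real.sin θ ^ 2 := by
  nlinarith [Real.sin_sq_le_one θ, sq_nonneg (Real.sin θ)]

theorem hasDerivAt_ellipticF (hq0 : 0 ≤ q) (hq : q < 1) (θ : ℝ) :
    HasDerivAt (ellipticF q) (1 / √(1 - q * Real.sin θ ^ 2)) θ := by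
  have hc : Continuous (fun s : ℝ => 1 / √(1 - q * Real.sin s ^ 2)) := by
    refine continuous_const.div (by fun_prop) fun s => ?_
    exact (Real.sqrt_pos.mpr (one_sub_mul_sin_sq_pos hq0 hq s)).ne'
  exact (hc.integral_hasStrictDerivAt 0 θ).hasDerivAt

theorem ellipticF_zero : ellipticF q 0 = 0 := by simp [ellipticF]

theorem ellipticF_strictMono (hq0 : 0 ≤ q) (hq : q < 1) : StrictMono (ellipticF q) := by
  refine strictMono_of_deriv_pos fun θ => ?_
  rw [(hasDerivAt_ellipticF hq0 hq θ).deriv]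
  exact one_div_pos.mpr (Real.sqrt_pos.mpr (one_sub_mul_sin_sq_pos hq0 hq θ))

theorem ellipticF_add_pi (hq0 : 0 ≤ q) (hq : q < 1) (θ : ℝ) :
    ellipticF q (θ + Real.pi) = ellipticF q θ + ellipticF q Real.pi := by
  have hd : ∀ θ, HasDerivAt (fun θ => ellipticF q (θ + Real.pi) - ellipticF q θ) 0 θ := by
    intro θ
    refine (((hasDerivAt_ellipticF hq0 hq (θ + Real.pi)).comp_add_const θ Real.pi).sub
      (hasDerivAt_ellipticF hq0 hq θ)).congr_deriv ?_
    rw [Real.sin_add_pi, neg_sq, sub_self]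
  have := is_const_of_deriv_eq_zero (fun y => (hd y).differentiableAt) (fun y => (hd y).deriv) θ 0
  simp only [zero_add, ellipticF_zero, sub_zero] at this
  linarith

theorem ellipticF_pi (hq0 : 0 ≤ q) (hq : q < 1) : ellipticF q Real.pi = 2 * ellipticK q := by
  have hd : ∀ θ, HasDerivAt (fun θ => ellipticF q (Real.pi - θ) + ellipticF q θ) 0 θ := by
    intro θ
    refine (((hasDerivAt_ellipticF hq0 hq (Real.pi - θ)).comp_const_sub Real.pi θ).add
      (hasDerivAt_ellipticF hq0 hq θ)).congr_deriv ?_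
    rw [Real.sin_pi_sub, neg_add_cancel]
  have := is_const_of_deriv_eq_zero (fun y => (hd y).differentiableAt) (fun y => (hd y).deriv) 0
    (Real.pi / 2)
  simp only [ellipticF_zero, sub_zero, sub_half, add_zero] at this
  rw [this]
  simp only [ellipticF, ellipticK]
  ring

theorem ellipticF_int_mul_pi (hq0 : 0 ≤ q) (hq : q < 1) (n : ℤ) :
    ellipticF q (n * Real.pi) = n * (2 * ellipticK q) := by
  induction n using Int.induction_on with
  | zero => simp [ellipticF_zero]
  | succ n ih =>
    rw [show (((n : ℤ) + 1 : ℤ) : ℝ) * Real.pi = ((n : ℤ) : ℝ) * Real.pi + Real.pi by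
      push_cast; ring, ellipticF_add_pi hq0 hq, ih, ellipticF_pi hq0 hq]
    push_cast; ring
  | pred n ih =>
    have h := ellipticF_add_pi hq0 hq ((-(n : ℤ) - 1 : ℤ) * Real.pi)
    rw [show ((-(n : ℤ) - 1 : ℤ) : ℝ) * Real.pi + Real.pi = ((-(n : ℤ) : ℤ) : ℝ) * Real.pi by
      push_cast; ring, ih, ellipticF_pi hq0 hq] at h
    push_cast at h ⊢; linarith

/-- The integrand is at least 1, so F(θ) - θ is monotone and F is unbounded in both directions. -/
theorem ellipticF_surjective (hq0 : 0 ≤ q) (hq : q < 1) : Function.Surjective (ellipticF q) := by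
  have hc : Continuous (ellipticF q) :=
    continuous_iff_continuousAt.mpr fun θ => (hasDerivAt_ellipticF hq0 hq θ).continuousAt
  have hm : Monotone (fun θ => ellipticF q θ - θ) := by
    refine monotone_of_deriv_nonneg (fun θ => ?_) fun θ => ?_
    · exact ((hasDerivAt_ellipticF hq0 hq θ).sub (hasDerivAt_id θ)).differentiableAt
    · rw [((hasDerivAt_ellipticF hq0 hq θ).fun_sub (hasDerivAt_id' θ)).deriv, sub_nonneg]
      have hp := one_sub_mul_sin_sq_pos hq0 hq θ
      rw [le_div_iff₀ (Real.sqrt_pos.mpr hp), one_mul, Real.sqrt_le_iff]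
      exact ⟨zero_le_one, by nlinarith [sq_nonneg (Real.sin θ)]⟩
  refine hc.surjective ?_ ?_
  · refine Filter.tendsto_atTop_mono' _ ?_ Filter.tendsto_id
    filter_upwards [Filter.eventually_ge_atTop 0] with θ hθ
    have := hm hθ
    simp only [ellipticF_zero] at this
    simp only [id]; linarith
  · refine Filter.tendsto_atBot_mono' _ ?_ Filter.tendsto_id
    filter_upwards [Filter.eventually_le_atBot 0] with θ hθ
    have := hm hθ
    simp only [ellipticF_zero] at this
    simp only [id]; linarith

theorem ellipticK_pos (hq0 : 0 ≤ q) (hq : q < 1) : 0 < ellipticK q := by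
  have h := ellipticF_strictMono hq0 hq (half_pos Real.pi_pos)
  rw [ellipticF_zero] at h
  exact h

/-- The Jacobi amplitude, the inverse function of the elliptic integral. -/
theorem exists_amplitude (hq0 : 0 ≤ q) (hq : q < 1) (r : ℝ) :
    ∃ θ : ℝ → ℝ, (∀ y, HasDerivAt θ (r * √(1 - q * Real.sin (θ y) ^ 2)) y) ∧
      ∀ y, ellipticF q (θ y) = r * y := by
  set e := (ellipticF_strictMono hq0 hq).orderIsoOfSurjective _ (ellipticF_surjective hq0 hq)
    with he
  have hee : ∀ y, ellipticF q (e.symm y) = y := fun y => e.apply_symm_apply y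
  refine ⟨fun y => e.symm (r * y), fun y => ?_, fun y => hee _⟩
  have h1 : HasDerivAt e.symm (1 / √(1 - q * Real.sin (e.symm (r * y)) ^ 2))⁻¹ (r * y) := by
    refine HasDerivAt.of_local_left_inverse e.symm.continuous.continuousAt
      (hasDerivAt_ellipticF hq0 hq _) ?_ (Filter.Eventually.of_forall hee)
    exact (one_div_pos.mpr (Real.sqrt_pos.mpr (one_sub_mul_sin_sq_pos hq0 hq _))).ne'
  have h2 := h1.comp y ((hasDerivAt_id y).const_mul r)
  refine h2.congr_deriv ?_
  rw [one_div, inv_inv, mul_one, mul_comm]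

end Elliptic

/-- The roots of the cubic of the energy equation. -/
theorem root_relations {a m : ℝ} (ha : 0 < a) (hm : 0 < m) :
    0 < a2Const a m ∧ 0 < a3Const a m ∧
    betaConst a m = 2 * (a2Const a m - a3Const a m + a) ∧
    a2Const a m * a3Const a m = a * (a2Const a m - a3Const a m) := by
  set s := betaConst a m / 2 - a with hs
  have hs0 : 0 < s := by
    rw [hs, betaConst]
    have : 0 < m ^ 2 / a ^ 2 := by positivity
    linarith
  have hn : 0 ≤ s ^ 2 + 4 * a * s := by positivity
  have hq := Real.mul_self_sqrt hn
  have hlt : s < √(s ^ 2 + 4 * a * s) := by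
    apply Real.lt_sqrt_of_sq_lt
    have : 0 < 4 * a * s := by positivity
    linarith
  have e2 : a2Const a m = (s + √(s ^ 2 + 4 * a * s)) / 2 := rfl
  have e3 : a3Const a m = (-s + √(s ^ 2 + 4 * a * s)) / 2 := rfl
  rw [e2, e3]
  refine ⟨by linarith, by linarith, by linarith, ?_⟩
  linear_combination hq / 4

/-- The solution of the equation of the conformal factor has smallest period twice
`halfPeriod`. -/
theorem periodic_of_second_order {a m : ℝ} (ha : 0 < a) (hm : 0 < m) (ha2 : a2Const a m < a)
    {w w₁ : ℝ → ℝ} (hw0 : w 0 = a) (hw0' : w₁ 0 = 0) (h1 : ∀ y, HasDerivAt w (w₁ y) y)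
    (h2 : ∀ y, HasDerivAt w₁ (4 * betaConst a m * w y - 12 * w y ^ 2) y) :
    0 < halfPeriod a m ∧ (∀ y, w (y + 2 * halfPeriod a m) = w y) ∧
      ∀ b, w b = a → ∃ n : ℤ, b = n * (2 * halfPeriod a m) := by
  obtain ⟨p2, p3, hβ, hr23⟩ := root_relations ha hm
  set a₂ := a2Const a m
  set a₃ := a3Const a m with ha₃
  have hσ : 0 < a + a₃ := by linarith
  have hδ : 0 < a - a₂ := by linarith
  set q := modulusSq a m with hqdef
  have hqe : q = (a - a₂) / (a + a₃) := rfl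
  have hqm : q * (a + a₃) = a - a₂ := by rw [hqe]; field_simp
  have hq0 : 0 ≤ q := by rw [hqe]; positivity
  have hq1 : q < 1 := by rw [hqe, div_lt_one hσ]; linarith
  set r := √(2 * (a + a₃)) with hr
  have hr0 : 0 < r := Real.sqrt_pos.mpr (by linarith)
  have hrr : r * r = 2 * (a + a₃) := Real.mul_self_sqrt (by linarith)
  have hT : halfPeriod a m = ellipticK q / r := rfl
  obtain ⟨θ, hθ, hF⟩ := exists_amplitude hq0 hq1 r
  have hinj := (ellipticF_strictMono hq0 hq1).injective
  have hθ0 : θ 0 = 0 := hinj (by rw [hF, mul_zero, ellipticF_zero])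
  set g : ℝ → ℝ := fun y => r * √(1 - q * Real.sin (θ y) ^ 2) with hg
  have hgg : ∀ y, g y * g y = 2 * (a + a₃) - 2 * (a - a₂) * Real.sin (θ y) ^ 2 := by
    intro y
    have hp := Real.mul_self_sqrt (one_sub_mul_sin_sq_pos hq0 hq1 (θ y)).le
    simp only [hg]
    linear_combination (√(1 - q * Real.sin (θ y) ^ 2) * √(1 - q * Real.sin (θ y) ^ 2)) * hrr +
      2 * (a + a₃) * hp - 2 * Real.sin (θ y) ^ 2 * hqm
  have hsin : ∀ y, HasDerivAt (fun y => Real.sin (θ y)) (Real.cos (θ y) * g y) y := fun y =>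
    (hθ y).sin
  have hcos : ∀ y, HasDerivAt (fun y => Real.cos (θ y)) (-Real.sin (θ y) * g y) y := fun y =>
    (hθ y).cos
  have hgd : ∀ y, HasDerivAt g (-2 * (a - a₂) * Real.sin (θ y) * Real.cos (θ y)) y := by
    intro y
    have hp := one_sub_mul_sin_sq_pos hq0 hq1 (θ y)
    have h := ((((hsin y).pow 2).const_mul q).const_sub 1).sqrt hp.ne' |>.const_mul r
    refine h.congr_deriv ?_
    have hs0 := (Real.sqrt_pos.mpr hp).ne'
    simp only [hg, Pi.pow_apply]
    set S := √(1 - q * Real.sin (θ y) ^ 2)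
    norm_num
    field_simp
    linear_combination (-(Real.sin (θ y) * Real.cos (θ y))) * (q * hrr + 2 * hqm)
  -- The explicit solution: v runs between the roots a (at sin θ = 0) and a₂ (at cos θ = 0) of the
  -- cubic, and θ' = g.
  set v : ℝ → ℝ := fun y => a - (a - a₂) * Real.sin (θ y) ^ 2 with hv
  set v₁ : ℝ → ℝ := fun y => -2 * (a - a₂) * (Real.sin (θ y) * Real.cos (θ y) * g y) with hv₁
  have hvd : ∀ y, HasDerivAt v (v₁ y) y := by
    intro y
    refine ((((hsin y).pow 2).const_mul (a - a₂)).const_sub a).congr_deriv ?_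
    simp only [hv₁]
    push_cast
    ring
  have hvd2 : ∀ y, HasDerivAt v₁ (4 * betaConst a m * v y - 12 * v y ^ 2) y := by
    intro y
    refine ((((hsin y).mul (hcos y)).mul (hgd y)).const_mul (-2 * (a - a₂))).congr_deriv ?_
    have hc : Real.cos (θ y) ^ 2 = 1 - Real.sin (θ y) ^ 2 := Real.cos_sq' _
    simp only [hv, hβ, Pi.mul_apply]
    linear_combination (-2 * (a - a₂) * (Real.cos (θ y) ^ 2 - Real.sin (θ y) ^ 2)) * hgg y + 4 * hr23
      + (-2 * (a - a₂) * (2 * (a + a₃) - 4 * (a - a₂) * Real.sin (θ y) ^ 2)) * hc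
  have hwv : ∀ y, w y = v y := by
    intro y
    have hwc : Continuous w := continuous_iff_continuousAt.mpr fun y => (h1 y).continuousAt
    have hvc : Continuous v := continuous_iff_continuousAt.mpr fun y => (hvd y).continuousAt
    -- The difference of two solutions solves a linear equation, since w² - v² = (w + v)(w - v).
    have := eq_zero_of_linear_second_order (e := fun y => w y - v y) (e₁ := fun y => w₁ y - v₁ y)
      (k := fun y => 4 * betaConst a m - 12 * (w y + v y)) (by fun_prop)
      (fun y => (h1 y).sub (hvd y))
      (fun y => ((h2 y).sub (hvd2 y)).congr_deriv (by ring))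
      (by simp [hv, hw0, hθ0]) (by simp [hv₁, hw0', hθ0]) y
    linarith
  have hT0 : 0 < halfPeriod a m := by rw [hT]; exact div_pos (ellipticK_pos hq0 hq1) hr0
  have hrT : r * halfPeriod a m = ellipticK q := by rw [hT]; field_simp
  refine ⟨hT0, fun y => ?_, fun b hb => ?_⟩
  · have hθT : θ (y + 2 * halfPeriod a m) = θ y + Real.pi := by
      apply hinj
      rw [hF, ellipticF_add_pi hq0 hq1, ellipticF_pi hq0 hq1, hF]
      linear_combination 2 * hrT
    rw [hwv, hwv]
    simp only [hv, hθT, Real.sin_add_pi, neg_sq]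
  · rw [hwv] at hb
    -- The value a is attained only where sin θ = 0, that is at θ = nπ, and F(nπ) = 2nK pins down b.
    have hs : Real.sin (θ b) = 0 := by
      have : (a - a₂) * Real.sin (θ b) ^ 2 = 0 := by simp only [hv] at hb; linarith
      exact pow_eq_zero_iff (two_ne_zero) |>.mp ((mul_eq_zero.mp this).resolve_left hδ.ne')
    obtain ⟨n, hn⟩ := Real.sin_eq_zero_iff.mp hs
    refine ⟨n, ?_⟩
    have := hF b
    rw [← hn, ellipticF_int_mul_pi hq0 hq1, ← hrT] at this
    apply mul_left_cancel₀ hr0.ne'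
    linear_combination -this

/-! ### Periods -/

section PhaseSum

variable {w w₁ : ℝ → ℝ} {c : ℂ} {d : Fin 3 → ℝ} {β : ℝ}

/-- By Vieta and the energy equation, ∏(d_j w - ρ) = ρ(w'² + 4 (Im c)²)/4. So the integrands add up
to the derivative of an arctangent. Its use is that the total phase vanishes wherever w' does. -/
theorem sum_gFun (hsp : IsSpectrum d β c.re) (him : c.im ≠ 0)
    (h1 : ∀ y, HasDerivAt w (w₁ y) y)
    (h2 : ∀ y, HasDerivAt w₁ (4 * β * w y - 12 * w y ^ 2) y)
    (hE : ∀ y, w₁ y ^ 2 = 4 * β * w y ^ 2 - 8 * w y ^ 3 - 4 * (c.re ^ 2 + c.im ^ 2))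
    (hne : ∀ j y, d j * w y - c.re ≠ 0) (h0 : w₁ 0 = 0) (y : ℝ) :
    ∑ j, gFun w c (d j) y = Real.arctan (w₁ y / (2 * c.im)) := by
  have hd : ∀ y, HasDerivAt
      (fun y => gFun w c (d 0) y + gFun w c (d 1) y + gFun w c (d 2) y -
        Real.arctan (w₁ y / (2 * c.im))) 0 y := by
    intro y
    refine ((((hasDerivAt_gFun h1 (hne 0) y).add (hasDerivAt_gFun h1 (hne 1) y)).add
      (hasDerivAt_gFun h1 (hne 2) y)).sub ((h2 y).div_const (2 * c.im)).arctan).congr_deriv ?_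
    have n0 := hne 0 y
    have n1 := hne 1 y
    have n2 := hne 2 y
    have hρ := hsp.ne_zero
    have hE' := hE y
    have hpos : w₁ y ^ 2 + 4 * c.im ^ 2 ≠ 0 := by positivity
    have hprod : (d 0 * w y - c.re) * (d 1 * w y - c.re) * (d 2 * w y - c.re) =
        c.re * (w₁ y ^ 2 + 4 * c.im ^ 2) / 4 := by
      rw [hE']
      linear_combination w y ^ 3 * hsp.prod - w y ^ 2 * c.re * hsp.pair + w y * c.re ^ 2 * hsp.sum
    have hsum : d 0 * (d 1 * w y - c.re) * (d 2 * w y - c.re) +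
        d 1 * (d 0 * w y - c.re) * (d 2 * w y - c.re) +
        d 2 * (d 0 * w y - c.re) * (d 1 * w y - c.re) = c.re * (2 * β * w y - 6 * w y ^ 2) := by
      linear_combination 3 * w y ^ 2 * hsp.prod - 2 * w y * c.re * hsp.pair + c.re ^ 2 * hsp.sum
    have e1 : d 0 * c.im / (d 0 * w y - c.re) + d 1 * c.im / (d 1 * w y - c.re) +
        d 2 * c.im / (d 2 * w y - c.re) = c.im * (c.re * (2 * β * w y - 6 * w y ^ 2)) /
          (c.re * (w₁ y ^ 2 + 4 * c.im ^ 2) / 4) := by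
      rw [← hprod, ← hsum, div_add_div _ _ n0 n1, div_add_div _ _ (mul_ne_zero n0 n1) n2]
      congr 1; ring
    have e2 : 1 / (1 + (w₁ y / (2 * c.im)) ^ 2) * ((4 * β * w y - 12 * w y ^ 2) / (2 * c.im)) =
        c.im * (c.re * (2 * β * w y - 6 * w y ^ 2)) / (c.re * (w₁ y ^ 2 + 4 * c.im ^ 2) / 4) := by
      have h3 : 1 + (w₁ y / (2 * c.im)) ^ 2 = (w₁ y ^ 2 + 4 * c.im ^ 2) / (4 * c.im ^ 2) := by
        field_simp; ring
      rw [h3]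
      field_simp
      ring
    rw [e1, e2, sub_self]
  have := is_const_of_deriv_eq_zero (fun y => (hd y).differentiableAt) (fun y => (hd y).deriv) y 0
  simp only [gFun, intervalIntegral.integral_same, h0, zero_div, Real.arctan_zero, add_zero,
    sub_zero] at this
  rw [Fin.sum_univ_three]
  simp only [gFun]
  linarith

theorem gFun_add_int_mul {s p : ℝ} (h1 : ∀ y, HasDerivAt w (w₁ y) y)
    (hne : ∀ y, s * w y - c.re ≠ 0) (hp : ∀ y, w (y + p) = w y) (y : ℝ) (n : ℤ) :
    gFun w c s (y + n * p) = gFun w c s y + n * gFun w c s p := by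
  have hone : ∀ y, gFun w c s (y + p) = gFun w c s y + gFun w c s p := by
    intro y
    have hd : ∀ y, HasDerivAt (fun y => gFun w c s (y + p) - gFun w c s y) 0 y := by
      intro y
      refine (((hasDerivAt_gFun h1 hne (y + p)).comp_add_const y p).sub
        (hasDerivAt_gFun h1 hne y)).congr_deriv ?_
      rw [hp, sub_self]
    have := is_const_of_deriv_eq_zero (fun y => (hd y).differentiableAt) (fun y => (hd y).deriv) y 0
    have hz : gFun w c s 0 = 0 := by simp [gFun]
    simp only [zero_add, hz, sub_zero] at this
    linarith
  induction n using Int.induction_on with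
  | zero => simp
  | succ n ih =>
    rw [show y + (((n : ℤ) + 1 : ℤ) : ℝ) * p = (y + ((n : ℤ) : ℝ) * p) + p by push_cast; ring, hone,
      ih]
    push_cast; ring
  | pred n ih =>
    have h := hone (y + ((-(n : ℤ) - 1 : ℤ) : ℝ) * p)
    rw [show y + ((-(n : ℤ) - 1 : ℤ) : ℝ) * p + p = y + ((-(n : ℤ) : ℤ) : ℝ) * p by
      push_cast; ring, ih] at h
    push_cast at h ⊢; linarith

end PhaseSum

/-! ### Periods of the surface and the rationality conditions -/

section Torus

variable {f : ℂ → ℙ ℂ (Fin 3 → ℂ)} {F : ℂ → Fin 3 → ℂ} {w : ℝ → ℝ} {c : ℂ} {d : Fin 3 → ℝ} {β p : ℝ}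
  {m : Fin 3 → Fin 3 → ℂ}

theorem hFun_eq_hFun_iff {s y y' : ℝ} (hs : s ≠ 0) (h0 : s ^ 3 - c.re ≠ 0)
    (hy : 0 < (s * w y - c.re) / (s ^ 3 - c.re)) (hy' : 0 < (s * w y' - c.re) / (s ^ 3 - c.re)) :
    hFun w c s y = hFun w c s y' ↔ w y = w y' := by
  rw [hFun, hFun, Real.sqrt_inj hy.le hy'.le, div_left_inj' h0, sub_left_inj, mul_right_inj' hs]

/-- The phases of a period. -/
theorem phases_of_period (hF1 : ∀ z, hdot (F z) (F z) = 1) (hFf : ∀ z, F z ∈ (f z).submodule)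
    (hsp : IsSpectrum d β c.re)
    (hpos : ∀ j y, 0 < (d j * w y - c.re) / (d j ^ 3 - c.re))
    (hform : ∀ (x y : ℝ) (j : Fin 3), hdot (F (x + y * Complex.I)) (m j) =
      (hFun w c (d j) y : ℂ) * Complex.exp (Complex.I * (d j * x) + Complex.I * gFun w c (d j) y))
    (hper : ∀ b, w b = w 0 → ∃ n : ℤ, b = n * p)
    (hG : ∀ j y (n : ℤ), gFun w c (d j) (y + n * p) = gFun w c (d j) y + n * gFun w c (d j) p)
    (hsum : ∑ j, gFun w c (d j) p = 0) {o : ℂ} (ho : f o = f 0) :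
    ∃ n : ℤ, o.im = n * p ∧
      ∀ j, ∃ k : ℤ, 3 * (d j * o.re + n * gFun w c (d j) p) = 2 * Real.pi * k := by
  have hz : ∀ j, gFun w c (d j) 0 = 0 := fun j => by simp [gFun]
  have hFo : F o = hdot (F o) (F 0) • F 0 :=
    eq_hdot_smul_of_mem_submodule (by rw [← ho]; exact hFf o) (hFf 0) (hF1 0)
  set χ := hdot (F o) (F 0) with hχ
  have hχ1 : ‖χ‖ = 1 := by
    have h := hF1 o
    rw [hFo, hdot_smul_left, hdot_smul_right, hF1, mul_one, Complex.mul_conj,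
      Complex.normSq_eq_norm_sq] at h
    have h' : ‖χ‖ ^ 2 = 1 := by exact_mod_cast h
    exact (pow_eq_one_iff_of_nonneg (norm_nonneg _) two_ne_zero).mp h'
  have key : ∀ j, (hFun w c (d j) o.im : ℂ) *
      Complex.exp (Complex.I * (d j * o.re) + Complex.I * gFun w c (d j) o.im) =
      χ * hFun w c (d j) 0 := by
    intro j
    have h1 := hform o.re o.im j
    have h2 := hform 0 0 j
    rw [Complex.re_add_im, hFo, hdot_smul_left] at h1
    simp only [Complex.ofReal_zero, zero_mul, add_zero, mul_zero, hz, Complex.exp_zero,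
      mul_one] at h2
    rw [← h1, h2]
  have hnorm : ∀ t : ℝ, ‖Complex.exp (Complex.I * t)‖ = 1 := fun t => by
    rw [mul_comm]; exact Complex.norm_exp_ofReal_mul_I t
  -- Comparing moduli of one coordinate suffices, as h_0 determines w.
  have hw0 : w o.im = w 0 := by
    have hnn : ∀ y, 0 ≤ hFun w c (d 0) y := fun y => Real.sqrt_nonneg _
    have h := congrArg norm (key 0)
    have e : Complex.I * (d 0 * o.re) + Complex.I * gFun w c (d 0) o.im =
        Complex.I * ((d 0 * o.re + gFun w c (d 0) o.im : ℝ) : ℂ) := by push_cast; ring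
    rw [norm_mul, norm_mul, e, hnorm, hχ1, mul_one, one_mul, Complex.norm_real, Complex.norm_real,
      Real.norm_of_nonneg (hnn _), Real.norm_of_nonneg (hnn _)] at h
    exact (hFun_eq_hFun_iff (hsp.d_ne_zero 0) (sub_ne_zero.mpr (hsp.cube_ne 0)) (hpos 0 _)
      (hpos 0 _)).mp h
  obtain ⟨n, hn⟩ := hper _ hw0
  refine ⟨n, hn, ?_⟩
  have hexp : ∀ j, Complex.exp (Complex.I * ((d j * o.re + n * gFun w c (d j) p : ℝ) : ℂ)) = χ := by
    intro j
    have h := key j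
    have e1 : gFun w c (d j) o.im = n * gFun w c (d j) p := by
      have := hG j 0 n
      rw [zero_add, hz, zero_add] at this
      rw [hn, this]
    have e2 : hFun w c (d j) o.im = hFun w c (d j) 0 := by rw [hFun, hFun, hw0]
    have e3 : (hFun w c (d j) 0 : ℂ) ≠ 0 := by exact_mod_cast (Real.sqrt_pos.mpr (hpos j 0)).ne'
    rw [e1, e2, mul_comm] at h
    rw [← mul_right_cancel₀ e3 h]
    congr 1
    push_cast; ring
  -- The three phases are congruent modulo 2π and add up to zero, so the common factor χ is a cube
  -- root of unity. This is the origin of the factor 3.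
  have hχ3 : χ ^ 3 = 1 := by
    have hs := hsum
    rw [Fin.sum_univ_three] at hs
    have e : χ ^ 3 = χ * χ * χ := by ring
    rw [e]
    nth_rewrite 1 [← hexp 0]
    nth_rewrite 1 [← hexp 1]
    rw [← hexp 2, ← Complex.exp_add, ← Complex.exp_add, ← mul_add, ← mul_add, ← Complex.ofReal_add,
      ← Complex.ofReal_add]
    have : d 0 * o.re + n * gFun w c (d 0) p + (d 1 * o.re + n * gFun w c (d 1) p) +
        (d 2 * o.re + n * gFun w c (d 2) p) = 0 := by
      linear_combination o.re * hsp.sum + n * hs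
    rw [this]; simp
  intro j
  have h := hχ3
  rw [← hexp j, ← Complex.exp_nat_mul, Complex.exp_eq_one_iff] at h
  obtain ⟨k, hk⟩ := h
  refine ⟨k, ?_⟩
  have h2 : Complex.I * ((3 * (d j * o.re + n * gFun w c (d j) p) : ℝ) : ℂ) =
      Complex.I * ((2 * Real.pi * k : ℝ) : ℂ) := by
    push_cast at hk ⊢
    linear_combination hk
  exact_mod_cast mul_left_cancel₀ Complex.I_ne_zero h2

/-- If the phases are themselves multiples of 2π, every coordinate is unchanged, so even the lift F
is periodic. -/
theorem period_of_phases (hF1 : ∀ z, hdot (F z) (F z) = 1) (hFf : ∀ z, F z ∈ (f z).submodule)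
    (hm : ∀ j k, hdot (m j) (m k) = if j = k then 1 else 0)
    (hform : ∀ (x y : ℝ) (j : Fin 3), hdot (F (x + y * Complex.I)) (m j) =
      (hFun w c (d j) y : ℂ) * Complex.exp (Complex.I * (d j * x) + Complex.I * gFun w c (d j) y))
    (hw : ∀ y (n : ℤ), w (y + n * p) = w y)
    (hG : ∀ j y (n : ℤ), gFun w c (d j) (y + n * p) = gFun w c (d j) y + n * gFun w c (d j) p)
    {a : ℝ} {n : ℤ} (hk : ∀ j, ∃ k : ℤ, d j * a + n * gFun w c (d j) p = 2 * Real.pi * k) (z : ℂ) :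
    f (z + (a + (n * p : ℝ) * Complex.I)) = f z := by
  have hne : F z ≠ 0 := by
    intro h
    have := hF1 z
    rw [h] at this
    simp [hdot] at this
  have hF : F (z + (a + (n * p : ℝ) * Complex.I)) = F z := by
    rw [eq_sum_of_orthonormal hm (F (z + _)), eq_sum_of_orthonormal hm (F z)]
    refine Finset.sum_congr rfl fun j _ => ?_
    congr 1
    obtain ⟨k, hk⟩ := hk j
    have h1 := hform (z.re + a) (z.im + n * p) j
    have h2 := hform z.re z.im j
    rw [Complex.re_add_im] at h2
    have e : z + (a + (n * p : ℝ) * Complex.I) =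
        ((z.re + a : ℝ) : ℂ) + ((z.im + n * p : ℝ) : ℂ) * Complex.I := by
      conv_lhs => rw [← Complex.re_add_im z]
      push_cast; ring
    rw [e, h1, h2, hG]
    have e2 : hFun w c (d j) (z.im + n * p) = hFun w c (d j) z.im := by rw [hFun, hFun, hw]
    rw [e2]
    congr 1
    rw [Complex.exp_eq_exp_iff_exists_int]
    refine ⟨k, ?_⟩
    have hk' : ((d j * a + n * gFun w c (d j) p : ℝ) : ℂ) = ((2 * Real.pi * k : ℝ) : ℂ) := by
      rw [hk]
    push_cast at hk' ⊢
    linear_combination Complex.I * hk'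
  exact eq_of_mem_submodule hne (by rw [← hF]; exact hFf _) (hFf z)

theorem linearIndependent_pair_iff_det {a b : ℂ} :
    LinearIndependent ℝ ![a, b] ↔ a.re * b.im - b.re * a.im ≠ 0 := by
  rw [LinearIndependent.pair_iff]
  constructor
  · intro h h0
    have key : ∀ s t : ℝ, s * a.re + t * b.re = 0 → s * a.im + t * b.im = 0 → s = 0 ∧ t = 0 := by
      intro s t h1 h2
      refine h s t (Complex.ext ?_ ?_) <;> simpa using by assumption
    obtain ⟨h1, h2⟩ := key b.im (-a.im) (by linarith) (by ring)
    obtain ⟨h3, h4⟩ := key b.re (-a.re) (by ring) (by rw [h1, neg_eq_zero.mp h2]; ring)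
    have := (key 1 0 (by rw [neg_eq_zero.mp h4]; ring) (by rw [neg_eq_zero.mp h2]; ring)).1
    exact one_ne_zero this
  · intro h s t hst
    have h1 := congrArg Complex.re hst
    have h2 := congrArg Complex.im hst
    simp only [Complex.add_re, Complex.add_im, Complex.smul_re, Complex.smul_im, smul_eq_mul,
      Complex.zero_re, Complex.zero_im] at h1 h2
    constructor
    · refine (mul_eq_zero.mp (?_ : s * (a.re * b.im - b.re * a.im) = 0)).resolve_right h
      linear_combination b.im * h1 - b.re * h2
    · refine (mul_eq_zero.mp (?_ : t * (a.re * b.im - b.re * a.im) = 0)).resolve_right h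
      linear_combination a.re * h2 - a.im * h1

theorem descendsToTorus_iff (hF1 : ∀ z, hdot (F z) (F z) = 1) (hFf : ∀ z, F z ∈ (f z).submodule)
    (hm : ∀ j k, hdot (m j) (m k) = if j = k then 1 else 0) (hsp : IsSpectrum d β c.re)
    (hpos : ∀ j y, 0 < (d j * w y - c.re) / (d j ^ 3 - c.re))
    (hform : ∀ (x y : ℝ) (j : Fin 3), hdot (F (x + y * Complex.I)) (m j) =
      (hFun w c (d j) y : ℂ) * Complex.exp (Complex.I * (d j * x) + Complex.I * gFun w c (d j) y))
    (hp : p ≠ 0) (hw : ∀ y (n : ℤ), w (y + n * p) = w y)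
    (hper : ∀ b, w b = w 0 → ∃ n : ℤ, b = n * p)
    (hG : ∀ j y (n : ℤ), gFun w c (d j) (y + n * p) = gFun w c (d j) y + n * gFun w c (d j) p)
    (hsum : ∑ j, gFun w c (d j) p = 0) :
    DescendsToTorus f ↔ (∃ q : ℚ, d 0 / d 1 = (q : ℝ)) ∧
      (∃ q : ℚ, 1 / (2 * Real.pi) * (d 1 / d 0 * gFun w c (d 0) p - gFun w c (d 1) p) =
        (q : ℝ)) := by
  have hd0 := hsp.d_ne_zero 0
  have hd1 := hsp.d_ne_zero 1
  have hπ := Real.pi_ne_zero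
  constructor
  · rintro ⟨ω₁, ω₂, hli, hω₁, hω₂⟩
    obtain ⟨n₁, hn₁, hk₁⟩ := phases_of_period hF1 hFf hsp hpos hform hper hG hsum
      (by simpa using hω₁ 0)
    obtain ⟨n₂, hn₂, hk₂⟩ := phases_of_period hF1 hFf hsp hpos hform hper hG hsum
      (by simpa using hω₂ 0)
    choose k₁ hk₁ using hk₁
    choose k₂ hk₂ using hk₂
    rw [linearIndependent_pair_iff_det, hn₁, hn₂] at hli
    -- The determinant of the two periods is p Δ, because both imaginary parts are integer multiples
    -- of p.
    set Δ := ω₁.re * n₂ - ω₂.re * n₁ with hΔdef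
    have hΔ : Δ ≠ 0 := fun h0 => hli (by linear_combination p * (hΔdef.symm.trans h0))
    -- Combining the phase relations of both periods eliminates G_j(p): each d_j is an integer K_j
    -- times one common nonzero constant, which makes the ratios rational.
    have hK : ∀ j, 3 * d j * Δ = 2 * Real.pi * (k₁ j * n₂ - k₂ j * n₁ : ℤ) := by
      intro j
      push_cast
      linear_combination n₂ * hk₁ j - n₁ * hk₂ j
    have hK0 : ∀ j, ((k₁ j * n₂ - k₂ j * n₁ : ℤ) : ℝ) ≠ 0 := fun j h0 => by
      have := hK j
      rw [h0, mul_zero] at this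
      exact mul_ne_zero (mul_ne_zero three_ne_zero (hsp.d_ne_zero j)) hΔ this
    generalize hKe : (fun j => k₁ j * n₂ - k₂ j * n₁) = K at *
    have hKe' : ∀ j, k₁ j * n₂ - k₂ j * n₁ = K j := fun j => congrFun hKe j
    simp only [hKe'] at hK hK0
    have hratio : d 0 * K 1 = d 1 * K 0 := by
      apply mul_left_cancel₀ (mul_ne_zero two_ne_zero hπ)
      linear_combination d 1 * hK 0 - d 0 * hK 1
    refine ⟨⟨K 0 / K 1, ?_⟩, ?_⟩
    · push_cast
      rw [div_eq_div_iff hd1 (hK0 1), hratio, mul_comm]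
    -- For one period with n ≠ 0, subtracting the relation for j = 1 from K₁/K₀ times that for j = 0
    -- eliminates the real part a. One of the two independent periods has n ≠ 0, since Δ ≠ 0.
    · have aux : ∀ (a : ℝ) (n : ℤ) (k : Fin 3 → ℤ), n ≠ 0 →
          (∀ j, 3 * (d j * a + n * gFun w c (d j) p) = 2 * Real.pi * k j) →
          ∃ q : ℚ, 1 / (2 * Real.pi) * (d 1 / d 0 * gFun w c (d 0) p - gFun w c (d 1) p) =
            (q : ℝ) := by
        intro a n k hn hk
        refine ⟨((K 1 / K 0) * k 0 - k 1) / (3 * n), ?_⟩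
        have hn' : (n : ℝ) ≠ 0 := by exact_mod_cast hn
        have hκ : d 1 / d 0 = K 1 / K 0 := by
          rw [div_eq_div_iff hd0 (hK0 0), ← hratio, mul_comm]
        have hκd : (K 1 / K 0 : ℝ) * d 0 = d 1 := by rw [← hκ, div_mul_cancel₀ _ hd0]
        push_cast
        rw [hκ, one_div_mul_eq_div, div_eq_div_iff (mul_ne_zero two_ne_zero hπ)
          (mul_ne_zero three_ne_zero hn')]
        linear_combination (K 1 / K 0 : ℝ) * hk 0 - hk 1 - 3 * a * hκd
      by_cases h1 : n₁ = 0
      · refine aux _ n₂ k₂ ?_ hk₂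
        rintro rfl
        exact hΔ (by rw [hΔdef, h1]; simp)
      · exact aux _ n₁ k₁ h1 hk₁
  · rintro ⟨⟨q, hq⟩, ⟨Q, hQ⟩⟩
    have hqd : (q.den : ℝ) ≠ 0 := by exact_mod_cast q.den_nz
    have hQd : (Q.den : ℝ) ≠ 0 := by exact_mod_cast Q.den_nz
    have hq' : d 0 * q.den = d 1 * q.num := by
      rw [Rat.cast_def, div_eq_div_iff hd1 hqd] at hq
      rw [hq, mul_comm]
    have hQ' : Q.den * (d 1 / d 0 * gFun w c (d 0) p - gFun w c (d 1) p) =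
        2 * Real.pi * Q.num := by
      rw [Rat.cast_def, one_div_mul_eq_div, div_eq_div_iff (mul_ne_zero two_ne_zero hπ) hQd] at hQ
      linear_combination hQ
    have hs := hsp.sum
    rw [Fin.sum_univ_three] at hsum
    -- Both ∑ d_j and ∑ G_j(p) vanish, so the third phase is minus the sum of the other two and
    -- needs no condition.
    have hthird : ∀ (a : ℝ) (n k₀ k₁ : ℤ),
        d 0 * a + n * gFun w c (d 0) p = 2 * Real.pi * k₀ →
        d 1 * a + n * gFun w c (d 1) p = 2 * Real.pi * k₁ → ∀ z,
        f (z + (a + (n * p : ℝ) * Complex.I)) = f z := by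
      intro a n k₀ k₁ h0 h1
      refine period_of_phases hF1 hFf hm hform hw hG fun j => ?_
      fin_cases j
      · exact ⟨k₀, h0⟩
      · exact ⟨k₁, h1⟩
      · refine ⟨-k₀ - k₁, ?_⟩
        push_cast
        linear_combination a * hs + n * hsum - h0 - h1
    -- The first period is real, with phases 2π·num q and 2π·den q by d₀/d₁ = q. The second advances
    -- y by den Q periods of w, its real part cancels the phase of j = 0, and the phase of j = 1 is
    -- then -2π·num Q.
    refine ⟨_, _, ?_, hthird (2 * Real.pi * q.den / d 1) 0 q.num q.den ?_ ?_,
      hthird (-(Q.den * gFun w c (d 0) p / d 0)) Q.den 0 (-Q.num) ?_ ?_⟩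
    · rw [linearIndependent_pair_iff_det]
      simp only [Complex.add_re, Complex.add_im, Complex.ofReal_re, Complex.ofReal_im,
        Complex.re_ofReal_mul, Complex.im_ofReal_mul, Complex.I_re, Complex.I_im, Int.cast_zero,
        zero_mul, mul_zero, mul_one, add_zero, zero_add, sub_zero, Int.cast_natCast]
      positivity
    · rw [Int.cast_zero, zero_mul, add_zero, mul_div_assoc', div_eq_iff hd1]
      linear_combination 2 * Real.pi * hq'
    · rw [Int.cast_zero, zero_mul, add_zero, mul_div_cancel₀ _ hd1]
      push_cast; ring
    · push_cast
      field_simp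
      ring
    · push_cast
      have e : d 1 * -(Q.den * gFun w c (d 0) p / d 0) =
        -(Q.den * (d 1 / d 0 * gFun w c (d 0) p)) := by ring
      rw [e]
      linear_combination -hQ'

end Torus

end MinLag
end

/-- `f` is a translationally equivariant minimal Lagrangian surface with metric `2 e^u dz dz̄` and
Hopf differential `-i λ⁻³ ψ dz³`, i.e. with cubic form `c = λ⁻³ ψ` (evaluated at `0`). The origin
is chosen as usual, with `u'(0) = 0` and `a₂ < a₁ = e^{u(0)}`, so that `f` is not flat and
`u` has its maximum over `y` at `0`. The `i d_j` are the eigenvalues of `D(λ)`, in any order. -/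
theorem mainTheorem8
    (f : ℂ → ℙ ℂ (Fin 3 → ℂ)) (u : ℂ → ℝ) (ψ : ℂ → ℂ) (lam : ℂ) (hlam : ‖lam‖ = 1)
    (hf : MinLag.IsMinimalLagrangian f u)
    (hHopf : MinLag.HasHopfDifferential f (fun z => -Complex.I * (lam ^ 3)⁻¹ * ψ z))
    (hequiv : MinLag.IsTranslationallyEquivariant f)
    (hu : MinLag.dY u 0 = 0)
    (ha : MinLag.a2Const (Real.exp (u 0)) ‖ψ 0‖ < Real.exp (u 0))
    (c : ℂ) (hc : c = (lam ^ 3)⁻¹ * ψ 0) (him : c.im ≠ 0) (hre : c.re ≠ 0)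
    (T : ℝ) (hT : T = MinLag.halfPeriod (Real.exp (u 0)) ‖ψ 0‖)
    (w : ℝ → ℝ) (hw : ∀ y : ℝ, w y = Real.exp (u (y * Complex.I)))
    (d : Fin 3 → ℝ)
    (hd : (MinLag.matD lam (u 0) (ψ 0)).charpoly =
      ∏ j, (Polynomial.X - Polynomial.C (Complex.I * (d j : ℂ)))) :
    (∃ Fr, MinLag.IsFrame f u ψ lam Fr) ∧
    (∀ j y, d j * w y - c.re ≠ 0 ∧ 0 < (d j * w y - c.re) / (d j ^ 3 - c.re)) ∧
    (∀ Fr, MinLag.IsFrame f u ψ lam Fr →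
      ∃ l : Fin 3 → Fin 3 → ℂ,
        (∀ j k, MinLag.hdot (l j) (l k) = if j = k then 1 else 0) ∧
        (∀ j, (MinLag.matD lam (u 0) (ψ 0)).mulVec (l j) = (Complex.I * (d j : ℂ)) • l j) ∧
        ∀ x y : ℝ, MinLag.canonicalLift Fr (x + y * Complex.I) =
          (Fr 0).mulVec (∑ j, ((MinLag.hFun w c (d j) y : ℂ) *
            Complex.exp (Complex.I * (d j * x) + Complex.I * MinLag.gFun w c (d j) y)) • l j)) ∧
    (MinLag.DescendsToTorus f ↔
      (∃ q : ℚ, d 0 / d 1 = (q : ℝ)) ∧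
      (∃ q : ℚ, 1 / (2 * Real.pi) *
        (d 1 / d 0 * MinLag.gFun w c (d 0) (2 * T) - MinLag.gFun w c (d 1) (2 * T)) =
          (q : ℝ))) := by
  obtain ⟨H, hH⟩ := MinLag.exists_isConformalLift hf.1
  have hmin := hf.2
  have hus := hH.contDiff_u
  have hl0 : lam ≠ 0 := by rintro rfl; simp at hlam
  have hnc : ‖c‖ = ‖ψ 0‖ := by rw [hc, norm_mul, norm_inv, norm_pow, hlam]; simp
  have hm2 : ‖ψ 0‖ ^ 2 = c.re ^ 2 + c.im ^ 2 := by
    rw [← hnc, ← Complex.normSq_eq_norm_sq, Complex.normSq_apply]; ring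
  have hm : 0 < ‖ψ 0‖ := by
    rw [← hnc, norm_pos_iff]
    rintro rfl
    exact him rfl
  have hφ : ∀ z, MinLag.hdot (MinLag.dZ (MinLag.dZ H) z) (MinLag.dZbar H z) =
      -Complex.I * c := by
    intro z
    rw [hHopf _ hH.lift]
    simp only
    rw [hH.psi_const hmin hequiv hlam hHopf, hc, mul_assoc]
  have hw0 : w 0 = Real.exp (u 0) := by rw [hw]; simp
  have hwpos : ∀ y, 0 < w y := fun y => by rw [hw]; exact Real.exp_pos _
  set w₁ : ℝ → ℝ := fun y => Real.exp (u (y * Complex.I)) * MinLag.dY u (y * Complex.I) with hw₁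
  have hw₁0 : w₁ 0 = 0 := by simp [hw₁, hu]
  have h1 : ∀ y, HasDerivAt w (w₁ y) y := MinLag.hasDerivAt_w hus hw
  have h2 := MinLag.hasDerivAt_w₁ hH hmin hequiv hφ hw
  rw [hnc] at h2
  have hE := MinLag.energy_of_gauss hwpos h1 h2 hw₁0
  have h3 := MinLag.second_order_of_gauss hwpos h1 h2 hw₁0
  rw [hw0] at hE h3
  have hsp := MinLag.isSpectrum_of_charpoly hlam hc him hre hd
  have hne : ∀ j y, d j * w y - c.re ≠ 0 := fun j y => hsp.mul_sub_ne_zero him hm2 (hE y) j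
  have hform := fun Fr (hFr : MinLag.IsFrame f u ψ lam Fr) =>
    MinLag.canonicalLift_formula hH hmin hequiv hlam hHopf hu hc hsp hw hne hd hFr
  obtain ⟨Fr, hFr⟩ := MinLag.exists_isFrame hf hHopf hlam
  obtain ⟨hpos, l, hl, -, hF⟩ := hform Fr hFr
  refine ⟨⟨Fr, hFr⟩, fun j y => ⟨hne j y, hpos j y⟩, fun Fr hFr => (hform Fr hFr).2, ?_⟩
  obtain ⟨hT0, hper, hper'⟩ :=
    MinLag.periodic_of_second_order (Real.exp_pos _) hm ha hw0 hw₁0 h1 h3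
  rw [← hT] at hT0 hper hper'
  have hFl := hFr.isHorizontalLift.1.2
  have hperiodic : Function.Periodic w (2 * T) := hper
  refine MinLag.descendsToTorus_iff (m := fun j => (Fr 0).mulVec (l j)) (fun z => (hFl z).1)
    (fun z => (hFl z).2) (fun j k => ?_) hsp hpos (fun x y j => ?_) (by positivity)
    (fun y n => hperiodic.int_mul n y) (fun b hb => hper' b (hb.trans hw0))
    (fun j => MinLag.gFun_add_int_mul h1 (hne j) hper) ?_
  · rw [MinLag.hdot_mulVec_mulVec (hFr.conjTranspose_mul 0), hl]
  · rw [hF, MinLag.hdot_mulVec_mulVec (hFr.conjTranspose_mul 0), MinLag.hdot_sum_left]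
    simp only [MinLag.hdot_smul_left, hl, mul_ite, mul_one, mul_zero, Finset.sum_ite_eq',
      Finset.mem_univ, if_true]
  -- Since w(2T) = w(0), the energy equation gives w'(2T)² = w'(0)² = 0, so the arctangent in the
  -- phase sum is zero there.
  · have hw₁T : w₁ (2 * T) = 0 := by
      have hT' := hper 0
      rw [zero_add] at hT'
      have e := hE (2 * T)
      rw [hT', ← hE 0, hw₁0] at e
      exact pow_eq_zero_iff two_ne_zero |>.mp (e.trans (by ring))
    rw [MinLag.sum_gFun hsp him h1 h3 (fun y => by rw [hE, hm2]) hne hw₁0, hw₁T, zero_div,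
      Real.arctan_zero]
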